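/- Fix an integer $m\ge 2$ and let $X_0^*$ be a random variable with values in $\{1,2,3,\dots\}$ and $\mathbb P(X_0^*\ge 2)>0$. For $p\in[0,1]$ let $X_0$ have law $(1-p)\delta_0+p\,P_{X_0^*}$, that is, $\mathbb P(X_0=0)=1-p$ and $\mathbb P(X_0=j)=p\,\mathbb P(X_0^*=j)$ for $j\ge 1$, and define recursively, for $n\ge 0$, (the law of) $X_{n+1}:=(X_{n,1}+\dots+X_{n,m}-1)^+$, where $X_{n,1},\dots,X_{n,m}$ are independent copies of $X_n$ and $a^+=\max\{a,0\}$. Suppose that $\mathbb E(s^{X_0^*})$ converges absolutely for every real $s$ with $|s|<m$. Then for every $p\in[0,1]$ all $\mathbb E(X_n)$ are finite and the free energy $$F_\infty(p):=\lim_{n\to\infty}\frac{\mathbb E(X_n)}{m^n}$$ exists. The functions $p\mapsto \mathbb E(X_0)$ and $p\mapsto\mathbb P(X_n=0)$, $n\ge 0$, are $C^\infty$ on $[0,1]$, and $F_\infty\in C^\infty[0,1]$ (derivatives at the endpoints being one-sided). For every integer $k\ge 0$ and every $p\in[0,1]$, $$F_\infty^{(k)}(p)=\frac{d^k}{dp^k}\Big(\mathbb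 E(X_0)-\frac1{m-1}\Big)+\sum_{n=0}^\infty\frac1{m^{n+1}}\,\frac{d^k}{dp^k}\,\mathbb P(X_n=0)^m ,$$ where the series converges absolutely for each $p$, and its partial sums converge uniformly in $p\in[0,1]$. -/

import Mathlib

open MeasureTheory Set Filter Topology
open scoped ContDiff

/-!
The Derrida-Retaux system, described through the laws of the variables `X n`.
Throughout, `ν` is the law on `ℕ` of the variable `X₀*`.
-/

namespace DerridaRetaux

noncomputable section

/-- The law `(1 - p) δ₀ + p ν` of `X₀`. -/
def initLaw (ν : Measure ℕ) (p : ℝ) : Measure ℕ :=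
  ENNReal.ofReal (1 - p) • Measure.dirac 0 + ENNReal.ofReal p • ν

/-- The law of `(Y₁ + ⋯ + Yₘ - 1)⁺`, where `Y₁, …, Yₘ` are independent with law `μ`.
Truncated subtraction on `ℕ` is the positive part. -/
def step (m : ℕ) (μ : Measure ℕ) : Measure ℕ :=
  (Measure.pi fun _ : Fin m => μ).map fun y => (∑ i, y i) - 1

/-- The law of `X n` for the system with parameter `p`. -/
def law (m : ℕ) (ν : Measure ℕ) (p : ℝ) : ℕ → Measure ℕ
  | 0 => initLaw ν p
  | n + 1 => step m (law m ν p n)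

/-- The expectation of `X n`. -/
def mean (m : ℕ) (ν : Measure ℕ) (n : ℕ) (p : ℝ) : ℝ :=
  ∫ x, (x : ℝ) ∂(law m ν p n)

/-- The probability of the event `X n = 0`. -/
def probZero (m : ℕ) (ν : Measure ℕ) (n : ℕ) (p : ℝ) : ℝ :=
  (law m ν p n).real {0}

/-- The free energy: the limit of `E (X n) / m ^ n` as `n → ∞`. -/
def freeEnergy (m : ℕ) (ν : Measure ℕ) (p : ℝ) : ℝ :=
  limUnder atTop fun n : ℕ => mean m ν n p / (m : ℝ) ^ n

/-- The `n`-th term `m ^ (-(n + 1)) · dᵏ/dpᵏ P(X n = 0) ^ m` of the series of `k`-th derivatives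
(derivatives within `[0, 1]`, hence one-sided at the endpoints). -/
def term (m : ℕ) (ν : Measure ℕ) (k n : ℕ) (p : ℝ) : ℝ :=
  1 / (m : ℝ) ^ (n + 1) * iteratedDerivWithin k (fun q => probZero m ν n q ^ m) (Icc 0 1) p

end

end DerridaRetaux

/-!
The mean satisfies `E X (n+1) = m E X n - 1 + P(X n = 0) ^ m`, so the free energy is, up to the
affine function `E X 0 - 1 / (m - 1)` of `p`, the sum of the series of `m ^ (-(n+1)) P(X n = 0) ^ m`.
Each `P(X n = 0)` is a polynomial in `p` (`zeroPoly`), and everything reduces to showing that for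
every `k` the `k`-th derivative of `P(X n = 0) ^ m` is at most `C (3 / 2) ^ n` on `[0, 1]`, with `C`
depending on `k`. As `3 / 2 < m`, each series of `k`-th derivatives then converges normally, and the
series can be differentiated term by term.

By Cauchy's estimate it is enough that, for every `κ > 0`, the polynomial `P(X n = 0)` is bounded by
`2` on complex discs of radius `c exp (-κ n)` centred on `[0, 1]`. This is
`exists_norm_coeff_zero_le`, and it has three ingredients.

* Perturbation. When `p` moves to `p + z` with `z` complex, the generating series of `X n` moves by
  `(X - 1) β n`, where `β` satisfies a recursion (`perturb`, `lawSeries_add`). In a norm with weights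
  `s ^ min j (N - n)`, one step multiplies `β` essentially by `(m / s) G ^ (m - 1)`, where
  `G = E s ^ min (X n) (N - n)`.
* Explosion. If `P(X k > j)` is at least `2 / m ^ j` for some `j`, then `O(log n)` steps after time
  `k + j` the variable exceeds `n` with probability at least `1 / 2`
  (`half_le_iterate_step_real_gt`). At such a time the law below height `n` has mass at most
  `1 / 2`, a small complex perturbation of it has total variation at most `1` there, and this bound
  propagates up to time `n` (`norm_coeff_zero_le_one`). Until `O(log n)` steps before the first such
  time, the tails are at most `2 / m ^ j` (`tail_le_of_lt_half`).
* Growth. For a system with such tails, the product of the factors `(m / s) G ^ (m - 1)` up to time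
  `N` is at most `C exp (κ N)`, if `s < m` is close enough to `m` (`exists_prod_le`). The reason is
  that the functional `Θ = E s ^ X (1 - (s - 1) X - λ X (X + 1))`, with `λ = (m - 1) (m - s) / m`, is
  multiplied at each step by `G ^ (m - 1)` at least, up to a small relative loss, while it is at most
  `1`. The loss is a multiple of a square `V ^ 2`, which `dev_moment_bound` bounds by a multiple of
  `Θ`; the same lemma bounds `Θ` below by a positive constant. It uses that `P(X = 1)` stays away
  from `1` when `m = 2` (`exists_law_real_one_le`), and the inequality
  `E u ^ X (1 - (u - 1) X) ≥ 0` at a second point `u` between `s` and `m`, much closer to `m`. It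
  holds except for boundedly many final steps, because otherwise this quantity would decrease at a
  fixed rate, against the a priori bound provided by the tails (`exists_forall_ex_dev_nonneg`).
-/

namespace DerridaRetaux

/-! ### Laws on `ℕ` and their generating series -/

/-- The law of `Y₁ + ⋯ + Yₘ`, where `Y₁, …, Yₘ` are independent with law `μ`. -/
noncomputable def sumLaw (m : ℕ) (μ : Measure ℕ) : Measure ℕ :=
  (Measure.pi fun _ : Fin m => μ).map fun y => ∑ i, y i

/-- The probability generating series of a law on `ℕ`. -/
noncomputable def pgf (μ : Measure ℕ) : PowerSeries ℝ := PowerSeries.mk fun j => μ.real {j}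

@[simp] lemma coeff_pgf (μ : Measure ℕ) (j : ℕ) : PowerSeries.coeff j (pgf μ) = μ.real {j} :=
  PowerSeries.coeff_mk _ _

lemma isProbabilityMeasure_initLaw (ν : Measure ℕ) [IsProbabilityMeasure ν] {p : ℝ}
    (hp : p ∈ Icc (0 : ℝ) 1) : IsProbabilityMeasure (initLaw ν p) := by
  refine ⟨?_⟩
  simp only [initLaw, Measure.coe_add, Measure.coe_smul, Pi.add_apply, Pi.smul_apply,
    measure_univ, smul_eq_mul, mul_one]
  rw [← ENNReal.ofReal_add (by linarith [hp.2]) hp.1]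
  simp

lemma isProbabilityMeasure_step (m : ℕ) (μ : Measure ℕ) [IsProbabilityMeasure μ] :
    IsProbabilityMeasure (step m μ) :=
  Measure.isProbabilityMeasure_map (Measurable.of_discrete).aemeasurable

instance isProbabilityMeasure_sumLaw (m : ℕ) (μ : Measure ℕ) [IsProbabilityMeasure μ] :
    IsProbabilityMeasure (sumLaw m μ) :=
  Measure.isProbabilityMeasure_map (Measurable.of_discrete).aemeasurable

lemma isProbabilityMeasure_law (m : ℕ) (ν : Measure ℕ) [IsProbabilityMeasure ν] {p : ℝ}
    (hp : p ∈ Icc (0 : ℝ) 1) (n : ℕ) : IsProbabilityMeasure (law m ν p n) := by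
  induction n with
  | zero => exact isProbabilityMeasure_initLaw ν hp
  | succ n ih => exact isProbabilityMeasure_step m _

lemma step_eq_map_sumLaw (m : ℕ) (μ : Measure ℕ) : step m μ = (sumLaw m μ).map (· - 1) := by
  rw [sumLaw, Measure.map_map Measurable.of_discrete Measurable.of_discrete]
  rfl

lemma sumLaw_real_singleton (m : ℕ) (μ : Measure ℕ) [IsProbabilityMeasure μ] (j : ℕ) :
    (sumLaw m μ).real {j} = PowerSeries.coeff j (pgf μ ^ m) := by
  classical
  have hprod : pgf μ ^ m = ∏ _i : Fin m, pgf μ := by simp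
  rw [hprod, PowerSeries.coeff_prod, sumLaw, map_measureReal_apply Measurable.of_discrete
    (measurableSet_singleton j)]
  have hset : (fun y : Fin m → ℕ => ∑ i, y i) ⁻¹' {j} =
      ↑((Finset.finsuppAntidiag (Finset.univ : Finset (Fin m)) j).map
        ⟨fun l : Fin m →₀ ℕ => (l : Fin m → ℕ), DFunLike.coe_injective⟩) := by
    ext y
    simp only [mem_preimage, mem_singleton_iff, Finset.coe_map, Function.Embedding.coeFn_mk,
      mem_image, Finset.mem_coe, Finset.mem_finsuppAntidiag]
    constructor
    · intro h
      exact ⟨Finsupp.equivFunOnFinite.symm y, by simpa using h, by simp⟩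
    · rintro ⟨l, ⟨h, -⟩, rfl⟩
      exact h
  rw [hset, ← sum_measureReal_singleton, Finset.sum_map]
  refine Finset.sum_congr rfl fun l _ => ?_
  simp [measureReal_def, Measure.pi_singleton, ENNReal.toReal_prod]

/-- The effect of `DerridaRetaux.step` on generating series: the coefficients of the `m`-th power
move down by one place, and those of degree `0` and `1` merge. -/
noncomputable def stepSeries {R : Type*} [CommRing R] (m : ℕ) (A : PowerSeries R) :
    PowerSeries R :=
  PowerSeries.mk fun j => if j = 0 then PowerSeries.coeff 0 (A ^ m) + PowerSeries.coeff 1 (A ^ m)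
    else PowerSeries.coeff (j + 1) (A ^ m)

lemma pgf_step (m : ℕ) (μ : Measure ℕ) [IsProbabilityMeasure μ] :
    pgf (step m μ) = stepSeries m (pgf μ) := by
  ext j
  rw [coeff_pgf, stepSeries, PowerSeries.coeff_mk, step_eq_map_sumLaw,
    map_measureReal_apply Measurable.of_discrete (measurableSet_singleton j)]
  rcases Nat.eq_zero_or_pos j with rfl | hj
  · have : (fun x : ℕ => x - 1) ⁻¹' {0} = ↑({0, 1} : Finset ℕ) := by
      ext x; simp; omega
    rw [this, ← sum_measureReal_singleton, if_pos rfl, Finset.sum_pair zero_ne_one,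
      sumLaw_real_singleton, sumLaw_real_singleton]
  · have : (fun x : ℕ => x - 1) ⁻¹' {j} = {j + 1} := by
      ext x; simp; omega
    rw [this, if_neg hj.ne', sumLaw_real_singleton]

/-- The generating series of `X n`, as a function of a parameter `p` that may be taken in any
algebra over `ℝ`: a real number, a complex number, or an indeterminate. -/
noncomputable def lawSeries {R : Type*} [CommRing R] [Algebra ℝ R] (m : ℕ) (ν : Measure ℕ)
    (p : R) : ℕ → PowerSeries R
  | 0 => PowerSeries.C (1 - p) + PowerSeries.C p * PowerSeries.map (algebraMap ℝ R) (pgf ν)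
  | n + 1 => stepSeries m (lawSeries m ν p n)

lemma map_stepSeries {R S : Type*} [CommRing R] [CommRing S] (f : R →+* S) (m : ℕ)
    (A : PowerSeries R) :
    PowerSeries.map f (stepSeries m A) = stepSeries m (PowerSeries.map f A) := by
  ext j
  have hpow : PowerSeries.map f A ^ m = PowerSeries.map f (A ^ m) := (map_pow _ _ _).symm
  simp only [stepSeries, hpow, PowerSeries.coeff_map, PowerSeries.coeff_mk]
  split_ifs <;> simp

lemma map_lawSeries {R S : Type*} [CommRing R] [Algebra ℝ R] [CommRing S] [Algebra ℝ S]
    (f : R →ₐ[ℝ] S) (m : ℕ) (ν : Measure ℕ) (p : R) (n : ℕ) :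
    PowerSeries.map (f : R →+* S) (lawSeries m ν p n) = lawSeries m ν (f p) n := by
  induction n with
  | zero =>
    ext j
    simp [lawSeries, PowerSeries.coeff_C]
  | succ n ih => rw [lawSeries, map_stepSeries, ih, lawSeries]

lemma pgf_law (m : ℕ) (ν : Measure ℕ) [IsProbabilityMeasure ν] {p : ℝ}
    (hp : p ∈ Icc (0 : ℝ) 1) (n : ℕ) : pgf (law m ν p n) = lawSeries m ν p n := by
  induction n with
  | zero =>
    ext j
    have h1 : (0 : ℝ) ≤ 1 - p := by linarith [hp.2]
    simp only [law, lawSeries, initLaw, coeff_pgf, map_add, PowerSeries.coeff_C_mul,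
      PowerSeries.coeff_C, PowerSeries.coeff_map, measureReal_def, Measure.coe_add,
      Measure.coe_smul, Pi.add_apply, Pi.smul_apply, smul_eq_mul, Algebra.algebraMap_self,
      RingHom.id_apply]
    rw [ENNReal.toReal_add (ENNReal.mul_ne_top ENNReal.ofReal_ne_top (measure_ne_top _ _))
      (ENNReal.mul_ne_top ENNReal.ofReal_ne_top (measure_ne_top _ _)), ENNReal.toReal_mul,
      ENNReal.toReal_mul, ENNReal.toReal_ofReal h1, ENNReal.toReal_ofReal hp.1]
    by_cases hj : j = 0
    · subst hj; simp
    · simp [hj, Ne.symm hj]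
  | succ n ih =>
    have := isProbabilityMeasure_law m ν hp n
    rw [law, pgf_step, ih, lawSeries]

/-- The polynomial in `p` that gives the probability of the event `X n = 0`. -/
noncomputable def zeroPoly (m : ℕ) (ν : Measure ℕ) (n : ℕ) : Polynomial ℝ :=
  PowerSeries.coeff 0 (lawSeries m ν (Polynomial.X : Polynomial ℝ) n)

lemma aeval_zeroPoly {R : Type*} [CommRing R] [Algebra ℝ R] (m : ℕ) (ν : Measure ℕ) (n : ℕ)
    (p : R) : Polynomial.aeval p (zeroPoly m ν n) = PowerSeries.coeff 0 (lawSeries m ν p n) := by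
  have h := map_lawSeries (Polynomial.aeval (R := ℝ) p) m ν Polynomial.X n
  rw [Polynomial.aeval_X] at h
  rw [← h, PowerSeries.coeff_map]
  rfl

lemma probZero_eq_eval (m : ℕ) (ν : Measure ℕ) [IsProbabilityMeasure ν] {p : ℝ}
    (hp : p ∈ Icc (0 : ℝ) 1) (n : ℕ) : probZero m ν n p = (zeroPoly m ν n).eval p := by
  rw [probZero, ← Polynomial.coe_aeval_eq_eval, aeval_zeroPoly, ← pgf_law m ν hp, coeff_pgf]

/-! ### Two test functions and a moment inequality -/

/-- The test function `j ↦ s ^ j (1 - (s - 1) j - l j (j + 1))`. It is nonincreasing, so cutting off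
large values of `X` only increases its mean, and its value at `j - 1` has a closed form that is
still valid for the truncated subtraction at `j = 0` (`dev_pred`). -/
noncomputable def dev (s l : ℝ) (j : ℕ) : ℝ := s ^ j * (1 - (s - 1) * j - l * (j * (j + 1)))

lemma dev_succ_le {s l : ℝ} (hs : 1 ≤ s) (hl : 0 ≤ l) (j : ℕ) : dev s l (j + 1) ≤ dev s l j := by
  have h : dev s l j - dev s l (j + 1) =
      s ^ j * ((j + 1) * ((s - 1) ^ 2 + l * (s * (j + 2) - j))) := by
    simp only [dev, pow_succ]; push_cast; ring
  have hj : (0 : ℝ) ≤ j := j.cast_nonneg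
  have h1 : 0 ≤ s * (j + 2) - j := by nlinarith
  have : 0 ≤ s ^ j * ((j + 1) * ((s - 1) ^ 2 + l * (s * (j + 2) - j))) := by positivity
  linarith

lemma antitone_dev {s l : ℝ} (hs : 1 ≤ s) (hl : 0 ≤ l) : Antitone (dev s l) :=
  antitone_nat_of_succ_le (dev_succ_le hs hl)

lemma dev_le_one {s l : ℝ} (hs : 1 ≤ s) (hl : 0 ≤ l) (j : ℕ) : dev s l j ≤ 1 := by
  simpa [dev] using antitone_dev hs hl (Nat.zero_le j)

/-- The integral of `(t - 1) t ^ (j - 1)` from `s` to `u`. Up to the factor `j (j + 1)` it is the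
decrease of `dev t 0 j` between `t = s` and `t = u`. -/
noncomputable def devInt (s u : ℝ) (j : ℕ) : ℝ := ∫ t in s..u, (t - 1) * t ^ (j - 1)

lemma devInt_eq (s u : ℝ) {j : ℕ} (hj : 1 ≤ j) :
    (j : ℝ) * (j + 1) * devInt s u j = dev s 0 j - dev u 0 j := by
  obtain ⟨i, rfl⟩ := Nat.exists_eq_add_of_le' hj
  have h1 : devInt s u (i + 1) = ∫ t in s..u, (t ^ (i + 1) - t ^ i) := by
    refine intervalIntegral.integral_congr fun t _ => ?_
    simp only [Nat.add_sub_cancel]; ring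
  rw [h1, intervalIntegral.integral_sub (Continuous.intervalIntegrable (by fun_prop) _ _)
    (Continuous.intervalIntegrable (by fun_prop) _ _), integral_pow, integral_pow]
  have h2 : (i : ℝ) + 1 ≠ 0 := by positivity
  have h3 : (i : ℝ) + 1 + 1 ≠ 0 := by positivity
  simp only [dev]
  push_cast
  field_simp
  ring

lemma devInt_one (s u : ℝ) : devInt s u 1 = (u - s) * (s - 1) + (u - s) ^ 2 / 2 := by
  have := devInt_eq s u le_rfl
  simp only [dev, Nat.cast_one] at this
  linarith [this]

lemma devInt_le_mul_sub {s u M : ℝ} (hs : 1 ≤ s) (hsu : s ≤ u) (hu : u ≤ M + 1) {j : ℕ} :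
    devInt s u j ≤ M * (u - s) * u ^ j := by
  have h : ∀ t ∈ Icc s u, (t - 1) * t ^ (j - 1) ≤ M * u ^ j := fun t ht => by
    have h1 : t ^ (j - 1) ≤ u ^ j :=
      (pow_le_pow_left₀ (by linarith [ht.1]) ht.2 _).trans
        (pow_le_pow_right₀ (by linarith) (Nat.sub_le _ _))
    exact mul_le_mul (by linarith [ht.2]) h1 (pow_nonneg (by linarith [ht.1]) _)
      (by linarith [ht.2])
  calc devInt s u j ≤ ∫ _t in s..u, M * u ^ j :=
        intervalIntegral.integral_mono_on hsu (Continuous.intervalIntegrable (by fun_prop) _ _)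
          (by simp) h
    _ = M * (u - s) * u ^ j := by simp; ring

lemma devInt_le_div {s u M : ℝ} (hs : 1 ≤ s) (hsu : s ≤ u) (hu : u ≤ M + 1) {j : ℕ}
    (hj : 1 ≤ j) : devInt s u j ≤ M * u ^ j / j := by
  obtain ⟨i, rfl⟩ := Nat.exists_eq_add_of_le' hj
  have h : ∀ t ∈ Icc s u, (t - 1) * t ^ (i + 1 - 1) ≤ M * t ^ i := fun t ht => by
    exact mul_le_mul_of_nonneg_right (by linarith [ht.2]) (pow_nonneg (by linarith [ht.1]) _)
  calc devInt s u (i + 1) ≤ ∫ t in s..u, M * t ^ i :=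
        intervalIntegral.integral_mono_on hsu (Continuous.intervalIntegrable (by fun_prop) _ _)
          (Continuous.intervalIntegrable (by fun_prop) _ _) h
    _ = M * ((u ^ (i + 1) - s ^ (i + 1)) / (i + 1)) := by
        rw [intervalIntegral.integral_const_mul, integral_pow]
    _ ≤ M * (u ^ (i + 1) / (i + 1)) := by
        have : 0 ≤ s ^ (i + 1) := by positivity
        have hM : 0 ≤ M := by linarith
        gcongr
        linarith
    _ = _ := by push_cast; ring

lemma pow_succ_ge_tangent {s t : ℝ} (hs : 0 ≤ s) (hst : s ≤ t) (i : ℕ) :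
    s ^ (i + 1) + (i + 1) * s ^ i * (t - s) ≤ t ^ (i + 1) := by
  induction i with
  | zero => simp
  | succ i ih =>
    have h1 : 0 ≤ s ^ i * (t - s) ^ 2 * (i + 1) := by positivity
    have h2 := mul_le_mul_of_nonneg_left ih (hs.trans hst)
    have h3 : t * (s ^ (i + 1) + (i + 1) * s ^ i * (t - s)) =
        s ^ (i + 1 + 1) + (((i + 1 : ℕ) : ℝ) + 1) * s ^ (i + 1) * (t - s)
          + s ^ i * (t - s) ^ 2 * (i + 1) := by
      push_cast; ring
    rw [pow_succ' t]
    linarith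

lemma devInt_lower {s u : ℝ} (hs : 1 ≤ s) (hsu : s ≤ u) (i : ℕ) :
    s ^ (i + 1) * ((u - s) * (s - 1) + (u - s) ^ 2 / 2) +
      (i + 1) * s ^ i * (s - 1) * (u - s) ^ 2 / 2 ≤ devInt s u (i + 2) := by
  have h : ∀ t ∈ Icc s u, s ^ (i + 1) * (t - 1) + (i + 1) * s ^ i * (s - 1) * (t - s) ≤
      (t - 1) * t ^ (i + 2 - 1) := fun t ht => by
    have h1 := mul_le_mul_of_nonneg_left (pow_succ_ge_tangent (by linarith) ht.1 i)
      (by linarith [ht.1] : 0 ≤ t - 1)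
    have h2 : 0 ≤ (i + 1) * s ^ i * (t - s) * (t - s) := by
      have : 0 ≤ t - s := by linarith [ht.1]
      positivity
    have h3 : i + 2 - 1 = i + 1 := rfl
    rw [h3]
    nlinarith
  calc _ = ∫ t in s..u, (s ^ (i + 1) * (t - 1) + (i + 1) * s ^ i * (s - 1) * (t - s)) := by
        have e1 : ∀ c : ℝ, ∫ t in s..u, (t - c) = (u - c) ^ 2 / 2 - (s - c) ^ 2 / 2 := fun c => by
          rw [intervalIntegral.integral_sub (Continuous.intervalIntegrable (by fun_prop) _ _) (by simp), integral_id]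
          simp only [intervalIntegral.integral_const, smul_eq_mul]; ring
        rw [intervalIntegral.integral_add (Continuous.intervalIntegrable (by fun_prop) _ _)
          (Continuous.intervalIntegrable (by fun_prop) _ _),
          intervalIntegral.integral_const_mul, intervalIntegral.integral_const_mul, e1, e1]
        ring
    _ ≤ _ := intervalIntegral.integral_mono_on hsu
          (Continuous.intervalIntegrable (by fun_prop) _ _)
          (Continuous.intervalIntegrable (by fun_prop) _ _) h

/-- The value `j = 1`, which for `M = 2` gives no gain of order `ε ^ 2`. Here `s = M - ε` and
`u = M - ε ^ 3`. -/
lemma devInt_one_sub_ge {M ε : ℝ} (hM : 2 ≤ M) (hε : 0 < ε) :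
    ε ^ 2 * (M - 2) / (2 * M) - M * ε ^ 3 ≤
      ((M - ε ^ 3) - (M - ε)) * ((M - ε) - 1) + ((M - ε ^ 3) - (M - ε)) ^ 2 / 2
        - (M - 1) * ε / M * (M - ε) := by
  have hM0 : M ≠ 0 := by linarith
  have h : ((M - ε ^ 3) - (M - ε)) * ((M - ε) - 1) + ((M - ε ^ 3) - (M - ε)) ^ 2 / 2
        - (M - 1) * ε / M * (M - ε) =
      ε ^ 2 * (M - 2) / (2 * M) - (M - 1) * ε ^ 3 + ε ^ 6 / 2 := by
    field_simp
    ring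
  rw [h]
  have : 0 < ε ^ 3 := by positivity
  have : 0 < ε ^ 6 := by positivity
  nlinarith

/-- For `j = i + 2`, the gain `devInt s u j` exceeds the loss `l s ^ j` due to `l = (M - 1) ε / M`, by
a margin of order `j ε ^ 2 s ^ j`. -/
lemma devInt_sub_ge {M ε : ℝ} (hM : 2 ≤ M) (hε : 0 < ε) (hεM : ε ≤ 1 / (100 * M)) (i : ℕ) :
    ((i : ℝ) + 2) * ε ^ 2 * (M - ε) ^ (i + 2) / (20 * M) ≤
      devInt (M - ε) (M - ε ^ 3) (i + 2) - (M - 1) * ε / M * (M - ε) ^ (i + 2) := by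
  have hM0 : 0 < M := by linarith
  have hε1 : ε * M ≤ 1 / 100 := by
    rw [le_div_iff₀ (by positivity)] at hεM ⊢; linarith
  have hε2 : ε ≤ 1 / 200 := by nlinarith
  have hε3 : ε ^ 3 ≤ ε := by nlinarith [mul_pos hε hε]
  have hlow := devInt_lower (s := M - ε) (u := M - ε ^ 3) (by linarith) (by linarith) i
  have h1 := devInt_one_sub_ge hM hε
  have hsi : 0 < (M - ε) ^ i := pow_pos (by linarith) _
  have hsi1 : 0 < (M - ε) ^ (i + 1) := pow_pos (by linarith) _
  have h2 := mul_le_mul_of_nonneg_left h1 hsi1.le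
  have h3 : (0 : ℝ) ≤ i := i.cast_nonneg
  have h4 : 0 ≤ ε ^ 2 * (M - 2) / (2 * M) := by
    have : 0 ≤ M - 2 := by linarith
    positivity
  have h5 := mul_nonneg hsi1.le h4
  have h6 : M * ε ^ 3 ≤ ε ^ 2 / 100 := by nlinarith [sq_nonneg ε]
  have h7 := mul_le_mul_of_nonneg_left h6 hsi1.le
  -- the quadratic gain
  have h8 : (0.8 : ℝ) * ε ^ 2 ≤ ((M - ε ^ 3) - (M - ε)) ^ 2 := by
    have : 0.9 * ε ≤ (M - ε ^ 3) - (M - ε) := by nlinarith [mul_pos hε hε]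
    nlinarith
  have h9 : (M - ε) / 3 ≤ M - ε - 1 := by linarith
  have h10 : (M - ε) / 3 * (0.8 * ε ^ 2) ≤ (M - ε - 1) * ((M - ε ^ 3) - (M - ε)) ^ 2 :=
    mul_le_mul h9 h8 (by positivity) (by linarith)
  have h11 := mul_le_mul_of_nonneg_left h10 (by positivity : 0 ≤ ((i : ℝ) + 1) * (M - ε) ^ i / 2)
  have h12 : ((i : ℝ) + 2) * ε ^ 2 * (M - ε) ^ (i + 2) / (20 * M) ≤
      ((i : ℝ) + 2) * ε ^ 2 * (M - ε) ^ (i + 1) / 20 := by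
    rw [pow_succ _ (i + 1), div_le_div_iff₀ (by positivity) (by positivity)]
    have : 0 ≤ ((i : ℝ) + 2) * ε ^ 2 * (M - ε) ^ (i + 1) := by positivity
    nlinarith
  have h13 : 0 ≤ ε ^ 2 * (M - ε) ^ (i + 1) := by positivity
  have h14 := mul_nonneg h3 h13
  rw [pow_succ _ (i + 1)] at *
  rw [pow_succ _ i] at *
  nlinarith

/-- The pointwise comparison behind the Cauchy–Schwarz step of `dev_moment_bound`. -/
lemma sq_devInt_le {M ε : ℝ} (hM : 2 ≤ M) (hε : 0 < ε) (hεM : ε ≤ 1 / (100 * M)) (i : ℕ) :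
    ((i : ℝ) + 3) * devInt (M - ε) (M - ε ^ 3) (i + 2) ^ 2 ≤
      40 * M ^ 3 * Real.exp (20 * M) * (M - ε ^ 3) ^ (i + 2) *
        (devInt (M - ε) (M - ε ^ 3) (i + 2) - (M - 1) * ε / M * (M - ε) ^ (i + 2)) := by
  have hM0 : 0 < M := by linarith
  have hε1 : ε * M ≤ 1 / 100 := by
    rw [le_div_iff₀ (by positivity)] at hεM ⊢; linarith
  have hε2 : ε ≤ 1 / 200 := by nlinarith
  have hε3 : ε ^ 3 ≤ ε := by nlinarith [mul_pos hε hε]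
  have hε4 : 0 < ε ^ 3 := by positivity
  have hJ := devInt_sub_ge hM hε hεM i
  have hI1 := devInt_le_mul_sub (M := M) (s := M - ε) (u := M - ε ^ 3) (by linarith)
    (by linarith) (by linarith) (j := i + 2)
  have hI2 := devInt_le_div (M := M) (s := M - ε) (u := M - ε ^ 3) (by linarith)
    (by linarith) (by linarith) (j := i + 2) (by omega)
  push_cast at hI2
  set I := devInt (M - ε) (M - ε ^ 3) (i + 2) with hI
  set S := (M - ε) ^ (i + 2) with hS
  set U := (M - ε ^ 3) ^ (i + 2) with hU
  have hS0 : 0 < S := pow_pos (by linarith) _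
  have hU0 : 0 < U := pow_pos (by linarith) _
  have hi : (0 : ℝ) ≤ i := i.cast_nonneg
  have hlam : (M - 1) * ε / M * S ≤ ε * S := by
    have : (M - 1) * ε / M ≤ ε := by rw [div_le_iff₀ hM0]; nlinarith
    exact mul_le_mul_of_nonneg_right this hS0.le
  have hlam0 : 0 ≤ (M - 1) * ε / M * S := by
    have : 0 ≤ M - 1 := by linarith
    positivity
  have hJ0 : 0 ≤ I - (M - 1) * ε / M * S := le_trans (by positivity) hJ
  have hI0 : 0 ≤ I := by linarith
  have hexp : 1 ≤ Real.exp (20 * M) := Real.one_le_exp (by positivity)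
  have hexp0 := Real.exp_pos (20 * M)
  rcases le_total (20 * M) (((i : ℝ) + 2) * ε) with hc | hc
  · -- the exponential growth of `u ^ j` dominates
    have h1 : ε * S ≤ ((i : ℝ) + 2) * ε ^ 2 * S / (20 * M) := by
      rw [le_div_iff₀ (by positivity)]
      have : 0 ≤ ε * S := by positivity
      nlinarith
    have h2 : I ≤ 2 * (I - (M - 1) * ε / M * S) := by linarith
    have h3 : ((i : ℝ) + 3) * I ≤ 2 * M * U := by
      rw [le_div_iff₀ (by positivity)] at hI2
      nlinarith
    calc ((i : ℝ) + 3) * I ^ 2 = (((i : ℝ) + 3) * I) * I := by ring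
      _ ≤ (2 * M * U) * (2 * (I - (M - 1) * ε / M * S)) :=
          mul_le_mul h3 h2 hI0 (by positivity)
      _ = 4 * M * (U * (I - (M - 1) * ε / M * S)) := by ring
      _ ≤ 40 * M ^ 3 * Real.exp (20 * M) * (U * (I - (M - 1) * ε / M * S)) := by
          refine mul_le_mul_of_nonneg_right ?_ (mul_nonneg hU0.le hJ0)
          have : 4 * M ≤ 40 * M ^ 3 := by nlinarith [mul_pos hM0 hM0]
          have : 40 * M ^ 3 * 1 ≤ 40 * M ^ 3 * Real.exp (20 * M) := by gcongr
          linarith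
      _ = _ := by ring
  · have h1 : U ≤ S * Real.exp (20 * M) := by
      have e1 : M - ε ^ 3 ≤ (M - ε) * Real.exp ε := by
        have := Real.add_one_le_exp ε
        nlinarith
      calc U ≤ ((M - ε) * Real.exp ε) ^ (i + 2) := pow_le_pow_left₀ (by linarith) e1 _
        _ = S * Real.exp (((i : ℝ) + 2) * ε) := by
          rw [mul_pow, ← Real.exp_nat_mul]; push_cast; rfl
        _ ≤ S * Real.exp (20 * M) := by gcongr
    have h2 : I ≤ M * ε * U := hI1.trans (by
      have : (M - ε ^ 3) - (M - ε) ≤ ε := by linarith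
      gcongr)
    calc ((i : ℝ) + 3) * I ^ 2 ≤ (2 * ((i : ℝ) + 2)) * (M * ε * U) ^ 2 := by
          gcongr; linarith
      _ = 2 * M ^ 2 * U * (((i : ℝ) + 2) * ε ^ 2) * U := by ring
      _ ≤ 2 * M ^ 2 * U * (((i : ℝ) + 2) * ε ^ 2) * (S * Real.exp (20 * M)) := by gcongr
      _ = 40 * M ^ 3 * Real.exp (20 * M) * U * (((i : ℝ) + 2) * ε ^ 2 * S / (20 * M)) := by
          field_simp; ring
      _ ≤ _ := by gcongr

/-- For `s = M - ε`, `u = M - ε ^ 3`, the two tests `dev s l - dev u 0` and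
`s ^ j (1 - (M - 1) j) - dev u 0 j`, at `j ≥ 2`, satisfy a Cauchy–Schwarz inequality whose weight
`j u ^ j` does not depend on the smaller scale `ε`. -/
lemma dev_tail_bounds {M ε : ℝ} (hM : 2 ≤ M) (hε : 0 < ε) (hεM : ε ≤ 1 / (100 * M)) {j : ℕ}
    (hj : 2 ≤ j) :
    ε ^ 2 * (j ^ 2 * (M - ε) ^ j) / (20 * M) ≤
        dev (M - ε) ((M - 1) * ε / M) j - dev (M - ε ^ 3) 0 j ∧
      ((M - ε) ^ j * (1 - (M - 1) * j) - dev (M - ε ^ 3) 0 j) ^ 2 ≤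
        40 * M ^ 3 * Real.exp (20 * M) * (j * (M - ε ^ 3) ^ j) *
          (dev (M - ε) ((M - 1) * ε / M) j - dev (M - ε ^ 3) 0 j) := by
  have hM0 : 0 < M := by linarith
  have hε1 : ε * M ≤ 1 / 100 := by
    rw [le_div_iff₀ (by positivity)] at hεM ⊢; linarith
  have hε2 : ε ≤ 1 / 200 := by nlinarith
  have hε3 : ε ^ 3 ≤ ε := by nlinarith [mul_pos hε hε]
  obtain ⟨i, rfl⟩ := Nat.exists_eq_add_of_le' hj
  have hJ := devInt_sub_ge hM hε hεM i
  have hI := sq_devInt_le hM hε hεM i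
  have hE := devInt_eq (M - ε) (M - ε ^ 3) (j := i + 2) (by omega)
  have hf : dev (M - ε) ((M - 1) * ε / M) (i + 2) = dev (M - ε) 0 (i + 2) -
      (M - 1) * ε / M * (M - ε) ^ (i + 2) * (((i + 2 : ℕ) : ℝ) * (((i + 2 : ℕ) : ℝ) + 1)) := by
    simp only [dev]; ring
  have hv : (M - ε) ^ (i + 2) * (1 - (M - 1) * ((i + 2 : ℕ) : ℝ)) = dev (M - ε) 0 (i + 2) -
      ε * ((i + 2 : ℕ) : ℝ) * (M - ε) ^ (i + 2) := by
    simp only [dev]; ring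
  rw [hf, hv]
  set a := dev (M - ε) 0 (i + 2)
  set b := dev (M - ε ^ 3) 0 (i + 2)
  set I := devInt (M - ε) (M - ε ^ 3) (i + 2)
  set S := (M - ε) ^ (i + 2)
  set U := (M - ε ^ 3) ^ (i + 2)
  have hS0 : 0 < S := pow_pos (by linarith) _
  have hU0 : 0 < U := pow_pos (by linarith) _
  have hab : a = b + ((i + 2 : ℕ) : ℝ) * (((i + 2 : ℕ) : ℝ) + 1) * I := by linarith
  rw [hab]
  push_cast
  have hi : (0 : ℝ) ≤ i := i.cast_nonneg
  set J := I - (M - 1) * ε / M * S with hJdef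
  have hJ0 : 0 ≤ J := le_trans (by positivity) hJ
  have e1 : b + ((i : ℝ) + 2) * ((i : ℝ) + 2 + 1) * I -
      (M - 1) * ε / M * S * (((i : ℝ) + 2) * ((i : ℝ) + 2 + 1)) - b =
      ((i : ℝ) + 2) * ((i : ℝ) + 3) * J := by rw [hJdef]; ring
  have e2 : b + ((i : ℝ) + 2) * ((i : ℝ) + 2 + 1) * I - ε * ((i : ℝ) + 2) * S - b =
      ((i : ℝ) + 2) * (((i : ℝ) + 3) * I - ε * S) := by ring
  rw [e1, e2]
  constructor
  · have h1 := mul_le_mul_of_nonneg_left hJ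
      (by positivity : 0 ≤ ((i : ℝ) + 2) * ((i : ℝ) + 3))
    refine le_trans ?_ h1
    rw [mul_div_assoc', div_le_div_iff_of_pos_right (by positivity)]
    have : 0 ≤ ((i : ℝ) + 2) ^ 2 * (ε ^ 2 * S) := by positivity
    nlinarith
  · have hlam : ε * S ≤ 2 * ((M - 1) * ε / M * S) := by
      have : ε ≤ 2 * ((M - 1) * ε / M) := by
        rw [mul_div_assoc', le_div_iff₀ hM0]; nlinarith
      nlinarith
    have hεS : ε * S ≤ 2 * I := by linarith
    have hεS0 : 0 < ε * S := by positivity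
    have h2 : (((i : ℝ) + 3) * I - ε * S) ^ 2 ≤ (((i : ℝ) + 3) * I) ^ 2 := by
      apply pow_le_pow_left₀ <;> nlinarith
    calc (((i : ℝ) + 2) * (((i : ℝ) + 3) * I - ε * S)) ^ 2
        = ((i : ℝ) + 2) ^ 2 * (((i : ℝ) + 3) * I - ε * S) ^ 2 := by ring
      _ ≤ ((i : ℝ) + 2) ^ 2 * (((i : ℝ) + 3) * I) ^ 2 := by gcongr
      _ = ((i : ℝ) + 2) ^ 2 * ((i : ℝ) + 3) * (((i : ℝ) + 3) * I ^ 2) := by ring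
      _ ≤ ((i : ℝ) + 2) ^ 2 * ((i : ℝ) + 3) * (40 * M ^ 3 * Real.exp (20 * M) * U * J) := by
          gcongr
      _ = _ := by ring

lemma pow_le_of_weight {M u : ℝ} (hu0 : 1 ≤ u) (hu : u ≤ M) (j : ℕ) :
    u ^ j ≤ M ^ 4 + j * u ^ j / 4 := by
  rcases le_total j 4 with h | h
  · have h1 : u ^ j ≤ M ^ j := pow_le_pow_left₀ (by linarith) hu _
    have h2 : M ^ j ≤ M ^ 4 := pow_le_pow_right₀ (by linarith) h
    have : 0 ≤ (j : ℝ) * u ^ j / 4 := by positivity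
    linarith
  · have h1 : (4 : ℝ) ≤ j := by exact_mod_cast h
    have h2 : 0 < u ^ j := by positivity
    have h3 : 0 ≤ M ^ 4 := by positivity
    nlinarith

/-- If the mean of `dev u 0` is nonnegative then the weighted first moment is bounded. -/
lemma first_moment_le {M u : ℝ} (hu0 : 7 / 4 ≤ u) (hu : u ≤ M) (S : Finset ℕ) {p : ℕ → ℝ}
    (hp : ∀ j, 0 ≤ p j) (hp1 : ∑ j ∈ S, p j = 1) (hD : 0 ≤ ∑ j ∈ S, p j * dev u 0 j) :
    ∑ j ∈ S, p j * (j * u ^ j) ≤ 2 * M ^ 4 := by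
  have h1 : ∑ j ∈ S, p j * dev u 0 j =
      ∑ j ∈ S, p j * u ^ j - (u - 1) * ∑ j ∈ S, p j * (j * u ^ j) := by
    rw [Finset.mul_sum, ← Finset.sum_sub_distrib]
    exact Finset.sum_congr rfl fun j _ => by simp only [dev]; ring
  have h2 : ∑ j ∈ S, p j * u ^ j ≤ M ^ 4 + (∑ j ∈ S, p j * (j * u ^ j)) / 4 := by
    calc ∑ j ∈ S, p j * u ^ j ≤ ∑ j ∈ S, p j * (M ^ 4 + j * u ^ j / 4) :=
          Finset.sum_le_sum fun j _ =>
            mul_le_mul_of_nonneg_left (pow_le_of_weight (by linarith) hu j) (hp j)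
      _ = _ := by
          have hc : M ^ 4 = ∑ j ∈ S, p j * M ^ 4 := by rw [← Finset.sum_mul, hp1, one_mul]
          rw [Finset.sum_div]
          conv_rhs => rw [hc, ← Finset.sum_add_distrib]
          exact Finset.sum_congr rfl fun j _ => by ring
  have h3 : 0 ≤ ∑ j ∈ S, p j * (j * u ^ j) := Finset.sum_nonneg fun j _ =>
    mul_nonneg (hp j) (mul_nonneg j.cast_nonneg (pow_nonneg (by linarith) _))
  nlinarith

lemma sum_range_add_two (B : ℕ) (f : ℕ → ℝ) :
    ∑ j ∈ Finset.range (B + 2), f j = f 0 + f 1 + ∑ i ∈ Finset.range B, f (i + 2) := by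
  rw [Finset.sum_range_succ', Finset.sum_range_succ']
  ring

lemma dev_neg_le {M s l : ℝ} (hM : 2 ≤ M) (hs : 1 ≤ s) (hsM : s ≤ M) (hl : l ≤ 1 / 2) {j : ℕ}
    (hj : 1 ≤ j) : -(2 * M * (j ^ 2 * s ^ j)) ≤ dev s l j := by
  have hj' : (1 : ℝ) ≤ j := by exact_mod_cast hj
  have h1 : 0 < s ^ j := by positivity
  have h2 : -(2 * M * (j : ℝ) ^ 2) ≤ 1 - (s - 1) * j - l * (j * (j + 1)) := by
    nlinarith [mul_nonneg (by linarith : (0 : ℝ) ≤ 1 / 2 - l)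
      (by positivity : (0 : ℝ) ≤ j * (j + 1)), mul_nonneg (by linarith : (0 : ℝ) ≤ M - s)
      (by positivity : (0 : ℝ) ≤ (j : ℝ)), mul_nonneg (by linarith : (0 : ℝ) ≤ M - 1)
      (mul_nonneg (by linarith : (0 : ℝ) ≤ (j : ℝ) - 1) (by linarith : (0 : ℝ) ≤ (j : ℝ)))]
  have h3 := mul_le_mul_of_nonneg_left h2 h1.le
  simp only [dev]
  linarith

lemma sq_add_add_le (a b c : ℝ) : (a + b + c) ^ 2 ≤ 3 * (a ^ 2 + b ^ 2 + c ^ 2) := by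
  nlinarith [sq_nonneg (a - b), sq_nonneg (a - c), sq_nonneg (b - c)]

lemma weighted_sum_le {A B x y z : ℝ} (hA : 0 ≤ A) (hB : 0 ≤ B) (hx : 0 ≤ x) (hy : 0 ≤ y)
    (hz : 0 ≤ z) : x + A * y + B * z ≤ (1 + A + B) * (x + y + z) := by
  have h1 := mul_nonneg hA hx
  have h2 := mul_nonneg hB hx
  have h3 := mul_nonneg hB hy
  have h4 := mul_nonneg hA hz
  linarith

/-- The lower bound for `Θ` when `m = 2`: either the part `t` of the second moment that comes from the
values `j ≥ 2` is small, and then the mass `p₀` at `0` is not, or it gives the gain `ε ^ 2 t / 40`. -/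
lemma quadratic_lower_of_two {ε c₀ p₀ p₁ T t Θ : ℝ} (hε : 0 < ε) (hεc : ε ≤ c₀ / 3200)
    (hε1 : ε ≤ 1) (hc₀ : 0 < c₀) (hp : 1 = p₀ + p₁ + T) (hT : T ≤ t) (hp₁ : p₁ ≤ 1 - c₀)
    (h1 : p₀ - 4 * t ≤ Θ) (h2 : ε ^ 2 * t / 40 - 4 * ε ^ 3 ≤ Θ) : c₀ / 800 * ε ^ 2 ≤ Θ := by
  have hε2 : ε ^ 2 ≤ 1 := pow_le_one₀ hε.le hε1
  rcases le_total t (c₀ / 10) with h | h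
  · have : c₀ / 800 * ε ^ 2 ≤ c₀ / 800 * 1 := by gcongr
    linarith
  · have h6 : ε ^ 2 * (c₀ / 10) ≤ ε ^ 2 * t := by gcongr
    have h7 : ε ^ 2 * ε ≤ ε ^ 2 * (c₀ / 3200) := by gcongr
    have h8 : ε ^ 3 = ε ^ 2 * ε := by ring
    linarith

/-- The lower bound for `Θ` when `m ≥ 3`. The value `1` now contributes to the gain as well. -/
lemma quadratic_lower_of_three {M ε p₀ p₁ d T t Θ : ℝ} (hM : 3 ≤ M) (hε : 0 < ε) (hε1 : ε ≤ 1)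
    (hp : 1 = p₀ + p₁ + T) (hT : T ≤ t) (hp₁ : 0 ≤ p₁) (ht : 0 ≤ t) (hd : -(M ^ 2) ≤ d)
    (h1 : p₀ + p₁ * d - 2 * M * t ≤ Θ) (h2 : ε ^ 2 * (p₁ + t) / (20 * M) ≤ Θ) :
    1 / (160 * M ^ 3) * ε ^ 2 ≤ Θ := by
  have hε2 : ε ^ 2 ≤ 1 := pow_le_one₀ hε.le hε1
  rcases le_total (p₁ + t) (1 / (8 * M ^ 2)) with h | h
  · have h4 : p₁ * -(M ^ 2) ≤ p₁ * d := mul_le_mul_of_nonneg_left hd hp₁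
    have h5 : (p₁ + t) * (8 * M ^ 2) ≤ 1 := by
      rwa [le_div_iff₀ (by positivity)] at h
    have h6 : 0 ≤ p₁ * (3 * M ^ 2 - 1) := mul_nonneg hp₁ (by nlinarith)
    have h7 : 0 ≤ t * (4 * M ^ 2 - 1 - 2 * M) := mul_nonneg ht (by nlinarith)
    have h8 : 1 / (160 * M ^ 3) ≤ 1 / 2 := by
      apply one_div_le_one_div_of_le (by norm_num)
      have : (3 : ℝ) ^ 3 ≤ M ^ 3 := pow_le_pow_left₀ (by norm_num) hM 3
      linarith
    have h9 : 1 / (160 * M ^ 3) * ε ^ 2 ≤ 1 / 2 * 1 :=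
      mul_le_mul h8 hε2 (by positivity) (by norm_num)
    linarith
  · have h6 : ε ^ 2 * (1 / (8 * M ^ 2)) / (20 * M) ≤ ε ^ 2 * (p₁ + t) / (20 * M) := by
      gcongr
    have h7 : ε ^ 2 * (1 / (8 * M ^ 2)) / (20 * M) = 1 / (160 * M ^ 3) * ε ^ 2 := by
      field_simp; norm_num
    linarith

set_option maxHeartbeats 2000000 in
/-- If the mean of `dev u 0` is nonnegative and the law is not concentrated at the value `1` in
the case `m = 2`, then the mean `Θ` of `dev s l` is at least of order `ε ^ 2`, and it controls the
square of the mean of `s ^ j (1 - (m - 1) j)` with a constant that does not depend on `ε`. -/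
lemma dev_moment_bound {m : ℕ} (hm : 2 ≤ m) {c₀ : ℝ} (hc₀ : 0 < c₀) (hc₁ : c₀ ≤ 1) :
    ∃ ε₀ > 0, ∃ c > 0, ∃ K > 0, ε₀ ≤ 1 / (100 * (m : ℝ)) ∧ ∀ ε, 0 < ε → ε ≤ ε₀ →
      ∀ (B : ℕ) (p : ℕ → ℝ), (∀ j, 0 ≤ p j) → ∑ j ∈ Finset.range (B + 2), p j = 1 →
      (m = 2 → p 1 ≤ 1 - c₀) →
      0 ≤ ∑ j ∈ Finset.range (B + 2), p j * dev (m - ε ^ 3) 0 j →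
      c * ε ^ 2 ≤ ∑ j ∈ Finset.range (B + 2), p j * dev (m - ε) ((m - 1) * ε / m) j ∧
      (∑ j ∈ Finset.range (B + 2), p j * ((m - ε) ^ j * (1 - ((m : ℝ) - 1) * j))) ^ 2 ≤
        K * ∑ j ∈ Finset.range (B + 2), p j * dev (m - ε) ((m - 1) * ε / m) j := by
  have hM : (2 : ℝ) ≤ m := by exact_mod_cast hm
  set M : ℝ := (m : ℝ) with hMdef
  have hM0 : 0 < M := by linarith
  set Cw : ℝ := 40 * M ^ 3 * Real.exp (20 * M) with hCw
  have hCw0 : 0 < Cw := by positivity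
  set c : ℝ := min (c₀ / 800) (1 / (160 * M ^ 3)) with hc
  have hc0 : 0 < c := by positivity
  set K₁ : ℝ := 3 * (1 + 4 * M ^ 2 + 2 * M ^ 4 * Cw) with hK₁
  have hK₁0 : 0 < K₁ := by positivity
  refine ⟨min (c₀ / 3200) (1 / (100 * M)), by positivity, c, hc0, K₁ * (1 + 2 / c),
    by positivity, min_le_right _ _, ?_⟩
  intro ε hε hεε B p hp hp1 hp2 hD
  have hεM : ε ≤ 1 / (100 * M) := hεε.trans (min_le_right _ _)
  have hεc : ε ≤ c₀ / 3200 := hεε.trans (min_le_left _ _)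
  have hε1 : ε * M ≤ 1 / 100 := by
    rw [le_div_iff₀ (by positivity)] at hεM ⊢; linarith
  have hε2 : ε ≤ 1 / 200 := by nlinarith
  have hε3 : ε ^ 3 ≤ ε := by nlinarith [mul_pos hε hε]
  have hε30 : 0 < ε ^ 3 := by positivity
  have hMε3 : M * ε ^ 3 ≤ ε ^ 2 / 100 := by nlinarith [sq_nonneg ε]
  have hlam : (M - 1) * ε / M ≤ ε := by rw [div_le_iff₀ hM0]; nlinarith
  have hlam0 : 0 ≤ (M - 1) * ε / M := by
    have : 0 ≤ M - 1 := by linarith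
    positivity
  have hmom := first_moment_le (M := M) (u := M - ε ^ 3) (by linarith) (by linarith) _ hp hp1 hD
  have hD1 : ∑ j ∈ Finset.range (B + 2), p j * dev (M - ε ^ 3) 0 j ≤ 1 := by
    rw [← hp1]
    exact Finset.sum_le_sum fun j _ =>
      mul_le_of_le_one_right (hp j) (dev_le_one (by linarith) le_rfl j)
  have htail := fun i : ℕ => dev_tail_bounds hM hε hεM (j := i + 2) (by omega)
  set l : ℝ := (M - 1) * ε / M with hl
  set s : ℝ := M - ε with hs
  set u : ℝ := M - ε ^ 3 with hu
  have hs1 : 1 ≤ s := by linarith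
  have hu1 : 1 ≤ u := by linarith
  set D := ∑ j ∈ Finset.range (B + 2), p j * dev u 0 j with hDdef
  set Θ := ∑ j ∈ Finset.range (B + 2), p j * dev s l j with hΘ
  set V := ∑ j ∈ Finset.range (B + 2), p j * (s ^ j * (1 - (M - 1) * j)) with hV
  -- the contributions of the values `j ≥ 2`
  set Φ := ∑ i ∈ Finset.range B, p (i + 2) * (dev s l (i + 2) - dev u 0 (i + 2)) with hΦ
  set W := ∑ i ∈ Finset.range B, p (i + 2) *
    (s ^ (i + 2) * (1 - (M - 1) * ((i + 2 : ℕ) : ℝ)) - dev u 0 (i + 2)) with hW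
  set t := ∑ i ∈ Finset.range B, p (i + 2) * (((i + 2 : ℕ) : ℝ) ^ 2 * s ^ (i + 2)) with ht
  have ht0 : 0 ≤ t := Finset.sum_nonneg fun i _ => mul_nonneg (hp _) (by positivity)
  have hΦt : ε ^ 2 * t / (20 * M) ≤ Φ := by
    rw [ht, Finset.mul_sum, Finset.sum_div]
    refine Finset.sum_le_sum fun i _ => ?_
    calc _ = p (i + 2) * (ε ^ 2 * (((i + 2 : ℕ) : ℝ) ^ 2 * s ^ (i + 2)) / (20 * M)) := by ring
      _ ≤ _ := mul_le_mul_of_nonneg_left (htail i).1 (hp _)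
  have hΦ0 : 0 ≤ Φ := le_trans (by positivity) hΦt
  have hW2 : W ^ 2 ≤ 2 * M ^ 4 * Cw * Φ := by
    have hf : ∀ i ∈ Finset.range B, 0 ≤ p (i + 2) * (dev s l (i + 2) - dev u 0 (i + 2)) :=
      fun i _ => mul_nonneg (hp _) (le_trans (by positivity) (htail i).1)
    have hg : ∀ i ∈ Finset.range B, 0 ≤ p (i + 2) * (Cw * (((i + 2 : ℕ) : ℝ) * u ^ (i + 2))) :=
      fun i _ => mul_nonneg (hp _) (by positivity)
    have h1 := Finset.sum_sq_le_sum_mul_sum_of_sq_le_mul (Finset.range B) hf hg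
      (r := fun i => p (i + 2) *
        (s ^ (i + 2) * (1 - (M - 1) * ((i + 2 : ℕ) : ℝ)) - dev u 0 (i + 2))) (fun i _ => by
        have := mul_le_mul_of_nonneg_left (htail i).2 (mul_nonneg (hp (i + 2)) (hp (i + 2)))
        calc _ = p (i + 2) * p (i + 2) * (s ^ (i + 2) * (1 - (M - 1) * ((i + 2 : ℕ) : ℝ)) -
                  dev u 0 (i + 2)) ^ 2 := by ring
          _ ≤ _ := this
          _ = _ := by ring)
    have h2 : ∑ i ∈ Finset.range B, p (i + 2) * (Cw * (((i + 2 : ℕ) : ℝ) * u ^ (i + 2))) ≤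
        Cw * (2 * M ^ 4) := by
      have h3 := sum_range_add_two B fun j => p j * (j * u ^ j)
      have h4 : 0 ≤ p 1 * (((1 : ℕ) : ℝ) * u ^ 1) := mul_nonneg (hp 1) (by positivity)
      have h5 : ∑ i ∈ Finset.range B, p (i + 2) * (Cw * (((i + 2 : ℕ) : ℝ) * u ^ (i + 2))) =
          Cw * ∑ i ∈ Finset.range B, p (i + 2) * (((i + 2 : ℕ) : ℝ) * u ^ (i + 2)) := by
        rw [Finset.mul_sum]; exact Finset.sum_congr rfl fun i _ => by ring
      rw [h5]
      refine mul_le_mul_of_nonneg_left ?_ hCw0.le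
      simp only [Nat.cast_zero, zero_mul, mul_zero, zero_add] at h3
      linarith
    have h6 := mul_le_mul_of_nonneg_left h2 hΦ0
    linarith
  -- the contribution of the value `1`
  have hf1 : dev s l 1 - dev u 0 1 = 2 * (devInt s u 1 - l * s) := by
    have := devInt_eq s u le_rfl
    simp only [dev, Nat.cast_one] at this ⊢
    linarith
  have hJ1 := devInt_one_sub_ge hM hε
  rw [← hs, ← hu, ← hl, ← devInt_one s u] at hJ1
  have hJ1' : 0 ≤ ε ^ 2 * (M - 2) / (2 * M) := by
    have : 0 ≤ M - 2 := by linarith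
    positivity
  have hf1' : -(2 * (M * ε ^ 3)) ≤ dev s l 1 - dev u 0 1 := by linarith
  have hI1 : devInt s u 1 ≤ M * ε := by
    rw [devInt_one]
    have h2 : u - s ≤ ε := by linarith
    have h3 : (u - s) * (s - 1) ≤ ε * (M - 1) :=
      mul_le_mul h2 (by linarith) (by linarith) hε.le
    have h4 : (u - s) ^ 2 ≤ ε ^ 2 := pow_le_pow_left₀ (by linarith) h2 2
    have h5 : ε ^ 2 ≤ ε := by rw [pow_two]; exact mul_le_of_le_one_left hε.le (by linarith)
    linarith
  have hw1 : (s ^ 1 * (1 - (M - 1) * ((1 : ℕ) : ℝ)) - dev u 0 1) ^ 2 ≤ (2 * M * ε) ^ 2 := by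
    have h1 : s ^ 1 * (1 - (M - 1) * ((1 : ℕ) : ℝ)) - dev u 0 1 = 2 * devInt s u 1 - ε * s := by
      have := devInt_eq s u le_rfl
      simp only [dev, Nat.cast_one, hs] at this ⊢
      linarith
    rw [h1]
    have h2 : 0 ≤ devInt s u 1 := by
      rw [devInt_one]
      have : 0 ≤ u - s := by linarith
      have : 0 ≤ s - 1 := by linarith
      positivity
    have h3 : ε * s ≤ M * ε := by rw [mul_comm M]; gcongr; linarith
    have h4 : 0 ≤ ε * s := by positivity
    exact sq_le_sq' (by linarith) (by linarith)
  have hp1le : p 1 ≤ 1 := by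
    rw [← hp1]
    exact Finset.single_le_sum (fun j _ => hp j) (by simp)
  have hΘD : Θ = D + p 1 * (dev s l 1 - dev u 0 1) + Φ := by
    rw [hΘ, hDdef, sum_range_add_two, sum_range_add_two, hΦ]
    simp only [mul_sub, Finset.sum_sub_distrib, dev, pow_zero, Nat.cast_zero]
    ring
  have hVD : V = D + p 1 * (s ^ 1 * (1 - (M - 1) * ((1 : ℕ) : ℝ)) - dev u 0 1) + W := by
    rw [hV, hDdef, sum_range_add_two, sum_range_add_two, hW]
    simp only [mul_sub (p _), Finset.sum_sub_distrib, dev, pow_zero, Nat.cast_zero]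
    ring
  -- the lower bound for `Θ`
  have hΘc : c * ε ^ 2 ≤ Θ := by
    have hcc₀ : c ≤ c₀ / 800 := min_le_left _ _
    have hcM : c ≤ 1 / (160 * M ^ 3) := min_le_right _ _
    have hε2sq : ε ^ 2 ≤ 1 := by nlinarith
    have hT1 : ∑ i ∈ Finset.range B, p (i + 2) ≤ t := by
      refine Finset.sum_le_sum fun i _ => le_mul_of_one_le_right (hp _) ?_
      have h1 : (1 : ℝ) ≤ ((i + 2 : ℕ) : ℝ) ^ 2 := by
        exact_mod_cast Nat.one_le_pow _ _ (by omega)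
      exact one_le_mul_of_one_le_of_one_le h1 (one_le_pow₀ hs1)
    have hp0 := sum_range_add_two B p
    rw [hp1] at hp0
    have hΘlow : p 0 + p 1 * dev s l 1 - 2 * M * t ≤ Θ := by
      rw [hΘ, sum_range_add_two]
      have h1 : -(2 * M * t) ≤ ∑ i ∈ Finset.range B, p (i + 2) * dev s l (i + 2) := by
        rw [ht, Finset.mul_sum, ← Finset.sum_neg_distrib]
        refine Finset.sum_le_sum fun i _ => ?_
        have := mul_le_mul_of_nonneg_left (dev_neg_le (l := l) hM hs1 (by linarith)
          (by linarith) (j := i + 2) (by omega)) (hp (i + 2))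
        linarith
      have h2 : dev s l 0 = 1 := by simp [dev]
      rw [h2]
      linarith
    rcases hm.eq_or_lt with h2 | h3
    · have hM2 : M = 2 := by rw [hMdef, ← h2]; norm_num
      have hdev1 : dev s l 1 = 0 := by
        simp only [dev, hs, hl, hM2]; push_cast; ring
      have h5 : -(4 * ε ^ 3) ≤ p 1 * (dev s l 1 - dev u 0 1) := by
        have e1 := mul_le_mul_of_nonneg_left hf1' (hp 1)
        have e2 : p 1 * (2 * (M * ε ^ 3)) ≤ 1 * (2 * (M * ε ^ 3)) := by gcongr
        have e3 : 2 * (M * ε ^ 3) = 4 * ε ^ 3 := by rw [hM2]; ring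
        rw [e3] at e1 e2
        linarith
      rw [hdev1, hM2] at hΘlow
      rw [hM2] at hΦt
      refine le_trans (by gcongr) (quadratic_lower_of_two hε hεc (by linarith) hc₀ hp0 hT1
        (hp2 h2.symm) (by linarith) (by linarith))
    · have hM3 : (3 : ℝ) ≤ M := by rw [hMdef]; exact_mod_cast h3
      have hf3 : ε ^ 2 / (20 * M) ≤ dev s l 1 - dev u 0 1 := by
        have e1 : ε ^ 2 / 6 ≤ ε ^ 2 * (M - 2) / (2 * M) := by
          rw [div_le_div_iff₀ (by positivity) (by positivity)]
          have : ε ^ 2 * (2 * M) ≤ ε ^ 2 * (6 * (M - 2)) :=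
            mul_le_mul_of_nonneg_left (by linarith) (sq_nonneg ε)
          linarith
        have e2 : ε ^ 2 / (20 * M) ≤ ε ^ 2 / 20 := by
          gcongr; linarith
        have e3 : 0 ≤ ε ^ 2 := sq_nonneg ε
        linarith
      have hdev1 : -(M ^ 2) ≤ dev s l 1 := by
        simp only [dev, Nat.cast_one, pow_one]
        have e1 : -M ≤ 1 - (s - 1) * 1 - l * (1 * (1 + 1)) := by linarith
        have e2 := mul_le_mul_of_nonneg_left e1 (by linarith : 0 ≤ s)
        have e3 : s * M ≤ M * M := by gcongr; linarith
        linarith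
      have h4 := mul_le_mul_of_nonneg_left hf3 (hp 1)
      have h9 : ε ^ 2 * (p 1 + t) / (20 * M) =
        p 1 * (ε ^ 2 / (20 * M)) + ε ^ 2 * t / (20 * M) := by ring
      refine le_trans (by gcongr) (quadratic_lower_of_three hM3 hε (by linarith) hp0 hT1
        (hp 1) ht0 hdev1 hΘlow (by linarith))
  refine ⟨hΘc, ?_⟩
  set w₁ := s ^ 1 * (1 - (M - 1) * ((1 : ℕ) : ℝ)) - dev u 0 1
  have h1 : V ^ 2 ≤ 3 * (D ^ 2 + (p 1 * w₁) ^ 2 + W ^ 2) := by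
    rw [hVD]
    exact sq_add_add_le _ _ _
  have h2 : (p 1 * w₁) ^ 2 ≤ 4 * M ^ 2 * ε ^ 2 := by
    have e1 : p 1 ^ 2 ≤ 1 := pow_le_one₀ (hp 1) hp1le
    calc (p 1 * w₁) ^ 2 = p 1 ^ 2 * w₁ ^ 2 := mul_pow _ _ _
      _ ≤ 1 * (2 * M * ε) ^ 2 := by gcongr
      _ = _ := by ring
  have h3 : D ^ 2 ≤ D := by rw [pow_two]; exact mul_le_of_le_one_left hD hD1
  have h4 : V ^ 2 ≤ K₁ * (D + ε ^ 2 + Φ) := by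
    have e1 := weighted_sum_le (by positivity : 0 ≤ 4 * M ^ 2)
      (by positivity : 0 ≤ 2 * M ^ 4 * Cw) hD (sq_nonneg ε) hΦ0
    rw [hK₁, mul_assoc]
    linarith
  have h5 : D + Φ ≤ Θ + ε ^ 2 := by
    have e1 := mul_le_mul_of_nonneg_left hf1' (hp 1)
    have e2 : p 1 * (2 * (M * ε ^ 3)) ≤ 1 * (2 * (M * ε ^ 3)) := by gcongr
    have e3 : 0 ≤ ε ^ 2 := sq_nonneg ε
    linarith
  have h6 : ε ^ 2 ≤ Θ / c := by
    rw [le_div_iff₀ hc0]; linarith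
  calc V ^ 2 ≤ K₁ * (D + ε ^ 2 + Φ) := h4
    _ ≤ K₁ * (Θ + 2 * (Θ / c)) := by
        refine mul_le_mul_of_nonneg_left ?_ hK₁0.le
        linarith
    _ = K₁ * (1 + 2 / c) * Θ := by ring

/-! ### Polynomial generating functions -/

/-- The expectation of `h` under the law whose generating function is the polynomial `g`. The
range of summation is longer than needed so that it always contains `0` and `1`. -/
noncomputable def ex (g : Polynomial ℝ) (h : ℕ → ℝ) : ℝ :=
  ∑ j ∈ Finset.range (g.natDegree + 2), g.coeff j * h j

lemma ex_eq_sum_range (g : Polynomial ℝ) (h : ℕ → ℝ) {K : ℕ} (hK : g.natDegree < K) :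
    ex g h = ∑ j ∈ Finset.range K, g.coeff j * h j := by
  have key : ∀ L, g.natDegree < L → ∑ j ∈ Finset.range L, g.coeff j * h j =
      ∑ j ∈ Finset.range (g.natDegree + 1), g.coeff j * h j := fun L hL => by
    refine (Finset.sum_subset (Finset.range_mono hL) fun j _ hj => ?_).symm
    rw [Polynomial.coeff_eq_zero_of_natDegree_lt (by simpa using hj), zero_mul]
  rw [ex, key _ (by omega), key K hK]

lemma ex_add_left (g₁ g₂ : Polynomial ℝ) (h : ℕ → ℝ) : ex (g₁ + g₂) h = ex g₁ h + ex g₂ h := by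
  obtain ⟨K, hK⟩ : ∃ K, K = g₁.natDegree + g₂.natDegree + (g₁ + g₂).natDegree + 1 := ⟨_, rfl⟩
  rw [ex_eq_sum_range (K := K) _ _ (by omega), ex_eq_sum_range (K := K) _ _ (by omega),
    ex_eq_sum_range (K := K) _ _ (by omega), ← Finset.sum_add_distrib]
  exact Finset.sum_congr rfl fun j _ => by rw [Polynomial.coeff_add]; ring

lemma ex_monomial (n : ℕ) (a : ℝ) (h : ℕ → ℝ) : ex (Polynomial.monomial n a) h = a * h n := by
  rw [ex_eq_sum_range (K := n + 1) _ _
    (Nat.lt_succ_of_le (Polynomial.natDegree_monomial_le a)), Finset.sum_eq_single n]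
  · simp
  · intro j _ hj; simp [Polynomial.coeff_monomial, hj.symm]
  · simp

lemma ex_add (g : Polynomial ℝ) (h₁ h₂ : ℕ → ℝ) :
    ex g (fun j => h₁ j + h₂ j) = ex g h₁ + ex g h₂ := by
  simp only [ex, mul_add, Finset.sum_add_distrib]

lemma ex_const_mul (g : Polynomial ℝ) (c : ℝ) (h : ℕ → ℝ) :
    ex g (fun j => c * h j) = c * ex g h := by
  simp only [ex, Finset.mul_sum]
  exact Finset.sum_congr rfl fun j _ => by ring

lemma ex_mono {g : Polynomial ℝ} (hg : ∀ j, 0 ≤ g.coeff j) {h₁ h₂ : ℕ → ℝ}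
    (h : ∀ j, h₁ j ≤ h₂ j) : ex g h₁ ≤ ex g h₂ :=
  Finset.sum_le_sum fun j _ => mul_le_mul_of_nonneg_left (h j) (hg j)

lemma ex_pow (g : Polynomial ℝ) (s : ℝ) : ex g (fun j => s ^ j) = g.eval s := by
  rw [ex_eq_sum_range g _ (Nat.lt_succ_self _), Polynomial.eval_eq_sum_range]

lemma ex_mul_pow (g : Polynomial ℝ) (s : ℝ) :
    ex g (fun j => j * s ^ j) = s * (Polynomial.derivative g).eval s := by
  induction g using Polynomial.induction_on' with
  | add p q hp hq => rw [ex_add_left, hp, hq]; simp; ring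
  | monomial n a =>
    rw [ex_monomial, Polynomial.derivative_monomial, Polynomial.eval_monomial]
    rcases n with _ | n
    · simp
    · simp only [Nat.add_sub_cancel, pow_succ]; ring

lemma ex_mul_pred_mul_pow (g : Polynomial ℝ) (s : ℝ) :
    ex g (fun j => j * (j - 1) * s ^ j) =
      s ^ 2 * (Polynomial.derivative (Polynomial.derivative g)).eval s := by
  induction g using Polynomial.induction_on' with
  | add p q hp hq => rw [ex_add_left, hp, hq]; simp; ring
  | monomial n a =>
    rw [ex_monomial, Polynomial.derivative_monomial, Polynomial.derivative_monomial,
      Polynomial.eval_monomial]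
    rcases n with _ | _ | n
    · simp
    · simp
    · simp only [Nat.add_sub_cancel, pow_succ]; push_cast; ring

lemma coeff_pow_nonneg {g : Polynomial ℝ} (hg : ∀ j, 0 ≤ g.coeff j) (n j : ℕ) :
    0 ≤ (g ^ n).coeff j := by
  induction n generalizing j with
  | zero => rw [pow_zero, Polynomial.coeff_one]; split_ifs <;> norm_num
  | succ n ih =>
    rw [pow_succ, Polynomial.coeff_mul]
    exact Finset.sum_nonneg fun x _ => mul_nonneg (ih _) (hg _)

lemma ex_dev (g : Polynomial ℝ) (s l : ℝ) : ex g (dev s l) =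
    g.eval s - (s - 1) * (s * (Polynomial.derivative g).eval s) -
      l * (s ^ 2 * (Polynomial.derivative (Polynomial.derivative g)).eval s +
        2 * (s * (Polynomial.derivative g).eval s)) := by
  have h : dev s l = fun j : ℕ => s ^ j + (-(s - 1) - 2 * l) * (j * s ^ j) +
      (-l) * (j * (j - 1) * s ^ j) := by
    funext j; simp only [dev]; ring
  rw [h, ex_add, ex_add, ex_const_mul, ex_const_mul, ex_pow, ex_mul_pow, ex_mul_pred_mul_pow]
  ring

lemma dev_pred {s : ℝ} (hs : s ≠ 0) (l : ℝ) (j : ℕ) :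
    dev s l (j - 1) = s⁻¹ * (s * s ^ j + -(s - 1) * (j * s ^ j) + (-l) * (j * (j - 1) * s ^ j)) := by
  rcases j with _ | j
  · simp [dev, hs]
  · simp only [dev, Nat.add_sub_cancel, pow_succ]
    push_cast
    field_simp
    ring

/-- The truncation at `0` costs nothing: the test functions `dev s l` are chosen so that the
formula for `dev s l (j - 1)` remains valid at `j = 0`. -/
lemma ex_dev_pred (g : Polynomial ℝ) {s : ℝ} (hs : s ≠ 0) (l : ℝ) :
    ex g (fun j => dev s l (j - 1)) =
    s⁻¹ * (s * g.eval s - (s - 1) * (s * (Polynomial.derivative g).eval s) -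
      l * (s ^ 2 * (Polynomial.derivative (Polynomial.derivative g)).eval s)) := by
  simp only [dev_pred hs]
  rw [ex_const_mul, ex_add, ex_add, ex_const_mul, ex_const_mul, ex_const_mul, ex_pow, ex_mul_pow,
    ex_mul_pred_mul_pow]
  ring

/-- The value of `l` is the one for which the second-order terms of a step combine into a single
square. -/
lemma ex_pow_dev_pred (m : ℕ) (hm : 2 ≤ m) (g : Polynomial ℝ) {s : ℝ} (hs : s ≠ 0) :
    ex (g ^ m) (fun j => dev s (((m : ℝ) - 1) * (m - s) / m) (j - 1)) =
      g.eval s ^ (m - 2) * (m / s * ex g (dev s (((m : ℝ) - 1) * (m - s) / m)) * g.eval s -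
        (m - s) / s * (ex g fun j => s ^ j * (1 - ((m : ℝ) - 1) * j)) ^ 2) := by
  obtain ⟨k, rfl⟩ := Nat.exists_eq_add_of_le' hm
  have hV : (ex g fun j => s ^ j * (1 - (((k + 2 : ℕ) : ℝ) - 1) * j)) =
      g.eval s - (((k + 2 : ℕ) : ℝ) - 1) * (s * (Polynomial.derivative g).eval s) := by
    have h : (fun j : ℕ => s ^ j * (1 - (((k + 2 : ℕ) : ℝ) - 1) * j)) =
        fun j : ℕ => s ^ j + (-(((k + 2 : ℕ) : ℝ) - 1)) * (j * s ^ j) := by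
      funext j; ring
    rw [h, ex_add, ex_const_mul, ex_pow, ex_mul_pow]
    ring
  have hk : ((k + 2 : ℕ) : ℝ) ≠ 0 := by positivity
  rw [hV, ex_dev, ex_dev_pred _ hs]
  simp only [Polynomial.derivative_pow, Polynomial.derivative_mul, Polynomial.eval_add,
    Polynomial.eval_mul, Polynomial.eval_pow, Polynomial.derivative_C, Polynomial.eval_C,
    Nat.add_sub_cancel, show k + 2 - 1 = k + 1 from rfl, Polynomial.eval_zero]
  push_cast at hk ⊢
  field_simp
  ring

/-- Without the second-order term, the mean of `dev u 0` strictly decreases by a multiple of the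
weighted first moment, apart from the factor `g(u) ^ (m - 1)`. -/
lemma ex_pow_dev_zero_pred (m : ℕ) (hm : 1 ≤ m) (g : Polynomial ℝ) {u : ℝ} (hu : u ≠ 0) :
    ex (g ^ m) (fun j => dev u 0 (j - 1)) = g.eval u ^ (m - 1) *
      (ex g (dev u 0) - (u - 1) * ((m - u) / u) * ex g fun j => j * u ^ j) := by
  obtain ⟨k, rfl⟩ := Nat.exists_eq_add_of_le' hm
  rw [ex_dev, ex_dev_pred _ hu, ex_mul_pow]
  simp only [Polynomial.derivative_pow, Polynomial.eval_mul, Polynomial.eval_pow,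
    Polynomial.eval_C, Nat.add_sub_cancel]
  push_cast
  field_simp
  ring

/-! ### Growth of the truncated system -/

/-- The polynomials `g k` behave like the generating functions of `min (X k) (N - k)` up to a
horizon `N`, for a system whose variables have tails of order `m ^ (-j)` below `N - k`. -/
structure TruncatedFlow (m N : ℕ) (g : ℕ → Polynomial ℝ) : Prop where
  nonneg : ∀ k j, 0 ≤ (g k).coeff j
  eval_one : ∀ k, (g k).eval 1 = 1
  tail : ∀ k ≤ N, ∀ j, (g k).coeff j * (m : ℝ) ^ j ≤ 2 * m
  step : ∀ k < N, ∀ h : ℕ → ℝ,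
    ex (g (k + 1)) h = ex (g k ^ m) fun j => h (min (j - 1) (N - k - 1))

/-- A bound for the weighted first moments of a truncated flow. -/
noncomputable def momentBound (m : ℕ) (s : ℝ) : ℝ := 2 * m * ∑' j : ℕ, (j : ℝ) * (s / m) ^ j

lemma summable_momentBound {m : ℕ} (hm : 2 ≤ m) {s : ℝ} (hs : 0 ≤ s) (hsm : s < m) :
    Summable fun j : ℕ => (j : ℝ) * (s / m) ^ j := by
  have h : ‖s / m‖ < 1 := by
    have : (0 : ℝ) < m := by positivity
    rw [Real.norm_eq_abs, abs_of_nonneg (by positivity), div_lt_one this]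
    exact hsm
  simpa using summable_pow_mul_geometric_of_norm_lt_one 1 h

lemma momentBound_nonneg (m : ℕ) {s : ℝ} (hs : 0 ≤ s) : 0 ≤ momentBound m s :=
  mul_nonneg (by positivity) (tsum_nonneg fun j => by positivity)

namespace TruncatedFlow

variable {m N : ℕ} {g : ℕ → Polynomial ℝ}

lemma ex_one (hg : TruncatedFlow m N g) (k : ℕ) : ex (g k) (fun _ => 1) = 1 := by
  have h := ex_pow (g k) 1
  rw [hg.eval_one] at h
  simpa using h

lemma sum_coeff (hg : TruncatedFlow m N g) (k : ℕ) :
    ∑ j ∈ Finset.range ((g k).natDegree + 2), (g k).coeff j = 1 := by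
  simpa [ex] using hg.ex_one k

lemma moment_le (hg : TruncatedFlow m N g) (hm : 2 ≤ m) {s : ℝ} (hs : 0 ≤ s) (hsm : s < m)
    {k : ℕ} (hk : k ≤ N) : ex (g k) (fun j => j * s ^ j) ≤ momentBound m s := by
  have hm0 : (0 : ℝ) < m := by positivity
  rw [ex, momentBound, ← tsum_mul_left]
  refine le_trans (Finset.sum_le_sum fun j _ => ?_)
    (((summable_momentBound hm hs hsm).mul_left (2 * (m : ℝ))).sum_le_tsum _
      fun j _ => by positivity)
  have h1 := mul_le_mul_of_nonneg_right (hg.tail k hk j)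
    (by positivity : 0 ≤ (j : ℝ) * (s / m) ^ j)
  calc (g k).coeff j * (j * s ^ j) = (g k).coeff j * (m : ℝ) ^ j * (j * (s / m) ^ j) := by
        rw [div_pow]; field_simp
    _ ≤ _ := h1

lemma one_le_eval (hg : TruncatedFlow m N g) {s : ℝ} (hs : 1 ≤ s) (k : ℕ) :
    1 ≤ (g k).eval s := by
  rw [← hg.ex_one k, ← ex_pow]
  exact ex_mono (hg.nonneg k) fun j => one_le_pow₀ hs

lemma eval_le (hg : TruncatedFlow m N g) (hm : 2 ≤ m) {s : ℝ} (hs : 1 ≤ s) (hsm : s < m)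
    {k : ℕ} (hk : k ≤ N) : (g k).eval s ≤ 1 + momentBound m s := by
  refine le_trans ?_ (add_le_add_right (hg.moment_le hm (by linarith) hsm hk) 1)
  rw [← hg.ex_one k, ← ex_pow, ← ex_add]
  refine ex_mono (hg.nonneg k) fun j => ?_
  rcases j with _ | j
  · simp
  · have h1 : 0 < s ^ (j + 1) := by positivity
    have h2 : (0 : ℝ) ≤ j := j.cast_nonneg
    push_cast
    nlinarith

lemma ex_dev_eq (g : Polynomial ℝ) (u : ℝ) :
    ex g (dev u 0) = g.eval u - (u - 1) * ex g fun j => j * u ^ j := by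
  rw [ex_dev, ex_mul_pow]; ring

/-- The error made by truncating at height `b` is exponentially small in `b`, for test functions
that grow at an exponential rate `u < v`. -/
lemma dev_min_le {u v : ℝ} (hu : 1 ≤ u) (huv : u ≤ v) (b j : ℕ) :
    dev u 0 (min (j - 1) (b - 1)) ≤ dev u 0 (j - 1) + (1 + u) * (u / v) ^ b * (j * v ^ j) := by
  have hv : 0 < v := by linarith
  rcases le_or_gt j b with h | h
  · rw [min_eq_left (by omega)]
    have : 0 ≤ (1 + u) * (u / v) ^ b * (j * v ^ j) := by positivity
    linarith
  · obtain ⟨i, rfl⟩ : ∃ i, j = i + 1 := ⟨j - 1, by omega⟩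
    simp only [Nat.add_sub_cancel]
    have h1 := dev_le_one hu le_rfl (min i (b - 1))
    have h2 : u ^ (i + 1) ≤ (u / v) ^ b * v ^ (i + 1) := by
      have e1 : (u / v) ^ (i + 1) ≤ (u / v) ^ b :=
        pow_le_pow_of_le_one (by positivity) ((div_le_one hv).2 huv) h.le
      calc u ^ (i + 1) = (u / v) ^ (i + 1) * v ^ (i + 1) := by
            rw [← mul_pow, div_mul_cancel₀ _ hv.ne']
        _ ≤ _ := by gcongr
    have h3 : -(u * ((i + 1) * u ^ (i + 1))) + u ^ i ≤ dev u 0 i := by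
      simp only [dev, pow_succ]
      have e1 : 0 < u ^ i := by positivity
      have e2 : (0 : ℝ) ≤ i := i.cast_nonneg
      have e3 : (u - 1) * i ≤ u * ((i + 1) * u) :=
        mul_le_mul (by linarith) (by nlinarith) e2 (by linarith)
      nlinarith
    have h4 : 1 ≤ u ^ i := one_le_pow₀ hu
    have h5 : u * ((i + 1) * u ^ (i + 1)) ≤ (1 + u) * ((i + 1) * ((u / v) ^ b * v ^ (i + 1))) := by
      gcongr; linarith
    push_cast
    linarith

/-- One step for the mean of `dev u 0`. The last term is the effect of the truncation. -/
lemma ex_dev_succ_le (hg : TruncatedFlow m N g) (hm : 2 ≤ m) {u v : ℝ} (hu : 1 ≤ u)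
    (huv : u ≤ v) (hvm : v < m) {k : ℕ} (hk : k < N) :
    ex (g (k + 1)) (dev u 0) ≤ (g k).eval u ^ (m - 1) *
        (ex (g k) (dev u 0) - (u - 1) * ((m - u) / u) * ex (g k) fun j => j * u ^ j) +
      (1 + u) * (m * (1 + momentBound m v) ^ (m - 1) * momentBound m v) * (u / v) ^ (N - k) := by
  have h1 : ex (g (k + 1)) (dev u 0) ≤
      ex (g k ^ m) (fun j => dev u 0 (j - 1) + (1 + u) * (u / v) ^ (N - k) * (j * v ^ j)) := by
    rw [hg.step k hk]
    exact ex_mono (coeff_pow_nonneg (hg.nonneg k) m) fun j => dev_min_le hu huv _ _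
  rw [ex_add, ex_const_mul, ex_pow_dev_zero_pred m (by omega) _ (by linarith),
    ex_mul_pow (g k ^ m)] at h1
  refine h1.trans (add_le_add_right ?_ _)
  have hG := hg.eval_le hm (hu.trans huv) hvm hk.le
  have hG1 := hg.one_le_eval (hu.trans huv) k
  have hM := hg.moment_le hm (by linarith) hvm hk.le
  rw [ex_mul_pow] at hM
  have hM0 := momentBound_nonneg m (by linarith : 0 ≤ v)
  have h2 : v * (Polynomial.derivative (g k ^ m)).eval v ≤
      m * (1 + momentBound m v) ^ (m - 1) * momentBound m v := by
    rw [Polynomial.derivative_pow]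
    simp only [Polynomial.eval_mul, Polynomial.eval_C, Polynomial.eval_pow]
    calc _ = (m : ℝ) * (g k).eval v ^ (m - 1) *
          (v * (Polynomial.derivative (g k)).eval v) := by ring
      _ ≤ (m : ℝ) * (g k).eval v ^ (m - 1) * momentBound m v := by gcongr
      _ ≤ _ := by gcongr
  have h3 : 0 ≤ (u / v) ^ (N - k) := pow_nonneg (div_nonneg (by linarith) (by linarith)) _
  calc (1 + u) * (u / v) ^ (N - k) * (v * (Polynomial.derivative (g k ^ m)).eval v)
      ≤ (1 + u) * (u / v) ^ (N - k) *
        (m * (1 + momentBound m v) ^ (m - 1) * momentBound m v) := by gcongr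
    _ = _ := by ring

end TruncatedFlow

/-- The mean of `dev u 0` along a truncated flow is nonnegative, except possibly during a bounded
time before the horizon: a negative mean would decrease by a fixed amount at each step, while the
tails keep it bounded. -/
lemma exists_forall_ex_dev_nonneg {m : ℕ} (hm : 2 ≤ m) {u : ℝ} (hu : 1 ≤ u) (hum : u < m) :
    ∃ T : ℕ, ∀ (N : ℕ) (g : ℕ → Polynomial ℝ), TruncatedFlow m N g →
      ∀ k, k + T ≤ N → 0 ≤ ex (g k) (dev u 0) := by
  obtain ⟨v, huv, hvm⟩ := exists_between hum
  set C : ℝ := (1 + u) * (m * (1 + momentBound m v) ^ (m - 1) * momentBound m v) with hC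
  set δ : ℝ := (m - u) / u with hδ
  have hu0 : 0 < u := by linarith
  have hv0 : 0 < v := by linarith
  have hδ0 : 0 < δ := div_pos (by linarith) hu0
  obtain ⟨T₀, hT₀⟩ : ∃ T₀ : ℕ, ∀ b, T₀ ≤ b → C * (u / v) ^ b ≤ δ / 2 := by
    have h1 : Tendsto (fun b : ℕ => C * (u / v) ^ b) atTop (𝓝 (C * 0)) :=
      (tendsto_pow_atTop_nhds_zero_of_lt_one (by positivity)
        ((div_lt_one hv0).2 huv)).const_mul C
    rw [mul_zero] at h1
    exact eventually_atTop.1 (h1.eventually_le_const (by positivity))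
  obtain ⟨R, hR⟩ := exists_nat_gt (u * momentBound m u / (δ / 2))
  rw [div_lt_iff₀ (by positivity)] at hR
  refine ⟨T₀ + R, fun N g hg k hk => ?_⟩
  by_contra hneg
  rw [not_le] at hneg
  have key : ∀ i ≤ R, ex (g (k + i)) (dev u 0) ≤ -(i * (δ / 2)) := by
    intro i
    induction i with
    | zero => intro _; simpa using hneg.le
    | succ i ih =>
      intro hi
      have hD := ih (by omega)
      have h1 := hg.ex_dev_succ_le hm hu huv.le hvm (k := k + i) (by omega)
      rw [← hC, ← hδ] at h1
      have h2 := hT₀ (N - (k + i)) (by omega)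
      have hG := hg.one_le_eval hu (k + i)
      have hD0 : ex (g (k + i)) (dev u 0) ≤ 0 := hD.trans (by
        have : 0 ≤ (i : ℝ) * (δ / 2) := by positivity
        linarith)
      have h3 : 1 ≤ (u - 1) * ex (g (k + i)) fun j => j * u ^ j := by
        rw [TruncatedFlow.ex_dev_eq] at hD0; linarith
      have h4 : δ ≤ (u - 1) * δ * ex (g (k + i)) fun j => j * u ^ j := by nlinarith
      have h5 : 1 ≤ (g (k + i)).eval u ^ (m - 1) := one_le_pow₀ hG
      have h6 : (g (k + i)).eval u ^ (m - 1) * (ex (g (k + i)) (dev u 0) -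
          (u - 1) * δ * ex (g (k + i)) fun j => j * u ^ j) ≤ ex (g (k + i)) (dev u 0) -
          (u - 1) * δ * ex (g (k + i)) fun j => j * u ^ j := by
        nlinarith
      rw [← Nat.add_assoc]
      push_cast
      linarith
  have h1 := key R le_rfl
  have h2 := hg.moment_le hm hu0.le hum (k := k + R) (by omega)
  have h3 := hg.one_le_eval hu (k + R)
  have h4 := momentBound_nonneg m hu0.le
  rw [TruncatedFlow.ex_dev_eq] at h1
  have h5 : (u - 1) * ex (g (k + R)) (fun j => j * u ^ j) ≤ (u - 1) * momentBound m u :=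
    mul_le_mul_of_nonneg_left h2 (by linarith)
  nlinarith

/-- If the square of the mean `V` of `s ^ j (1 - (m - 1) j)` is controlled by the mean `Θ` of `dev s l`,
then a step multiplies `Θ` by `G ^ (m - 1)` at least, up to a relative loss of order `m - s`. -/
lemma TruncatedFlow.theta_succ_ge {m N : ℕ} {g : ℕ → Polynomial ℝ} (hg : TruncatedFlow m N g)
    (hm : 2 ≤ m) {s K : ℝ} (hs : 1 ≤ s) (hsm : s ≤ m) (hK : 0 ≤ K) {k : ℕ} (hk : k < N)
    (hΘ : 0 ≤ ex (g k) (dev s (((m : ℝ) - 1) * (m - s) / m)))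
    (hV : (ex (g k) fun j => s ^ j * (1 - ((m : ℝ) - 1) * j)) ^ 2 ≤
      K * ex (g k) (dev s (((m : ℝ) - 1) * (m - s) / m))) :
    (g k).eval s ^ (m - 1) * (1 - (m - s) * K) *
        ex (g k) (dev s (((m : ℝ) - 1) * (m - s) / m)) ≤
      ex (g (k + 1)) (dev s (((m : ℝ) - 1) * (m - s) / m)) := by
  have hm1 : (2 : ℝ) ≤ m := by exact_mod_cast hm
  have hs0 : 0 < s := by linarith
  have hl : 0 ≤ ((m : ℝ) - 1) * (m - s) / m :=
    div_nonneg (mul_nonneg (by linarith) (by linarith)) (by linarith)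
  have h1 : ex (g k ^ m) (fun j => dev s (((m : ℝ) - 1) * (m - s) / m) (j - 1)) ≤
      ex (g (k + 1)) (dev s (((m : ℝ) - 1) * (m - s) / m)) := by
    rw [hg.step k hk]
    exact ex_mono (coeff_pow_nonneg (hg.nonneg k) m) fun j =>
      antitone_dev hs hl (min_le_left _ _)
  rw [ex_pow_dev_pred m hm _ hs0.ne'] at h1
  refine le_trans ?_ h1
  set Θ := ex (g k) (dev s (((m : ℝ) - 1) * (m - s) / m))
  set G := (g k).eval s
  have hG : 1 ≤ G := hg.one_le_eval hs k
  have h2 : G ^ (m - 1) = G ^ (m - 2) * G := by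
    rw [← pow_succ]; congr 1; omega
  rw [h2, mul_assoc, mul_assoc]
  refine mul_le_mul_of_nonneg_left ?_ (by positivity)
  have h3 : (m - s) / s * (ex (g k) fun j => s ^ j * (1 - ((m : ℝ) - 1) * j)) ^ 2 ≤
      (m - s) * (K * Θ * G) := by
    have e1 : (m - s) / s ≤ m - s := div_le_self (by linarith) hs
    have e2 : K * Θ ≤ K * Θ * G := le_mul_of_one_le_right (mul_nonneg hK hΘ) hG
    exact mul_le_mul e1 (hV.trans e2) (sq_nonneg _) (by linarith)
  have h4 : Θ * G ≤ m / s * (Θ * G) :=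
    le_mul_of_one_le_left (mul_nonneg hΘ (by linarith)) ((one_le_div hs0).2 hsm)
  calc G * ((1 - (m - s) * K) * Θ) = Θ * G - (m - s) * (K * Θ * G) := by ring
    _ ≤ m / s * (Θ * G) - (m - s) / s *
        (ex (g k) fun j => s ^ j * (1 - ((m : ℝ) - 1) * j)) ^ 2 := by linarith
    _ = _ := by ring

/-- Subexponential growth: for a suitable `s < m` the product of the factors
`(m / s) E (s ^ Y k) ^ (m - 1)` grows at an arbitrarily small exponential rate. -/
lemma exists_prod_le {m : ℕ} (hm : 2 ≤ m) {c₀ : ℝ} (hc₀ : 0 < c₀) (hc₁ : c₀ ≤ 1) {κ : ℝ}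
    (hκ : 0 < κ) :
    ∃ s : ℝ, 1 < s ∧ s < m ∧ ∃ C : ℝ, 0 < C ∧
      ∀ (N : ℕ) (g : ℕ → Polynomial ℝ), TruncatedFlow m N g →
      (m = 2 → ∀ k, k + 2 ≤ N → (g k).coeff 1 ≤ 1 - c₀) →
      ∏ k ∈ Finset.range N, ((m : ℝ) / s * (g k).eval s ^ (m - 1)) ≤ C * Real.exp (κ * N) := by
  have hm1 : (2 : ℝ) ≤ m := by exact_mod_cast hm
  obtain ⟨ε₀, hε₀, c, hc, K, hK, hε₀m, hcore⟩ := dev_moment_bound hm hc₀ hc₁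
  set q : ℝ := Real.exp (-(κ / 2)) with hq
  have hq0 : 0 < q := Real.exp_pos _
  have hq1 : q < 1 := Real.exp_lt_one_iff.2 (by linarith)
  obtain ⟨ε, hε, hε1, hε2, hε3⟩ : ∃ ε > 0, ε ≤ ε₀ ∧ ε * K ≤ 1 - q ∧ ε ≤ m * (1 - q) := by
    have h1 : 0 < 1 - q := by linarith
    refine ⟨min ε₀ (min ((1 - q) / K) (m * (1 - q))), by positivity, min_le_left _ _, ?_,
      (min_le_right _ _).trans (min_le_right _ _)⟩
    rw [← le_div_iff₀ hK]
    exact (min_le_right _ _).trans (min_le_left _ _)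
  have hεs : ε ≤ 1 / 200 := by
    refine hε1.trans (hε₀m.trans (one_div_le_one_div_of_le (by norm_num) (by linarith)))
  have hε3' : ε ^ 3 ≤ 1 := pow_le_one₀ hε.le (by linarith)
  have hε30 : 0 < ε ^ 3 := by positivity
  set s : ℝ := m - ε with hs
  have hs1 : 1 < s := by linarith
  have hsm : s < m := by linarith
  have hs0 : 0 < s := by linarith
  obtain ⟨T, hT⟩ := exists_forall_ex_dev_nonneg hm (u := m - ε ^ 3) (by linarith) (by linarith)
  set b : ℝ := 1 + momentBound m s with hb
  have hb1 : 1 ≤ b := by linarith [momentBound_nonneg m hs0.le]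
  have hmq : (m : ℝ) / s ≤ Real.exp (κ / 2) := by
    have : Real.exp (κ / 2) = q⁻¹ := by rw [hq, Real.exp_neg, inv_inv]
    rw [this, ← one_div, div_le_div_iff₀ hs0 hq0]
    linarith
  refine ⟨s, hs1, hsm, (1 / (c * ε ^ 2) + 1) * (b ^ (m - 1)) ^ (T + 2), by positivity, ?_⟩
  intro N g hg hg1
  set l : ℝ := ((m : ℝ) - 1) * ε / m with hl
  have hml : ((m : ℝ) - 1) * (m - s) / m = l := by rw [hl, hs]; ring
  have hl0 : 0 ≤ l := div_nonneg (mul_nonneg (by linarith) hε.le) (by linarith)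
  have hΘV : ∀ k, k + (T + 2) ≤ N → c * ε ^ 2 ≤ ex (g k) (dev s l) ∧
      (ex (g k) fun j => s ^ j * (1 - ((m : ℝ) - 1) * j)) ^ 2 ≤ K * ex (g k) (dev s l) := by
    intro k hk
    exact hcore ε hε hε1 (g k).natDegree (g k).coeff (hg.nonneg k) (hg.sum_coeff k)
      (fun h => hg1 h k (by omega)) (hT N g hg k (by omega))
  -- the mean of `dev s l` is at most `1` and grows at least like the product
  have hprod : ∀ i, i + (T + 2) ≤ N →
      (∏ k ∈ Finset.range i, ((g k).eval s ^ (m - 1) * q)) * (c * ε ^ 2) ≤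
        ex (g i) (dev s l) := by
    intro i
    induction i with
    | zero => intro h; simpa using (hΘV 0 h).1
    | succ i ih =>
      intro h
      have h1 := ih (by omega)
      obtain ⟨h2, h3⟩ := hΘV i (by omega)
      have h4 : 0 ≤ ex (g i) (dev s l) := le_trans (by positivity) h2
      have h5 := hg.theta_succ_ge hm hs1.le hsm.le hK.le (k := i) (by omega)
        (by rwa [hml]) (by rwa [hml])
      rw [hml] at h5
      have hG := hg.one_le_eval hs1.le i
      refine le_trans ?_ h5
      rw [Finset.prod_range_succ]
      have h6 : q ≤ 1 - (m - s) * K := by rw [hs]; linarith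
      calc (∏ k ∈ Finset.range i, ((g k).eval s ^ (m - 1) * q)) *
            ((g i).eval s ^ (m - 1) * q) * (c * ε ^ 2)
          = ((g i).eval s ^ (m - 1) * q) *
            ((∏ k ∈ Finset.range i, ((g k).eval s ^ (m - 1) * q)) * (c * ε ^ 2)) := by ring
        _ ≤ ((g i).eval s ^ (m - 1) * q) * ex (g i) (dev s l) := by gcongr
        _ ≤ _ := by gcongr
  have hfirst : ∏ k ∈ Finset.range (N - (T + 2)), (g k).eval s ^ (m - 1) ≤
      (1 / (c * ε ^ 2) + 1) * Real.exp (κ / 2 * N) := by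
    rcases le_or_gt (T + 2) N with h | h
    · have h1 := hprod (N - (T + 2)) (by omega)
      have h2 : ex (g (N - (T + 2))) (dev s l) ≤ 1 := by
        rw [← hg.ex_one (N - (T + 2))]
        exact ex_mono (hg.nonneg _) fun j => dev_le_one hs1.le hl0 j
      rw [Finset.prod_mul_distrib, Finset.prod_const, Finset.card_range] at h1
      set P := ∏ k ∈ Finset.range (N - (T + 2)), (g k).eval s ^ (m - 1)
      have hP : 0 ≤ P := Finset.prod_nonneg fun k _ =>
        pow_nonneg (by linarith [hg.one_le_eval hs1.le k]) _
      have h3 : q ^ N ≤ q ^ (N - (T + 2)) :=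
        pow_le_pow_of_le_one hq0.le hq1.le (Nat.sub_le _ _)
      have h4 : Real.exp (κ / 2 * N) * q ^ N = 1 := by
        rw [hq, ← Real.exp_nat_mul, ← Real.exp_add]; ring_nf; simp
      have h5 : P * q ^ N * (c * ε ^ 2) ≤ 1 := by
        refine le_trans ?_ (h1.trans h2)
        gcongr
      have h6 : P * q ^ N ≤ 1 / (c * ε ^ 2) := by rwa [le_div_iff₀ (by positivity)]
      calc P = Real.exp (κ / 2 * N) * (P * q ^ N) := by
            rw [mul_left_comm, h4, mul_one]
        _ ≤ Real.exp (κ / 2 * N) * (1 / (c * ε ^ 2) + 1) := by gcongr; linarith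
        _ = _ := by ring
    · rw [Nat.sub_eq_zero_of_le h.le, Finset.prod_range_zero]
      have h1 : 1 ≤ Real.exp (κ / 2 * N) := Real.one_le_exp (by positivity)
      have h2 : 0 ≤ 1 / (c * ε ^ 2) := by positivity
      nlinarith
  have hsecond : ∏ k ∈ Finset.Ico (N - (T + 2)) N, (g k).eval s ^ (m - 1) ≤
      (b ^ (m - 1)) ^ (T + 2) := by
    calc _ ≤ ∏ _k ∈ Finset.Ico (N - (T + 2)) N, b ^ (m - 1) := by
          refine Finset.prod_le_prod (fun k _ => ?_) fun k hk => ?_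
          · exact pow_nonneg (by linarith [hg.one_le_eval hs1.le k]) _
          · have h1 := hg.eval_le hm hs1.le hsm (Finset.mem_Ico.1 hk).2.le
            have h2 := hg.one_le_eval hs1.le k
            gcongr
      _ ≤ _ := by
          rw [Finset.prod_const, Nat.card_Ico]
          exact pow_le_pow_right₀ (one_le_pow₀ hb1) (by omega)
  have hmN : ((m : ℝ) / s) ^ N ≤ Real.exp (κ / 2 * N) := by
    calc ((m : ℝ) / s) ^ N ≤ Real.exp (κ / 2) ^ N := by gcongr
      _ = _ := by rw [← Real.exp_nat_mul]; ring_nf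
  rw [Finset.prod_mul_distrib, Finset.prod_const, Finset.card_range,
    ← Finset.prod_range_mul_prod_Ico _ (Nat.sub_le N (T + 2))]
  have hpos : 0 ≤ ∏ k ∈ Finset.Ico (N - (T + 2)) N, (g k).eval s ^ (m - 1) :=
    Finset.prod_nonneg fun k _ => pow_nonneg (by linarith [hg.one_le_eval hs1.le k]) _
  have hpos' : 0 ≤ ∏ k ∈ Finset.range (N - (T + 2)), (g k).eval s ^ (m - 1) :=
    Finset.prod_nonneg fun k _ => pow_nonneg (by linarith [hg.one_le_eval hs1.le k]) _
  calc _ ≤ Real.exp (κ / 2 * N) * (((1 / (c * ε ^ 2) + 1) * Real.exp (κ / 2 * N)) *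
        (b ^ (m - 1)) ^ (T + 2)) := by gcongr
    _ = (1 / (c * ε ^ 2) + 1) * (b ^ (m - 1)) ^ (T + 2) *
        (Real.exp (κ / 2 * N) * Real.exp (κ / 2 * N)) := by ring
    _ = _ := by rw [← Real.exp_add]; ring_nf

/-! ### Truncated laws form a truncated flow -/

/-- The law of `f Y₁ + ⋯ + f Yₘ` is the image of the joint law of the `Yᵢ`. -/
lemma sumLaw_map (m : ℕ) (μ : Measure ℕ) [IsProbabilityMeasure μ] (f : ℕ → ℕ) :
    sumLaw m (μ.map f) = (Measure.pi fun _ : Fin m => μ).map fun y => ∑ i, f (y i) := by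
  have hf : Measurable f := Measurable.of_discrete
  have : IsProbabilityMeasure (μ.map f) := Measure.isProbabilityMeasure_map hf.aemeasurable
  rw [sumLaw, ← Measure.pi_map_pi (fun _ => hf.aemeasurable),
    Measure.map_map Measurable.of_discrete Measurable.of_discrete]
  rfl

lemma map_sumLaw_min (m : ℕ) (μ : Measure ℕ) [IsProbabilityMeasure μ] {b : ℕ} (hb : 1 ≤ b) :
    (sumLaw m μ).map (fun j => min (j - 1) (b - 1)) =
      (sumLaw m (μ.map (min · b))).map fun j => min (j - 1) (b - 1) := by
  rw [sumLaw_map, sumLaw, Measure.map_map Measurable.of_discrete Measurable.of_discrete,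
    Measure.map_map Measurable.of_discrete Measurable.of_discrete]
  congr 1
  funext y
  simp only [Function.comp_apply]
  by_cases h : ∀ i, y i ≤ b
  · simp [h]
  · push Not at h
    obtain ⟨i, hi⟩ := h
    have h1 : y i ≤ ∑ i, y i := Finset.single_le_sum (fun _ _ => Nat.zero_le _) (Finset.mem_univ i)
    have h2 : min (y i) b ≤ ∑ i, min (y i) b :=
      Finset.single_le_sum (f := fun i => min (y i) b) (fun _ _ => Nat.zero_le _)
        (Finset.mem_univ i)
    omega

/-- A law on `ℕ` whose point masses are the coefficients of a polynomial `q` has the expectation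
functional `ex q`. -/
lemma integral_eq_ex (ρ : Measure ℕ) [IsFiniteMeasure ρ] (q : Polynomial ℝ)
    (h : ∀ j, ρ.real {j} = q.coeff j) (f : ℕ → ℝ) : ∫ x, f x ∂ρ = ex q f := by
  have hρ : ρ = ∑ j ∈ Finset.range (q.natDegree + 2), ρ {j} • Measure.dirac j := by
    refine Measure.ext_of_singleton fun a => ?_
    rw [Measure.coe_finsetSum, Finset.sum_apply]
    simp only [Measure.coe_smul, Pi.smul_apply, smul_eq_mul]
    by_cases ha : a < q.natDegree + 2
    · rw [Finset.sum_eq_single a]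
      · simp
      · intro b _ hb; simp [hb]
      · intro h'; exact absurd (Finset.mem_range.2 ha) h'
    · rw [Finset.sum_eq_zero]
      · have h0 := h a
        rw [Polynomial.coeff_eq_zero_of_natDegree_lt (by omega)] at h0
        rwa [measureReal_eq_zero_iff] at h0
      · intro b hb
        have : b ≠ a := by rintro rfl; exact ha (Finset.mem_range.1 hb)
        simp [this]
  rw [hρ, integral_finsetSum_measure]
  · rw [ex]
    refine Finset.sum_congr rfl fun j _ => ?_
    rw [integral_smul_measure, integral_dirac, ← h j]
    rfl
  · intro j _
    exact (integrable_dirac (by simp)).smul_measure (measure_ne_top _ _)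

/-- The generating polynomial of `min Y b`, where `Y` has law `μ`. -/
noncomputable def truncPoly (μ : Measure ℕ) (b : ℕ) : Polynomial ℝ :=
  ∑ j ∈ Finset.range (b + 1), Polynomial.monomial j ((μ.map (min · b)).real {j})

lemma coeff_truncPoly (μ : Measure ℕ) (b j : ℕ) :
    (truncPoly μ b).coeff j = (μ.map (min · b)).real {j} := by
  rw [truncPoly, Polynomial.finsetSum_coeff]
  simp only [Polynomial.coeff_monomial]
  rw [Finset.sum_ite_eq' (Finset.range (b + 1)) j]
  split_ifs with h
  · rfl
  · rw [map_measureReal_apply Measurable.of_discrete (measurableSet_singleton j)]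
    have : (fun x : ℕ => min x b) ⁻¹' {j} = ∅ := by
      ext x
      simp only [Finset.mem_range] at h
      simp only [mem_preimage, mem_singleton_iff, mem_empty_iff_false, iff_false]
      omega
    rw [this]; simp

lemma ex_truncPoly (μ : Measure ℕ) [IsProbabilityMeasure μ] (b : ℕ) (f : ℕ → ℝ) :
    ex (truncPoly μ b) f = ∫ x, f (min x b) ∂μ := by
  have : IsProbabilityMeasure (μ.map (min · b)) :=
    Measure.isProbabilityMeasure_map (Measurable.of_discrete).aemeasurable
  rw [← integral_eq_ex (μ.map (min · b)) _ fun j => (coeff_truncPoly μ b j).symm,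
    integral_map (Measurable.of_discrete).aemeasurable
      (Measurable.of_discrete).aestronglyMeasurable]

lemma eval_truncPoly (μ : Measure ℕ) [IsProbabilityMeasure μ] (b : ℕ) (s : ℝ) :
    (truncPoly μ b).eval s = ∫ x, s ^ min x b ∂μ := by
  rw [← ex_pow, ex_truncPoly]

lemma ex_truncPoly_pow (m : ℕ) (μ : Measure ℕ) [IsProbabilityMeasure μ] (b : ℕ) (f : ℕ → ℝ) :
    ex (truncPoly μ b ^ m) f = ∫ x, f x ∂(sumLaw m (μ.map (min · b))) := by
  have : IsProbabilityMeasure (μ.map (min · b)) :=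
    Measure.isProbabilityMeasure_map (Measurable.of_discrete).aemeasurable
  refine (integral_eq_ex _ _ (fun j => ?_) f).symm
  have hp : pgf (μ.map (min · b)) = (truncPoly μ b : PowerSeries ℝ) := by
    ext i
    rw [coeff_pgf, Polynomial.coeff_coe, coeff_truncPoly]
  rw [sumLaw_real_singleton, hp, ← Polynomial.coe_pow, Polynomial.coeff_coe]

lemma ex_truncPoly_step (m : ℕ) (μ : Measure ℕ) [IsProbabilityMeasure μ] {b : ℕ} (hb : 1 ≤ b)
    (f : ℕ → ℝ) : ex (truncPoly (step m μ) (b - 1)) f =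
      ex (truncPoly μ b ^ m) fun j => f (min (j - 1) (b - 1)) := by
  have := isProbabilityMeasure_step m μ
  rw [ex_truncPoly, ex_truncPoly_pow, step_eq_map_sumLaw,
    integral_map (Measurable.of_discrete).aemeasurable
      (Measurable.of_discrete).aestronglyMeasurable]
  have h := congrArg (fun ρ => ∫ x, f x ∂ρ) (map_sumLaw_min m μ hb)
  rwa [integral_map (Measurable.of_discrete).aemeasurable
      (Measurable.of_discrete).aestronglyMeasurable,
    integral_map (Measurable.of_discrete).aemeasurable
      (Measurable.of_discrete).aestronglyMeasurable] at h

lemma truncatedFlow_truncPoly {m : ℕ} (hm : 2 ≤ m) (μ : ℕ → Measure ℕ)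
    [∀ k, IsProbabilityMeasure (μ k)] (hμ : ∀ k, μ (k + 1) = step m (μ k)) (N : ℕ)
    (htail : ∀ k ≤ N, ∀ j ≤ N - k, (μ k).real {x | j < x} * (m : ℝ) ^ j ≤ 2) :
    TruncatedFlow m N fun k => truncPoly (μ k) (N - k) where
  nonneg k j := by rw [coeff_truncPoly]; exact measureReal_nonneg
  eval_one k := by rw [eval_truncPoly]; simp
  step k hk h := by
    rw [hμ, show N - (k + 1) = N - k - 1 by omega, ex_truncPoly_step m _ (by omega)]
  tail k hk j := by
    have hm1 : (1 : ℝ) ≤ m := by exact_mod_cast (by omega : 1 ≤ m)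
    rw [coeff_truncPoly, map_measureReal_apply Measurable.of_discrete (measurableSet_singleton j)]
    rcases j with _ | j
    · have := measureReal_le_one (μ := μ k) (s := (fun x : ℕ => min x (N - k)) ⁻¹' {0})
      simp only [pow_zero, mul_one]
      linarith
    · by_cases hj : j + 1 ≤ N - k
      · have h1 := htail k hk j (by omega)
        have h2 : (μ k).real ((fun x : ℕ => min x (N - k)) ⁻¹' {j + 1}) ≤
            (μ k).real {x | j < x} := by
          refine measureReal_mono fun x hx => ?_
          simp only [mem_preimage, mem_singleton_iff] at hx
          simp only [mem_ofPred_eq]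
          omega
        calc _ ≤ (μ k).real {x | j < x} * (m : ℝ) ^ (j + 1) := by gcongr
          _ = ((μ k).real {x | j < x} * (m : ℝ) ^ j) * m := by ring
          _ ≤ 2 * m := by gcongr
      · have : (fun x : ℕ => min x (N - k)) ⁻¹' {j + 1} = ∅ := by
          ext x
          simp only [mem_preimage, mem_singleton_iff, mem_empty_iff_false, iff_false]
          omega
        rw [this]
        simp

lemma coeff_one_truncPoly (μ : Measure ℕ) {b : ℕ} (hb : 2 ≤ b) :
    (truncPoly μ b).coeff 1 = μ.real {1} := by
  rw [coeff_truncPoly, map_measureReal_apply Measurable.of_discrete (measurableSet_singleton 1)]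
  congr 1
  ext x
  simp only [mem_preimage, mem_singleton_iff]
  omega

lemma sum_three_le_one (μ : Measure ℕ) [IsProbabilityMeasure μ] :
    μ.real {0} + μ.real {1} + μ.real {2} ≤ 1 := by
  have h := measureReal_le_one (μ := μ) (s := ((Finset.range 3 : Finset ℕ) : Set ℕ))
  rw [← sum_measureReal_singleton] at h
  simpa only [Finset.sum_range_succ, Finset.sum_range_zero, zero_add] using h

/-- For `m = 2`, the mass at `1` stays away from `1`, uniformly in the parameter and in time. -/
lemma exists_law_real_one_le (ν : Measure ℕ) [IsProbabilityMeasure ν]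
    (hν_two : 0 < ν {j | 2 ≤ j}) : ∃ c₀ : ℝ, 0 < c₀ ∧ c₀ ≤ 1 ∧
      ∀ p ∈ Icc (0 : ℝ) 1, ∀ k, (law 2 ν p k).real {1} ≤ 1 - c₀ := by
  have hpos : 0 < ν.real {j | 2 ≤ j} := ENNReal.toReal_pos hν_two.ne' (measure_ne_top _ _)
  refine ⟨min (ν.real {j | 2 ≤ j}) (1 / 4), lt_min hpos (by norm_num),
    (min_le_right _ _).trans (by norm_num), fun p hp k => ?_⟩
  set c := min (ν.real {j | 2 ≤ j}) (1 / 4) with hc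
  have hc0 : 0 < c := lt_min hpos (by norm_num)
  have hc1 : c ≤ 1 / 4 := min_le_right _ _
  induction k with
  | zero =>
    have h1 : (law 2 ν p 0).real {1} = p * ν.real {1} := by
      rw [← coeff_pgf, pgf_law 2 ν hp 0]
      simp [lawSeries]
    have h2 : ν.real {1} + ν.real {j | 2 ≤ j} ≤ 1 := by
      rw [← measureReal_union (by simp) (MeasurableSet.of_discrete)]
      exact measureReal_le_one
    have h3 : c ≤ ν.real {j | 2 ≤ j} := min_le_left _ _
    have h4 : 0 ≤ ν.real {1} := measureReal_nonneg
    rw [h1]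
    nlinarith [hp.1, hp.2]
  | succ k ih =>
    have := isProbabilityMeasure_law 2 ν hp k
    have h1 : (law 2 ν p (k + 1)).real {1} = (law 2 ν p k).real {1} ^ 2 +
        2 * (law 2 ν p k).real {0} * (law 2 ν p k).real {2} := by
      rw [← coeff_pgf, law, pgf_step, stepSeries, PowerSeries.coeff_mk, if_neg one_ne_zero, sq,
        PowerSeries.coeff_mul, Finset.Nat.sum_antidiagonal_eq_sum_range_succ_mk]
      simp only [Finset.sum_range_succ, Finset.sum_range_zero, coeff_pgf]
      ring
    have h2 := sum_three_le_one (law 2 ν p k)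
    have h3 : 0 ≤ (law 2 ν p k).real {0} := measureReal_nonneg
    have h4 : 0 ≤ (law 2 ν p k).real {1} := measureReal_nonneg
    have h5 : 0 ≤ (law 2 ν p k).real {2} := measureReal_nonneg
    rw [h1]
    set a := (law 2 ν p k).real {0}
    set b := (law 2 ν p k).real {1}
    set d := (law 2 ν p k).real {2}
    have h6 : 2 * a * d ≤ (1 - b) ^ 2 / 2 := by nlinarith [sq_nonneg (a - d)]
    -- the convex function `b ^ 2 + (1 - b) ^ 2 / 2` is at most `1 - c` at both ends of `[0, 1 - c]`
    nlinarith [mul_nonneg h4 (sub_nonneg.2 ih)]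

/-! ### Moments of one step of the recursion -/

lemma integral_step (m : ℕ) (μ : Measure ℕ) (f : ℕ → ℝ) :
    ∫ x, f x ∂(step m μ) = ∫ y, f ((∑ i, y i) - 1) ∂(Measure.pi fun _ : Fin m => μ) := by
  rw [step, integral_map (Measurable.of_discrete).aemeasurable
    (Measurable.of_discrete).aestronglyMeasurable]

lemma integrable_step_iff (m : ℕ) (μ : Measure ℕ) (f : ℕ → ℝ) :
    Integrable f (step m μ) ↔
      Integrable (fun y => f ((∑ i, y i) - 1)) (Measure.pi fun _ : Fin m => μ) := by
  rw [step, integrable_map_measure (Measurable.of_discrete).aestronglyMeasurable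
    (Measurable.of_discrete).aemeasurable]
  rfl

lemma integrable_sum_pi (m : ℕ) (μ : Measure ℕ) [IsProbabilityMeasure μ] {f : ℕ → ℝ}
    (hf : Integrable f μ) :
    Integrable (fun y => ∑ i, f (y i)) (Measure.pi fun _ : Fin m => μ) :=
  integrable_finsetSum _ fun i _ => integrable_comp_eval (μ := fun _ : Fin m => μ) (i := i) hf

lemma integral_sum_pi (m : ℕ) (μ : Measure ℕ) [IsProbabilityMeasure μ] {f : ℕ → ℝ}
    (hf : Integrable f μ) :
    ∫ y, ∑ i, f (y i) ∂(Measure.pi fun _ : Fin m => μ) = m * ∫ x, f x ∂μ := by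
  rw [integral_finsetSum _ fun i _ =>
    integrable_comp_eval (μ := fun _ : Fin m => μ) (i := i) hf]
  have h (i : Fin m) : ∫ y, f (y i) ∂(Measure.pi fun _ : Fin m => μ) = ∫ x, f x ∂μ :=
    integral_comp_eval (μ := fun _ : Fin m => μ) (i := i) hf.aestronglyMeasurable
  simp [h]

lemma integrable_id_step (m : ℕ) (μ : Measure ℕ) [IsProbabilityMeasure μ]
    (hμ : Integrable (fun x : ℕ => (x : ℝ)) μ) :
    Integrable (fun x : ℕ => (x : ℝ)) (step m μ) := by
  rw [integrable_step_iff]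
  refine (integrable_sum_pi m μ hμ).mono (Measurable.of_discrete).aestronglyMeasurable
    (ae_of_all _ fun y => ?_)
  rw [← Nat.cast_sum, Real.norm_natCast, Real.norm_natCast]
  exact_mod_cast Nat.sub_le _ _

/-- The mean evolves by `E X ↦ m E X - 1 + P(X = 0) ^ m`. -/
lemma integral_id_step (m : ℕ) (μ : Measure ℕ) [IsProbabilityMeasure μ]
    (hμ : Integrable (fun x : ℕ => (x : ℝ)) μ) :
    ∫ x, (x : ℝ) ∂(step m μ) = m * ∫ x, (x : ℝ) ∂μ - 1 + μ.real {0} ^ m := by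
  rw [integral_step]
  have hset : {y : Fin m → ℕ | ∑ i, y i = 0} = Set.pi univ fun _ => {0} := by
    ext y; simp
  have h0 : (Measure.pi fun _ : Fin m => μ).real {y | ∑ i, y i = 0} = μ.real {0} ^ m := by
    rw [hset, measureReal_def, Measure.pi_pi]
    simp [measureReal_def]
  have h (y : Fin m → ℕ) : (((∑ i, y i) - 1 : ℕ) : ℝ) =
      (∑ i, (y i : ℝ) - 1) + Set.indicator {y | ∑ i, y i = 0} (fun _ => 1) y := by
    rw [← Nat.cast_sum]
    by_cases hy : ∑ i, y i = 0
    · rw [indicator_of_mem (show y ∈ {y : Fin m → ℕ | ∑ i, y i = 0} from hy), hy]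
      norm_num
    · simp only [Set.indicator, mem_ofPred_eq, hy, if_false, add_zero]
      rw [Nat.cast_sub (by omega)]
      simp
  simp_rw [h]
  have hs := integrable_sum_pi m μ hμ
  have hs1 : Integrable (fun y : Fin m → ℕ => ∑ i, (y i : ℝ) - 1)
      (Measure.pi fun _ : Fin m => μ) := hs.sub (integrable_const 1)
  rw [integral_add hs1 ((integrable_const 1).indicator MeasurableSet.of_discrete),
    integral_sub hs (integrable_const 1), integral_sum_pi m μ hμ,
    integral_indicator_const _ MeasurableSet.of_discrete, h0]
  simp

lemma memLp_of_ae_le {ρ : Measure ℕ} [IsFiniteMeasure ρ] {B : ℕ} (hB : ∀ᵐ x ∂ρ, x ≤ B)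
    (f : ℕ → ℝ) (q : ENNReal) : MemLp f q ρ := by
  refine MemLp.of_bound (Measurable.of_discrete).aestronglyMeasurable
    (∑ j ∈ Finset.range (B + 1), ‖f j‖) (hB.mono fun x hx => ?_)
  exact Finset.single_le_sum (f := fun j => ‖f j‖) (fun _ _ => norm_nonneg _)
    (Finset.mem_range.2 (by omega))

lemma integrable_of_ae_le {ρ : Measure ℕ} [IsFiniteMeasure ρ] {B : ℕ} (hB : ∀ᵐ x ∂ρ, x ≤ B)
    (f : ℕ → ℝ) : Integrable f ρ :=
  memLp_one_iff_integrable.1 (memLp_of_ae_le hB f 1)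

lemma ae_pi_of_ae {α : Type*} [MeasurableSpace α] {m : ℕ} {ρ : Measure α}
    [IsProbabilityMeasure ρ] {P : α → Prop} (h : ∀ᵐ x ∂ρ, P x) :
    ∀ᵐ y ∂(Measure.pi fun _ : Fin m => ρ), ∀ i, P (y i) :=
  eventually_all.2 fun i =>
    (Measure.tendsto_eval_ae_ae (μ := fun _ : Fin m => ρ) (i := i)).eventually h

lemma ae_le_step {m : ℕ} {ρ : Measure ℕ} [IsProbabilityMeasure ρ] {B : ℕ}
    (hB : ∀ᵐ x ∂ρ, x ≤ B) : ∀ᵐ x ∂(step m ρ), x ≤ m * B := by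
  rw [step, ae_map_iff (Measurable.of_discrete).aemeasurable MeasurableSet.of_discrete]
  filter_upwards [ae_pi_of_ae (m := m) hB] with y hy
  have : ∑ i, y i ≤ ∑ _i : Fin m, B := Finset.sum_le_sum fun i _ => hy i
  simp only [Finset.sum_const, Finset.card_univ, Fintype.card_fin, smul_eq_mul] at this
  omega

/-- Excess above a level: truncated subtraction satisfies `∑ (zᵢ - c) ≤ (∑ zᵢ) - c`. -/
lemma excess_step_ge (m r : ℕ) {ρ : Measure ℕ} [IsProbabilityMeasure ρ] {B : ℕ}
    (hB : ∀ᵐ x ∂ρ, x ≤ B) :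
    m * ∫ x, ((x - (r + 1) : ℕ) : ℝ) ∂ρ ≤ ∫ x, ((x - r : ℕ) : ℝ) ∂(step m ρ) := by
  have := isProbabilityMeasure_step m ρ
  have hint := integrable_of_ae_le hB fun x => ((x - (r + 1) : ℕ) : ℝ)
  rw [integral_step, ← integral_sum_pi m ρ hint]
  refine integral_mono (integrable_sum_pi m ρ hint)
    ((integrable_step_iff m ρ fun x => ((x - r : ℕ) : ℝ)).1
      (integrable_of_ae_le (ae_le_step hB) _)) fun y => ?_
  rw [← Nat.cast_sum, Nat.cast_le, Nat.sub_sub, add_comm 1 r]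
  by_cases h : ∀ i, y i ≤ r + 1
  · rw [Finset.sum_eq_zero fun i _ => Nat.sub_eq_zero_of_le (h i)]
    exact Nat.zero_le _
  · push Not at h
    obtain ⟨i, hi⟩ := h
    rw [← Finset.add_sum_erase _ _ (Finset.mem_univ i),
      ← Finset.add_sum_erase _ (fun i => y i) (Finset.mem_univ i)]
    have : ∑ j ∈ Finset.univ.erase i, (y j - (r + 1)) ≤ ∑ j ∈ Finset.univ.erase i, y j :=
      Finset.sum_le_sum fun j _ => Nat.sub_le _ _
    omega

/-- The positive part is `1`-Lipschitz, so one step multiplies the variance by at most `m`. -/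
lemma variance_step_le (m : ℕ) {ρ : Measure ℕ} [IsProbabilityMeasure ρ] {B : ℕ}
    (hB : ∀ᵐ x ∂ρ, x ≤ B) :
    ProbabilityTheory.variance (fun x : ℕ => (x : ℝ)) (step m ρ) ≤
      m * ProbabilityTheory.variance (fun x : ℕ => (x : ℝ)) ρ := by
  set π : Measure (Fin m → ℕ) := Measure.pi fun _ : Fin m => ρ with hπ
  set S : (Fin m → ℕ) → ℝ := ∑ i, fun y : Fin m → ℕ => (y i : ℝ) with hS
  have hSy (y : Fin m → ℕ) : S y = ((∑ i, y i : ℕ) : ℝ) := by simp [hS]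
  have hS2 : MemLp S 2 π :=
    memLp_finsetSum' _ fun i _ => (memLp_of_ae_le hB (fun x => (x : ℝ)) 2).comp_measurePreserving
      (measurePreserving_eval (fun _ : Fin m => ρ) i)
  have hvar : ProbabilityTheory.variance S π =
      m * ProbabilityTheory.variance (fun x : ℕ => (x : ℝ)) ρ := by
    rw [hS, hπ, ProbabilityTheory.variance_sum_pi (μ := fun _ : Fin m => ρ)
      (X := fun _ x => (x : ℝ)) fun i => memLp_of_ae_le hB (fun x => (x : ℝ)) 2]
    simp
  rw [← hvar, step, ProbabilityTheory.variance_map (Measurable.of_discrete).aemeasurable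
    (Measurable.of_discrete).aemeasurable]
  set c : ℝ := max (∫ y, S y ∂π - 1) 0 with hc
  have hmeas : AEStronglyMeasurable
      ((fun x : ℕ => (x : ℝ)) ∘ fun y : Fin m → ℕ => (∑ i, y i) - 1) π :=
    (Measurable.of_discrete).aestronglyMeasurable
  rw [← ProbabilityTheory.variance_sub_const hmeas c]
  refine (ProbabilityTheory.variance_le_expectation_sq
    (hmeas.sub aestronglyMeasurable_const)).trans ?_
  rw [ProbabilityTheory.variance_eq_integral hS2.aemeasurable]
  have hpt (y : Fin m → ℕ) : (((fun x : ℕ => (x : ℝ)) ∘ fun y : Fin m → ℕ => (∑ i, y i) - 1) y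
      - c) ^ 2 ≤ (S y - ∫ y, S y ∂π) ^ 2 := by
    have h1 : ((fun x : ℕ => (x : ℝ)) ∘ fun y : Fin m → ℕ => (∑ i, y i) - 1) y =
        max (S y - 1) 0 := by
      rw [hSy, Function.comp_apply]
      rcases Nat.eq_zero_or_pos (∑ i, y i) with h | h
      · simp [h]
      · rw [Nat.cast_sub h, max_eq_left]
        · simp
        · have : (1 : ℝ) ≤ (∑ i, y i : ℕ) := by exact_mod_cast h
          linarith
    rw [h1, hc]
    refine sq_le_sq.2 ((abs_max_sub_max_le_abs _ _ _).trans (le_of_eq ?_))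
    congr 1
    ring
  refine integral_mono_of_nonneg (ae_of_all _ fun y => sq_nonneg _) ?_ (ae_of_all _ hpt)
  exact (hS2.sub (memLp_const _)).integrable_sq

/-! ### A large tail makes the system explode -/

/-- Stochastic domination of laws on `ℕ`, witnessed by a coupling. -/
def Dominates (μ ρ : Measure ℕ) : Prop :=
  ∃ η : Measure (ℕ × ℕ), IsProbabilityMeasure η ∧ η.map Prod.fst = μ ∧ η.map Prod.snd = ρ ∧
    ∀ᵐ z ∂η, z.2 ≤ z.1

lemma step_map {α : Type*} [MeasurableSpace α] (m : ℕ) (η : Measure α) [IsProbabilityMeasure η]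
    {f : α → ℕ} (hf : Measurable f) :
    step m (η.map f) = (Measure.pi fun _ : Fin m => η).map fun y => (∑ i, f (y i)) - 1 := by
  have : IsProbabilityMeasure (η.map f) := Measure.isProbabilityMeasure_map hf.aemeasurable
  rw [step, ← Measure.pi_map_pi (fun _ => hf.aemeasurable),
    Measure.map_map Measurable.of_discrete (by fun_prop)]
  rfl

lemma Dominates.step (m : ℕ) {μ ρ : Measure ℕ} (h : Dominates μ ρ) :
    Dominates (step m μ) (step m ρ) := by
  obtain ⟨η, hη, rfl, rfl, hle⟩ := h
  have hφ : Measurable fun y : Fin m → ℕ × ℕ => ((∑ i, (y i).1) - 1, (∑ i, (y i).2) - 1) :=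
    Measurable.of_discrete
  refine ⟨(Measure.pi fun _ : Fin m => η).map
    fun y => ((∑ i, (y i).1) - 1, (∑ i, (y i).2) - 1),
    Measure.isProbabilityMeasure_map hφ.aemeasurable, ?_, ?_, ?_⟩
  · rw [Measure.map_map measurable_fst hφ, step_map m η measurable_fst]
    rfl
  · rw [Measure.map_map measurable_snd hφ, step_map m η measurable_snd]
    rfl
  · rw [ae_map_iff hφ.aemeasurable MeasurableSet.of_discrete]
    filter_upwards [ae_pi_of_ae (m := m) hle] with y hy
    exact Nat.sub_le_sub_right (Finset.sum_le_sum fun i _ => hy i) 1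

lemma Dominates.iterate (m : ℕ) {μ ρ : Measure ℕ} (h : Dominates μ ρ) (l : ℕ) :
    Dominates ((DerridaRetaux.step m)^[l] μ) ((DerridaRetaux.step m)^[l] ρ) := by
  induction l with
  | zero => exact h
  | succ l ih =>
    rw [Function.iterate_succ_apply', Function.iterate_succ_apply']
    exact ih.step m

lemma Dominates.real_gt_le {μ ρ : Measure ℕ} (h : Dominates μ ρ) (n : ℕ) :
    ρ.real {x | n < x} ≤ μ.real {x | n < x} := by
  obtain ⟨η, hη, rfl, rfl, hle⟩ := h
  rw [map_measureReal_apply measurable_snd MeasurableSet.of_discrete,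
    map_measureReal_apply measurable_fst MeasurableSet.of_discrete]
  refine ENNReal.toReal_mono (measure_ne_top _ _) (measure_mono_ae ?_)
  filter_upwards [hle] with z hz hn
  exact lt_of_lt_of_le (show n < z.2 from hn) hz

/-- If `P(X > j)` is at least `2 / m ^ j`, then after `j + O(log n)` more steps the variable
exceeds `n` with probability at least `1 / 2`. The variable is bounded below by the one started
from `(j + 1) 1_{X > j}`, whose mean stays at least `2` during `j` steps and then grows like `m ^ i`,
while its variance grows at most like `m ^ i`; Chebyshev's inequality does the rest. -/
lemma half_le_iterate_step_real_gt {m : ℕ} (hm : 2 ≤ m) (μ : Measure ℕ) [IsProbabilityMeasure μ]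
    {i j n : ℕ} (hj : j ≤ n) (hi : 16 * ((n : ℝ) + 1) ^ 2 ≤ (m : ℝ) ^ i)
    (hμ : 2 ≤ μ.real {x | j < x} * (m : ℝ) ^ j) :
    1 / 2 ≤ ((step m)^[j + i] μ).real {x | n < x} := by
  have hm2 : (2 : ℝ) ≤ m := by exact_mod_cast hm
  set φ : ℕ → ℕ := fun x => if j < x then j + 1 else 0 with hφ
  have hφm : Measurable φ := Measurable.of_discrete
  set ρ : ℕ → Measure ℕ := fun l => (step m)^[l] (μ.map φ) with hρ
  have hρs (l : ℕ) : ρ (l + 1) = step m (ρ l) := Function.iterate_succ_apply' _ _ _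
  have hprob (l : ℕ) : IsProbabilityMeasure (ρ l) := by
    induction l with
    | zero => exact Measure.isProbabilityMeasure_map hφm.aemeasurable
    | succ l ih => rw [hρs]; exact isProbabilityMeasure_step m _
  have hbdd (l : ℕ) : ∃ B : ℕ, ∀ᵐ x ∂(ρ l), x ≤ B := by
    induction l with
    | zero =>
      refine ⟨j + 1, ?_⟩
      change ∀ᵐ x ∂(μ.map φ), x ≤ j + 1
      rw [ae_map_iff hφm.aemeasurable MeasurableSet.of_discrete]
      refine ae_of_all _ fun x => ?_
      simp only [hφ]
      split_ifs <;> omega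
    | succ l ih =>
      obtain ⟨B, hB⟩ := ih
      exact ⟨m * B, by rw [hρs]; exact ae_le_step hB⟩
  have hdom : Dominates μ (μ.map φ) := by
    have hg : Measurable fun x : ℕ => (x, φ x) := Measurable.of_discrete
    refine ⟨μ.map fun x => (x, φ x), Measure.isProbabilityMeasure_map hg.aemeasurable, ?_, ?_, ?_⟩
    · rw [Measure.map_map measurable_fst hg]
      exact Measure.map_id
    · rw [Measure.map_map measurable_snd hg]
      rfl
    · rw [ae_map_iff hg.aemeasurable MeasurableSet.of_discrete]
      refine ae_of_all _ fun x => ?_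
      simp only [hφ]
      split_ifs <;> omega
  refine le_trans ?_ ((hdom.iterate m (j + i)).real_gt_le n)
  change 1 / 2 ≤ (ρ (j + i)).real {x | n < x}
  set τ := μ.real {x | j < x} with hτ
  have hτ0 : 0 ≤ τ := measureReal_nonneg
  have hind (f : ℕ → ℝ) (hf : f 0 = 0) : ∫ x, f x ∂(ρ 0) = f (j + 1) * τ := by
    change ∫ x, f x ∂(μ.map φ) = _
    rw [integral_map hφm.aemeasurable (Measurable.of_discrete).aestronglyMeasurable]
    have h (x : ℕ) : f (φ x) = Set.indicator {x | j < x} (fun _ => f (j + 1)) x := by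
      simp only [hφ, Set.indicator, mem_ofPred_eq]
      split_ifs <;> simp [hf]
    simp_rw [h]
    rw [integral_indicator_const _ MeasurableSet.of_discrete, smul_eq_mul, mul_comm]
  have hexc (l r : ℕ) : (m : ℝ) ^ l * ∫ x, ((x - (r + l) : ℕ) : ℝ) ∂(ρ 0) ≤
      ∫ x, ((x - r : ℕ) : ℝ) ∂(ρ l) := by
    induction l generalizing r with
    | zero => simp
    | succ l ih =>
      obtain ⟨B, hB⟩ := hbdd l
      rw [hρs]
      refine le_trans ?_ (excess_step_ge m r hB)
      have h1 := mul_le_mul_of_nonneg_left (ih (r + 1)) (by positivity : (0 : ℝ) ≤ m)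
      rw [show r + (l + 1) = r + 1 + l by ring, pow_succ']
      linarith
  set M := τ * (m : ℝ) ^ j with hM
  set e : ℕ → ℝ := fun l => ∫ x, (x : ℝ) ∂(ρ l) with he
  have hej : M ≤ e j := by
    have h1 := hexc j 0
    rw [hind (fun x => ((x - (0 + j) : ℕ) : ℝ)) (by simp)] at h1
    simp only [zero_add, Nat.add_sub_cancel_left, Nat.cast_one, one_mul, Nat.sub_zero] at h1
    rw [hM, mul_comm]
    exact h1
  have hegrow (l : ℕ) : 1 + (m : ℝ) ^ l * (M - 1) ≤ e (j + l) := by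
    induction l with
    | zero => simpa using hej
    | succ l ih =>
      obtain ⟨B, hB⟩ := hbdd (j + l)
      have h1 := integral_id_step m (ρ (j + l)) (integrable_of_ae_le hB fun x => (x : ℝ))
      have h2 : 0 ≤ (ρ (j + l)).real {0} ^ m := by positivity
      have h3 : e (j + (l + 1)) = m * e (j + l) - 1 + (ρ (j + l)).real {0} ^ m := by
        rw [← h1, ← hρs]; rfl
      rw [h3, pow_succ']
      nlinarith
  have hvar (l : ℕ) : ProbabilityTheory.variance (fun x : ℕ => (x : ℝ)) (ρ l) ≤
      (m : ℝ) ^ l * (((j : ℝ) + 1) ^ 2 * τ) := by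
    induction l with
    | zero =>
      refine (ProbabilityTheory.variance_le_expectation_sq
        (Measurable.of_discrete).aestronglyMeasurable).trans (le_of_eq ?_)
      have := hind (fun x => (x : ℝ) ^ 2) (by simp)
      simpa using this
    | succ l ih =>
      obtain ⟨B, hB⟩ := hbdd l
      rw [hρs, pow_succ', mul_assoc]
      exact (variance_step_le m hB).trans (mul_le_mul_of_nonneg_left ih (by positivity))
  obtain ⟨B, hB⟩ := hbdd (j + i)
  have hn0 : (0 : ℝ) ≤ n := n.cast_nonneg
  have hj0 : (0 : ℝ) ≤ j := j.cast_nonneg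
  have hjn : (j : ℝ) ≤ n := by exact_mod_cast hj
  have hpi : (0 : ℝ) < (m : ℝ) ^ i := by positivity
  set W := (m : ℝ) ^ i * M with hW
  have hW1 : 32 * ((n : ℝ) + 1) ^ 2 ≤ W := by
    rw [hW]; nlinarith
  have hW0 : 0 < W := lt_of_lt_of_le (by positivity) hW1
  have heW : W / 2 ≤ e (j + i) := by
    refine le_trans ?_ (hegrow i)
    rw [hW]; nlinarith
  have hvW : ProbabilityTheory.variance (fun x : ℕ => (x : ℝ)) (ρ (j + i)) ≤
      ((n : ℝ) + 1) ^ 2 * W := by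
    refine (hvar (j + i)).trans ?_
    calc (m : ℝ) ^ (j + i) * (((j : ℝ) + 1) ^ 2 * τ) = ((j : ℝ) + 1) ^ 2 * W := by
          rw [hW, hM, pow_add]; ring
      _ ≤ _ := by gcongr
  have hcheb := ProbabilityTheory.meas_ge_le_variance_div_sq
    (memLp_of_ae_le hB (fun x => (x : ℝ)) 2) (show 0 < W / 4 by linarith)
  have hcheb' : (ρ (j + i)).real {x : ℕ | W / 4 ≤ |(x : ℝ) - e (j + i)|} ≤ 1 / 2 := by
    refine ENNReal.toReal_le_of_le_ofReal (by norm_num)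
      (hcheb.trans (ENNReal.ofReal_le_ofReal ?_))
    rw [div_le_iff₀ (by positivity)]
    nlinarith
  have hcompl : {x : ℕ | n < x}ᶜ ⊆ {x : ℕ | W / 4 ≤ |(x : ℝ) - e (j + i)|} := by
    intro x hx
    have hxn : (x : ℝ) ≤ n := by
      simp only [mem_compl_iff, mem_ofPred_eq, not_lt] at hx
      exact_mod_cast hx
    rw [mem_ofPred_eq, abs_sub_comm]
    refine le_trans ?_ (le_abs_self _)
    nlinarith
  have h1 := measureReal_mono (μ := ρ (j + i)) hcompl
  rw [probReal_compl_eq_one_sub MeasurableSet.of_discrete] at h1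
  linarith

/-! ### Perturbation of the parameter -/

/-- The weighted sum `∑_{j < D} ‖fⱼ‖ s ^ min j b` of the coefficients of a power series. -/
noncomputable def wnorm (D b : ℕ) (s : ℝ) (f : PowerSeries ℂ) : ℝ :=
  ∑ j ∈ Finset.range D, ‖PowerSeries.coeff j f‖ * s ^ min j b

section wnorm

variable {D b : ℕ} {s : ℝ} {f g : PowerSeries ℂ}

lemma wnorm_nonneg (hs : 0 ≤ s) : 0 ≤ wnorm D b s f :=
  Finset.sum_nonneg fun _ _ => by positivity

lemma wnorm_add_le (hs : 0 ≤ s) : wnorm D b s (f + g) ≤ wnorm D b s f + wnorm D b s g := by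
  rw [wnorm, wnorm, wnorm, ← Finset.sum_add_distrib]
  refine Finset.sum_le_sum fun j _ => ?_
  rw [map_add, ← add_mul]
  gcongr
  exact norm_add_le _ _

lemma wnorm_mono_left {D' : ℕ} (hs : 0 ≤ s) (hD : D ≤ D') : wnorm D b s f ≤ wnorm D' b s f :=
  Finset.sum_le_sum_of_subset_of_nonneg (Finset.range_mono hD) fun _ _ _ => by positivity

lemma wnorm_zero_le (hs : 1 ≤ s) : wnorm D 0 1 f ≤ wnorm D b s f := by
  refine Finset.sum_le_sum fun j _ => ?_
  rw [one_pow]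
  gcongr
  exact one_le_pow₀ hs

lemma wnorm_mul_le (hs : 1 ≤ s) : wnorm D b s (f * g) ≤ wnorm D b s f * wnorm D b s g := by
  classical
  have hs0 : 0 ≤ s := by linarith
  set F : ℕ × ℕ → ℝ := fun x => (‖PowerSeries.coeff x.1 f‖ * s ^ min x.1 b) *
    (‖PowerSeries.coeff x.2 g‖ * s ^ min x.2 b) with hF
  have hF0 (x : ℕ × ℕ) : 0 ≤ F x := by positivity
  calc wnorm D b s (f * g) ≤
      ∑ n ∈ Finset.range D, ∑ x ∈ Finset.HasAntidiagonal.antidiagonal n, F x := by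
        refine Finset.sum_le_sum fun n _ => ?_
        rw [PowerSeries.coeff_mul]
        refine (mul_le_mul_of_nonneg_right (norm_sum_le _ _) (by positivity)).trans ?_
        rw [Finset.sum_mul]
        refine Finset.sum_le_sum fun x hx => ?_
        have hxn := Finset.HasAntidiagonal.mem_antidiagonal.1 hx
        have hpow : s ^ min n b ≤ s ^ min x.1 b * s ^ min x.2 b := by
          rw [← pow_add]
          exact pow_le_pow_right₀ hs (by omega)
        rw [norm_mul]
        calc _ ≤ ‖PowerSeries.coeff x.1 f‖ * ‖PowerSeries.coeff x.2 g‖ *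
              (s ^ min x.1 b * s ^ min x.2 b) := by gcongr
          _ = F x := by rw [hF]; ring
    _ = ∑ x ∈ (Finset.range D ×ˢ Finset.range D) with x.1 + x.2 ∈ Finset.range D, F x := by
        rw [← Finset.sum_fiberwise_of_maps_to (t := Finset.range D) (f := F)
          (g := fun x : ℕ × ℕ => x.1 + x.2)
          (s := {x ∈ Finset.range D ×ˢ Finset.range D | x.1 + x.2 ∈ Finset.range D})
          fun x hx => (Finset.mem_filter.1 hx).2]
        refine Finset.sum_congr rfl fun n hn => Finset.sum_congr ?_ fun _ _ => rfl
        ext x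
        have := Finset.mem_range.1 hn
        simp only [Finset.HasAntidiagonal.mem_antidiagonal, Finset.mem_filter, Finset.mem_product,
          Finset.mem_range]
        omega
    _ ≤ ∑ x ∈ Finset.range D ×ˢ Finset.range D, F x :=
        Finset.sum_le_sum_of_subset_of_nonneg (Finset.filter_subset _ _) fun x _ _ => hF0 x
    _ = _ := by rw [wnorm, wnorm, Finset.sum_mul_sum, Finset.sum_product]

lemma wnorm_one_le (hs : 1 ≤ s) : wnorm D b s 1 ≤ 1 := by
  refine (wnorm_mono_left (by linarith) (Nat.le_succ D)).trans ?_
  rw [wnorm, Finset.sum_range_succ']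
  simp [PowerSeries.coeff_one]

lemma wnorm_pow_le (hs : 1 ≤ s) (n : ℕ) : wnorm D b s (f ^ n) ≤ wnorm D b s f ^ n := by
  induction n with
  | zero => simpa using wnorm_one_le hs
  | succ n ih =>
    rw [pow_succ, pow_succ]
    exact (wnorm_mul_le hs).trans (mul_le_mul_of_nonneg_right ih (wnorm_nonneg (by linarith)))

lemma wnorm_X_sub_one_le (hs : 1 ≤ s) : wnorm D b s (PowerSeries.X - 1) ≤ 1 + s := by
  refine (wnorm_mono_left (by linarith) (Nat.le_add_right D 2)).trans ?_
  rw [wnorm, Finset.sum_range_succ', Finset.sum_range_succ']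
  have h : s ^ min 1 b ≤ s := by
    calc s ^ min 1 b ≤ s ^ 1 := pow_le_pow_right₀ hs (by omega)
      _ = s := pow_one s
  have h0 : ∑ k ∈ Finset.range D, ‖PowerSeries.coeff (k + 1 + 1)
      (PowerSeries.X - 1 : PowerSeries ℂ)‖ * s ^ min (k + 1 + 1) b = 0 :=
    Finset.sum_eq_zero fun k _ => by simp [PowerSeries.coeff_X, PowerSeries.coeff_one]
  rw [h0]
  simp [PowerSeries.coeff_X, PowerSeries.coeff_one]
  linarith

lemma wnorm_sum_le {ι : Type*} (hs : 0 ≤ s) (t : Finset ι) (F : ι → PowerSeries ℂ) :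
    wnorm D b s (∑ i ∈ t, F i) ≤ ∑ i ∈ t, wnorm D b s (F i) := by
  classical
  induction t using Finset.induction_on with
  | empty => simp [wnorm]
  | insert i t hi ih =>
    rw [Finset.sum_insert hi, Finset.sum_insert hi]
    exact (wnorm_add_le hs).trans (by gcongr)

lemma norm_coeff_zero_le_wnorm : ‖PowerSeries.coeff 0 f‖ = wnorm 1 b s f := by
  simp [wnorm]

/-- Without weights, the recursion is a contraction for power series of norm at most `1`. -/
lemma wnorm_stepSeries_le (m D : ℕ) (f : PowerSeries ℂ) :
    wnorm D 0 1 (stepSeries m f) ≤ wnorm (D + 1) 0 1 f ^ m := by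
  refine le_trans ?_ (wnorm_pow_le le_rfl m)
  rcases D with _ | D
  · simp [wnorm]
  · rw [wnorm, wnorm, Finset.sum_range_succ', Finset.sum_range_succ', Finset.sum_range_succ']
    have h1 (k : ℕ) : PowerSeries.coeff (k + 1) (stepSeries m f) =
        PowerSeries.coeff (k + 1 + 1) (f ^ m) := by simp [stepSeries]
    have h2 : PowerSeries.coeff 0 (stepSeries m f) =
        PowerSeries.coeff 0 (f ^ m) + PowerSeries.coeff 1 (f ^ m) := by simp [stepSeries]
    have h3 := norm_add_le (PowerSeries.coeff 0 (f ^ m)) (PowerSeries.coeff 1 (f ^ m))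
    simp only [h1, h2, one_pow, mul_one, zero_add]
    linarith

/-- The shift `∑ fⱼ Xʲ ↦ ∑ fⱼ₊₁ Xʲ`. -/
noncomputable def shift (f : PowerSeries ℂ) : PowerSeries ℂ :=
  PowerSeries.mk fun j => PowerSeries.coeff (j + 1) f

lemma wnorm_shift_le (hs : 0 ≤ s) (hb : 1 ≤ b) :
    s * wnorm D (b - 1) s (shift f) ≤ wnorm (D + 1) b s f := by
  rw [wnorm, wnorm, Finset.sum_range_succ', Finset.mul_sum]
  refine le_trans (le_of_eq ?_) (le_add_of_nonneg_right (by positivity))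
  refine Finset.sum_congr rfl fun j _ => ?_
  rw [show min (j + 1) b = min j (b - 1) + 1 by omega, shift, PowerSeries.coeff_mk, pow_succ]
  ring

lemma wnorm_shift_le_zero (hs : 0 ≤ s) : wnorm D 0 s (shift f) ≤ wnorm (D + 1) 0 s f := by
  rw [wnorm, wnorm, Finset.sum_range_succ']
  refine le_trans (le_of_eq ?_) (le_add_of_nonneg_right (by positivity))
  simp [shift]

end wnorm

/-- The quotient by `X - 1` of the variation of `lawSeries` when the parameter moves from `p` to
`p + z`. Both series formally take the value `1` at `X = 1`. -/
noncomputable def perturb (m : ℕ) (ν : Measure ℕ) (p z : ℂ) : ℕ → PowerSeries ℂ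
  | 0 => PowerSeries.C z * PowerSeries.mk fun j => ((ν.real {x | j < x} : ℝ) : ℂ)
  | k + 1 => shift (perturb m ν p z k *
      ∑ i ∈ Finset.range m, lawSeries m ν (p + z) k ^ i * lawSeries m ν p k ^ (m - 1 - i))

lemma lawSeries_add (m : ℕ) (ν : Measure ℕ) [IsProbabilityMeasure ν] (p z : ℂ) (k : ℕ) :
    lawSeries m ν (p + z) k =
      lawSeries m ν p k + (PowerSeries.X - 1) * perturb m ν p z k := by
  induction k with
  | zero =>
    have h : PowerSeries.map (algebraMap ℝ ℂ) (pgf ν) = 1 + (PowerSeries.X - 1) *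
        PowerSeries.mk fun j => ((ν.real {x | j < x} : ℝ) : ℂ) := by
      ext j
      have hd (i : ℕ) : ν.real {x | i < x} = ν.real {i + 1} + ν.real {x | i + 1 < x} := by
        rw [← measureReal_union (by simp) MeasurableSet.of_discrete]
        congr 1
        ext x
        simp only [mem_ofPred_eq, mem_union, mem_singleton_iff]
        omega
      have h0 : ν.real {0} + ν.real {x | 0 < x} = 1 := by
        rw [← measureReal_union (by simp) MeasurableSet.of_discrete,
          show ({0} ∪ {x : ℕ | 0 < x}) = univ by ext x; simp; omega, probReal_univ]
      rw [sub_mul, one_mul, map_add, map_sub]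
      rcases j with _ | j
      · simp only [PowerSeries.coeff_map, coeff_pgf, PowerSeries.coeff_zero_X_mul,
          PowerSeries.coeff_mk, PowerSeries.coeff_one, if_true, Complex.coe_algebraMap]
        rw [eq_sub_of_add_eq h0]
        push_cast
        ring
      · rw [PowerSeries.coeff_succ_X_mul]
        simp only [PowerSeries.coeff_map, coeff_pgf, PowerSeries.coeff_mk, PowerSeries.coeff_one,
          Complex.coe_algebraMap, hd j]
        simp
    rw [lawSeries, lawSeries, perturb, h]
    simp only [map_add, map_sub, map_one]
    ring
  | succ k ih =>
    have hgeom := (Commute.all (lawSeries m ν (p + z) k) (lawSeries m ν p k)).mul_geom_sum₂ m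
    have hdiff : lawSeries m ν (p + z) k - lawSeries m ν p k =
        (PowerSeries.X - 1) * perturb m ν p z k := by rw [ih]; ring
    rw [hdiff, mul_assoc] at hgeom
    rw [lawSeries, lawSeries, perturb]
    set γ := perturb m ν p z k *
      ∑ i ∈ Finset.range m, lawSeries m ν (p + z) k ^ i * lawSeries m ν p k ^ (m - 1 - i)
    rw [sub_mul, one_mul, eq_sub_iff_add_eq] at hgeom
    have hc (j : ℕ) := congrArg (PowerSeries.coeff j) hgeom
    have hc0 := hc 0
    simp only [map_add, map_sub, PowerSeries.coeff_zero_X_mul] at hc0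
    have hcs (j : ℕ) := hc (j + 1)
    simp only [map_add, map_sub, PowerSeries.coeff_succ_X_mul] at hcs
    ext j
    rw [map_add, sub_mul, one_mul, map_sub]
    rcases j with _ | j
    · simp only [stepSeries, shift, PowerSeries.coeff_mk, if_true, PowerSeries.coeff_zero_X_mul]
      rw [← hc0, ← zero_add 1, ← hcs]
      ring
    · simp only [stepSeries, shift, PowerSeries.coeff_mk, PowerSeries.coeff_succ_X_mul,
        Nat.succ_ne_zero, if_false]
      rw [← hcs]
      ring

/-- Growth of the unshifted perturbation in one step. -/
lemma wnorm_perturb_mul_le (m : ℕ) (ν : Measure ℕ) [IsProbabilityMeasure ν]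
    (p z : ℂ) (k : ℕ) {D b : ℕ} {s G : ℝ} (hs : 1 ≤ s) (hG : 1 ≤ G)
    (hA : wnorm D b s (lawSeries m ν p k) ≤ G) :
    wnorm D b s (perturb m ν p z k *
      ∑ i ∈ Finset.range m, lawSeries m ν (p + z) k ^ i * lawSeries m ν p k ^ (m - 1 - i)) ≤
      m * G ^ (m - 1) * (1 + (1 + s) * wnorm D b s (perturb m ν p z k)) ^ (m - 1) *
        wnorm D b s (perturb m ν p z k) := by
  have hs0 : 0 ≤ s := by linarith
  set x := wnorm D b s (perturb m ν p z k) with hx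
  have hx0 : 0 ≤ x := wnorm_nonneg hs0
  have hA0 : 0 ≤ wnorm D b s (lawSeries m ν p k) := wnorm_nonneg hs0
  have hA0' : 0 ≤ wnorm D b s (lawSeries m ν (p + z) k) := wnorm_nonneg hs0
  set L := G * (1 + (1 + s) * x) with hL
  have hL1 : wnorm D b s (lawSeries m ν p k) ≤ L := by
    refine hA.trans ?_
    rw [hL]; nlinarith [mul_nonneg (by linarith : 0 ≤ 1 + s) hx0]
  have hL2 : wnorm D b s (lawSeries m ν (p + z) k) ≤ L := by
    rw [lawSeries_add]
    have h1 : wnorm D b s ((PowerSeries.X - 1) * perturb m ν p z k) ≤ (1 + s) * x :=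
      (wnorm_mul_le hs).trans (mul_le_mul_of_nonneg_right (wnorm_X_sub_one_le hs) hx0)
    refine (wnorm_add_le hs0).trans ((add_le_add hA h1).trans ?_)
    rw [hL]; nlinarith [mul_nonneg (by linarith : 0 ≤ 1 + s) hx0]
  have hterm (i : ℕ) (hi : i ∈ Finset.range m) :
      wnorm D b s (lawSeries m ν (p + z) k ^ i * lawSeries m ν p k ^ (m - 1 - i)) ≤
        L ^ (m - 1) := by
    refine (wnorm_mul_le hs).trans ?_
    rw [show m - 1 = i + (m - 1 - i) by have := Finset.mem_range.1 hi; omega, pow_add,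
      Nat.add_sub_cancel_left]
    refine mul_le_mul ?_ ?_ (wnorm_nonneg hs0) (by positivity)
    · exact (wnorm_pow_le hs i).trans (pow_le_pow_left₀ hA0' hL2 i)
    · exact (wnorm_pow_le hs _).trans (pow_le_pow_left₀ hA0 hL1 _)
  have hsum := (wnorm_sum_le hs0 (D := D) (b := b) (Finset.range m) fun i =>
    lawSeries m ν (p + z) k ^ i * lawSeries m ν p k ^ (m - 1 - i)).trans (Finset.sum_le_sum hterm)
  rw [Finset.sum_const, Finset.card_range, nsmul_eq_mul] at hsum
  calc _ ≤ x * (m * L ^ (m - 1)) :=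
        (wnorm_mul_le hs).trans (mul_le_mul_of_nonneg_left hsum hx0)
    _ = _ := by rw [hL, mul_pow]; ring

/-! ### The complex neighbourhood on which the probabilities stay bounded -/

lemma norm_coeff_lawSeries (m : ℕ) (ν : Measure ℕ) [IsProbabilityMeasure ν] {p : ℝ}
    (hp : p ∈ Icc (0 : ℝ) 1) (k j : ℕ) :
    ‖PowerSeries.coeff j (lawSeries m ν (p : ℂ) k)‖ = (law m ν p k).real {j} := by
  have h := map_lawSeries (Algebra.ofId ℝ ℂ) m ν p k
  rw [show (Algebra.ofId ℝ ℂ) p = (p : ℂ) from rfl] at h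
  rw [← h, PowerSeries.coeff_map, ← pgf_law m ν hp, coeff_pgf]
  change ‖((law m ν p k).real {j} : ℂ)‖ = _
  rw [Complex.norm_real, Real.norm_of_nonneg measureReal_nonneg]

lemma sum_real_mul_le_integral (μ : Measure ℕ) [IsProbabilityMeasure μ] {f : ℕ → ℝ}
    (hf : Integrable f μ) (hf0 : ∀ j, 0 ≤ f j) (D : ℕ) :
    ∑ j ∈ Finset.range D, μ.real {j} * f j ≤ ∫ x, f x ∂μ := by
  have h : ∑ j ∈ Finset.range D, μ.real {j} * f j =
      ∫ x in (Finset.range D : Set ℕ), f x ∂μ := by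
    rw [setIntegral_finset _ hf.integrableOn]
    rfl
  rw [h]
  exact setIntegral_le_integral hf (ae_of_all _ hf0)

lemma wnorm_lawSeries_le (m : ℕ) (ν : Measure ℕ) [IsProbabilityMeasure ν] {p : ℝ}
    (hp : p ∈ Icc (0 : ℝ) 1) (k D b : ℕ) {s : ℝ} (hs : 1 ≤ s) :
    wnorm D b s (lawSeries m ν (p : ℂ) k) ≤ (truncPoly (law m ν p k) b).eval s := by
  have := isProbabilityMeasure_law m ν hp k
  rw [eval_truncPoly, wnorm]
  simp_rw [norm_coeff_lawSeries m ν hp]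
  refine sum_real_mul_le_integral _ ?_ (fun j => by positivity) D
  refine Integrable.of_bound (Measurable.of_discrete).aestronglyMeasurable (s ^ b)
    (ae_of_all _ fun x => ?_)
  rw [Real.norm_of_nonneg (by positivity)]
  exact pow_le_pow_right₀ hs (min_le_right _ _)

lemma wnorm_lawSeries_le_one_sub (m : ℕ) (ν : Measure ℕ) [IsProbabilityMeasure ν] {p : ℝ}
    (hp : p ∈ Icc (0 : ℝ) 1) (k n : ℕ) :
    wnorm (n + 1) 0 1 (lawSeries m ν (p : ℂ) k) ≤ 1 - (law m ν p k).real {x | n < x} := by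
  have := isProbabilityMeasure_law m ν hp k
  rw [← probReal_compl_eq_one_sub MeasurableSet.of_discrete, wnorm]
  have h : {x : ℕ | n < x}ᶜ = ↑(Finset.range (n + 1)) := by
    ext x; simp
  rw [h, ← sum_measureReal_singleton]
  simp [norm_coeff_lawSeries m ν hp]

lemma sum_tail_mul_pow_le (ν : Measure ℕ) [IsProbabilityMeasure ν] {s : ℝ} (hs : 1 < s)
    (hν : Integrable (fun j : ℕ => s ^ j) ν) (D : ℕ) :
    ∑ j ∈ Finset.range D, ν.real {x | j < x} * s ^ j ≤ (∫ x, s ^ x ∂ν) / (s - 1) := by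
  have h (j : ℕ) : ν.real {x | j < x} * s ^ j =
      ∫ x, Set.indicator {x | j < x} (fun _ => s ^ j) x ∂ν := by
    rw [integral_indicator_const _ MeasurableSet.of_discrete, smul_eq_mul]
  have hint (j : ℕ) : Integrable (Set.indicator {x : ℕ | j < x} fun _ => s ^ j) ν :=
    (integrable_const _).indicator MeasurableSet.of_discrete
  simp_rw [h]
  rw [← integral_finsetSum _ fun j _ => hint j, ← integral_div]
  refine integral_mono (integrable_finsetSum _ fun j _ => hint j) (hν.div_const _) fun x => ?_
  have h1 : ∑ j ∈ Finset.range D, Set.indicator {x : ℕ | j < x} (fun _ => s ^ j) x ≤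
      ∑ j ∈ Finset.range x, s ^ j := by
    simp only [Set.indicator, mem_ofPred_eq]
    rw [← Finset.sum_filter]
    refine Finset.sum_le_sum_of_subset_of_nonneg (fun j hj => ?_) fun j _ _ => by positivity
    exact Finset.mem_range.2 (Finset.mem_filter.1 hj).2
  refine h1.trans ?_
  rw [geom_sum_eq hs.ne']
  exact div_le_div_of_nonneg_right (by linarith) (by linarith)

lemma wnorm_perturb_zero_le (m : ℕ) (ν : Measure ℕ) [IsProbabilityMeasure ν] (p z : ℂ) {s : ℝ}
    (hs : 1 < s) (hν : Integrable (fun j : ℕ => s ^ j) ν) (D b : ℕ) :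
    wnorm D b s (perturb m ν p z 0) ≤ ‖z‖ * ((∫ x, s ^ x ∂ν) / (s - 1)) := by
  refine le_trans ?_ (mul_le_mul_of_nonneg_left (sum_tail_mul_pow_le ν hs hν D) (norm_nonneg z))
  rw [wnorm, Finset.mul_sum]
  refine Finset.sum_le_sum fun j _ => ?_
  rw [perturb, PowerSeries.coeff_C_mul, PowerSeries.coeff_mk, norm_mul, Complex.norm_real,
    Real.norm_of_nonneg measureReal_nonneg, mul_assoc]
  gcongr
  · exact hs.le
  · exact min_le_left _ _

/-- A quantity that is multiplied at each step by `a k`, up to a correction that is small as long as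
the quantity itself is small, stays small if the product of the `a k` allows it. -/
lemma le_of_step_le {x a : ℕ → ℝ} {L q : ℕ} {c κ ζ : ℝ} (hx : ∀ k, 0 ≤ x k) (ha : ∀ k, 1 ≤ a k)
    (hc : 0 ≤ c) (hκ : 0 ≤ κ) (hζ : (1 + c * ζ) ^ q ≤ Real.exp κ)
    (hstep : ∀ k < L, x (k + 1) ≤ a k * (1 + c * x k) ^ q * x k)
    (h0 : x 0 * (Real.exp (κ * L) * ∏ i ∈ Finset.range L, a i) ≤ ζ) : ∀ k ≤ L, x k ≤ ζ := by
  have ha0 (k : ℕ) : 0 ≤ a k := by linarith [ha k]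
  have hsmall (k : ℕ) (hk : k ≤ L) :
      x 0 * (Real.exp (κ * k) * ∏ i ∈ Finset.range k, a i) ≤ ζ := by
    refine le_trans (mul_le_mul_of_nonneg_left ?_ (hx 0)) h0
    have h1 : ∏ i ∈ Finset.range k, a i ≤ ∏ i ∈ Finset.range L, a i :=
      Finset.prod_le_prod_of_subset_of_one_le (Finset.range_mono hk) (fun i _ => ha0 i)
        fun i _ _ => ha i
    have h2 : 0 ≤ ∏ i ∈ Finset.range k, a i := Finset.prod_nonneg fun i _ => ha0 i
    have hkL : (k : ℝ) ≤ L := by exact_mod_cast hk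
    gcongr
  have key (k : ℕ) (hk : k ≤ L) :
      x k ≤ x 0 * (Real.exp (κ * k) * ∏ i ∈ Finset.range k, a i) := by
    induction k with
    | zero => simp
    | succ k ih =>
      have ihk := ih (by omega)
      have h1 : (1 + c * x k) ^ q ≤ Real.exp κ := by
        refine le_trans (pow_le_pow_left₀ (by have := mul_nonneg hc (hx k); linarith) ?_ q) hζ
        have := mul_le_mul_of_nonneg_left (ihk.trans (hsmall k (by omega))) hc
        linarith
      calc x (k + 1) ≤ a k * (1 + c * x k) ^ q * x k := hstep k (by omega)
        _ ≤ a k * Real.exp κ * (x 0 * (Real.exp (κ * k) * ∏ i ∈ Finset.range k, a i)) :=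
          mul_le_mul (mul_le_mul_of_nonneg_left h1 (ha0 k)) ihk (hx k)
            (mul_nonneg (ha0 k) (Real.exp_pos _).le)
        _ = _ := by
          rw [Finset.prod_range_succ, Nat.cast_succ, mul_add, Real.exp_add, mul_one]
          ring
  exact fun k hk => (key k hk).trans (hsmall k hk)

/-- Weak form of the recursion for the perturbation, with the weights truncated at a height that
decreases with time until it vanishes at time `N`. -/
lemma wnorm_perturb_succ_le (m : ℕ) (ν : Measure ℕ) [IsProbabilityMeasure ν] {p : ℝ}
    (hp : p ∈ Icc (0 : ℝ) 1) (z : ℂ) (N k D : ℕ) {s : ℝ} (hs : 1 ≤ s) :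
    wnorm D (N - (k + 1)) s (perturb m ν p z (k + 1)) ≤
      (if k < N then m / s * (truncPoly (law m ν p k) (N - k)).eval s ^ (m - 1) else m) *
        (1 + (1 + s) * wnorm (D + 1) (N - k) s (perturb m ν p z k)) ^ (m - 1) *
        wnorm (D + 1) (N - k) s (perturb m ν p z k) := by
  have hs0 : 0 < s := by linarith
  have := isProbabilityMeasure_law m ν hp k
  have hG : 1 ≤ (truncPoly (law m ν p k) (N - k)).eval s := by
    have hnn (j : ℕ) : 0 ≤ (truncPoly (law m ν p k) (N - k)).coeff j := by
      rw [coeff_truncPoly]; exact measureReal_nonneg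
    have h1 : ex (truncPoly (law m ν p k) (N - k)) (fun _ => 1) = 1 := by
      rw [ex_truncPoly]; simp
    rw [← h1, ← ex_pow]
    exact ex_mono hnn fun j => one_le_pow₀ hs
  have hmain := wnorm_perturb_mul_le m ν (p : ℂ) z k hs hG
    (wnorm_lawSeries_le m ν hp k (D + 1) (N - k) hs)
  split_ifs with hk
  · have hsh := (wnorm_shift_le (D := D) (b := N - k) hs0.le (by omega)).trans hmain
    rw [show N - (k + 1) = N - k - 1 by omega]
    rw [← le_div_iff₀' hs0] at hsh
    refine hsh.trans (le_of_eq ?_)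
    ring
  · have hb : N - k = 0 := by omega
    have hb' : N - (k + 1) = 0 := by omega
    rw [hb']
    rw [hb] at hmain ⊢
    have h1 : (truncPoly (law m ν p k) 0).eval s = 1 := by rw [eval_truncPoly]; simp
    rw [h1, one_pow, mul_one] at hmain
    exact (wnorm_shift_le_zero hs0.le).trans hmain

lemma exists_sq_le_exp {κ : ℝ} (hκ : 0 < κ) :
    ∃ C : ℝ, 0 < C ∧ ∀ n : ℕ, ((n : ℝ) + 1) ^ 2 ≤ C * Real.exp (κ * n) := by
  refine ⟨2 / κ ^ 2 * Real.exp κ, by positivity, fun n => ?_⟩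
  have h := Real.pow_div_factorial_le_exp (κ * (n + 1)) (by positivity) 2
  rw [mul_add, mul_one, Real.exp_add] at h
  have h2 : (κ * n + κ) ^ 2 = κ ^ 2 * ((n : ℝ) + 1) ^ 2 := by ring
  rw [h2] at h
  rw [div_mul_eq_mul_div, div_mul_eq_mul_div, le_div_iff₀ (by positivity)]
  norm_num [Nat.factorial] at h
  nlinarith

lemma law_eq_iterate (m : ℕ) (ν : Measure ℕ) (p : ℝ) (k l : ℕ) :
    law m ν p (k + l) = (step m)^[l] (law m ν p k) := by
  induction l with
  | zero => rfl
  | succ l ih => rw [Function.iterate_succ_apply', ← ih]; rfl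

/-- Once the mass below `n` is less than `1 / 2`, a small perturbation of the law has norm at most
`1` there, and this persists. -/
lemma norm_coeff_zero_le_one (m : ℕ) {A : ℕ → PowerSeries ℂ}
    (hA : ∀ k, A (k + 1) = stepSeries m (A k))
    {K n : ℕ} (hK : K ≤ n) (h : wnorm (n + 1 - K) 0 1 (A K) ≤ 1) :
    ‖PowerSeries.coeff 0 (A n)‖ ≤ 1 := by
  have key (k : ℕ) (hk : K ≤ k) (hkn : k ≤ n) : wnorm (n + 1 - k) 0 1 (A k) ≤ 1 := by
    induction k, hk using Nat.le_induction with
    | base => exact h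
    | succ k hk ih =>
      have h1 := wnorm_stepSeries_le m (n + 1 - (k + 1)) (A k)
      rw [show n + 1 - (k + 1) + 1 = n + 1 - k by omega, ← hA] at h1
      exact h1.trans (pow_le_one₀ (wnorm_nonneg zero_le_one) (ih (by omega)))
  have h1 := key n hK le_rfl
  rw [Nat.add_sub_cancel_left] at h1
  rwa [norm_coeff_zero_le_wnorm (b := 0) (s := 1)]

/-- As long as the system has not exploded, the tails are of order `m ^ (-j)`. -/
lemma tail_le_of_lt_half {m : ℕ} (hm : 2 ≤ m) (ν : Measure ℕ) [IsProbabilityMeasure ν] {p : ℝ}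
    (hp : p ∈ Icc (0 : ℝ) 1) {n i K : ℕ} (hi : 16 * ((n : ℝ) + 1) ^ 2 ≤ (m : ℝ) ^ i)
    (hKn : K ≤ n + 1) (hK : ∀ k < K, (law m ν p k).real {x | n < x} < 1 / 2)
    {k j : ℕ} (hk : k ≤ K - 1 - i) (hj : j ≤ K - 1 - i - k) :
    (law m ν p k).real {x | j < x} * (m : ℝ) ^ j ≤ 2 := by
  have := isProbabilityMeasure_law m ν hp k
  rcases Nat.eq_zero_or_pos (K - 1 - i) with h | h
  · obtain rfl : j = 0 := by omega
    have := measureReal_le_one (μ := law m ν p k) (s := {x | 0 < x})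
    rw [pow_zero, mul_one]
    linarith
  · by_contra! hcon
    have h1 := half_le_iterate_step_real_gt hm (law m ν p k) (n := n) (by omega) hi hcon.le
    rw [← law_eq_iterate] at h1
    exact absurd h1 (not_le.2 (hK _ (by omega)))

/-- The key analytic input: `P(X n = 0)`, as a polynomial in the parameter, is bounded on complex
discs of subexponentially small radius around the points of `[0, 1]`. -/
lemma exists_norm_coeff_zero_le {m : ℕ} (hm : 2 ≤ m) (ν : Measure ℕ) [IsProbabilityMeasure ν]
    (hν_two : 0 < ν {j | 2 ≤ j})
    (hν_exp : ∀ s : ℝ, |s| < m → Integrable (fun j : ℕ => s ^ j) ν) {κ : ℝ} (hκ : 0 < κ) :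
    ∃ c : ℝ, 0 < c ∧ ∀ (n : ℕ), ∀ p ∈ Icc (0 : ℝ) 1, ∀ z : ℂ, ‖z‖ ≤ c * Real.exp (-(κ * n)) →
      ‖PowerSeries.coeff 0 (lawSeries m ν ((p : ℂ) + z) n)‖ ≤ 2 := by
  have hm2 : (2 : ℝ) ≤ m := by exact_mod_cast hm
  obtain ⟨δ, hδ, rfl⟩ : ∃ δ, 0 < δ ∧ κ = 3 * δ := ⟨κ / 3, by positivity, by ring⟩
  obtain ⟨c₀, hc₀, hc₁, hone⟩ := exists_law_real_one_le ν hν_two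
  obtain ⟨s, hs1, hsm, C, hC, hprod⟩ := exists_prod_le hm hc₀ hc₁ hδ
  obtain ⟨C₂, hC₂, hsq⟩ := exists_sq_le_exp hδ
  set Cs := (∫ x, s ^ x ∂ν) / (s - 1) with hCs
  have hexp : Integrable (fun j : ℕ => s ^ j) ν := hν_exp s (by rwa [abs_of_pos (by linarith)])
  have hCs0 : 0 ≤ Cs :=
    div_nonneg (integral_nonneg fun x => by have : 0 < s := by linarith
                                            positivity) (by linarith)
  -- a size of the perturbation below which its nonlinear effects are negligible
  set ζ : ℝ := min (1 / (2 * (1 + m))) (δ / (m * (1 + m))) with hζ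
  have hζ0 : 0 < ζ := by positivity
  have hζ1 : (1 + s) * ζ ≤ 1 / 2 := by
    have h1 : ζ ≤ 1 / (2 * (1 + m)) := min_le_left _ _
    rw [le_div_iff₀ (by positivity)] at h1
    nlinarith
  have hζ2 : (1 + (1 + s) * ζ) ^ (m - 1) ≤ Real.exp δ := by
    have h1 : ζ ≤ δ / (m * (1 + m)) := min_le_right _ _
    rw [le_div_iff₀ (by positivity)] at h1
    have h2 : 1 + (1 + s) * ζ ≤ Real.exp ((1 + s) * ζ) := by
      linarith [Real.add_one_le_exp ((1 + s) * ζ)]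
    refine (pow_le_pow_left₀ (by positivity) h2 _).trans ?_
    rw [← Real.exp_nat_mul, Real.exp_le_exp]
    have h3 : ((m - 1 : ℕ) : ℝ) ≤ m := by exact_mod_cast Nat.sub_le m 1
    calc ((m - 1 : ℕ) : ℝ) * ((1 + s) * ζ) ≤ m * ((1 + m) * ζ) := by gcongr
      _ ≤ δ := by linarith
  set Q := C * (16 * m ^ 2 * C₂) with hQ
  have hQ0 : 0 < Q := by positivity
  refine ⟨ζ / ((Cs + 1) * Q), by positivity, fun n p hp z hz => ?_⟩
  -- a time `i` that is long enough for an explosion above height `n`, but only logarithmic in `n`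
  obtain ⟨i, hi1, hi2⟩ : ∃ i : ℕ, 16 * ((n : ℝ) + 1) ^ 2 ≤ (m : ℝ) ^ i ∧
      (m : ℝ) ^ i ≤ m * (16 * ((n : ℝ) + 1) ^ 2) := by
    have hn0 : (0 : ℝ) ≤ n := n.cast_nonneg
    obtain ⟨i, h1, h2⟩ := exists_nat_pow_near (x := 16 * ((n : ℝ) + 1) ^ 2) (y := (m : ℝ))
      (by nlinarith) (by linarith)
    exact ⟨i + 1, h2.le, by rw [pow_succ']; gcongr⟩
  -- the explosion time, capped at `n + 1`
  obtain ⟨K, hKn, hK1, hK2⟩ : ∃ K ≤ n + 1, (∀ k < K, (law m ν p k).real {x | n < x} < 1 / 2) ∧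
      (K ≤ n → 1 / 2 ≤ (law m ν p K).real {x | n < x}) := by
    classical
    by_cases h : ∃ k, k ≤ n ∧ 1 / 2 ≤ (law m ν p k).real {x | n < x}
    · refine ⟨Nat.find h, (Nat.find_spec h).1.trans (Nat.le_succ n), fun k hk => ?_,
        fun _ => (Nat.find_spec h).2⟩
      have h1 := Nat.find_min h hk
      push Not at h1
      exact h1 (hk.le.trans (Nat.find_spec h).1)
    · push Not at h
      exact ⟨n + 1, le_rfl, fun k hk => h k (by omega), fun h => absurd h (by omega)⟩
  set N := K - 1 - i with hN
  have hprob (k : ℕ) : IsProbabilityMeasure (law m ν p k) := isProbabilityMeasure_law m ν hp k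
  have hflow : TruncatedFlow m N fun k => truncPoly (law m ν p k) (N - k) :=
    truncatedFlow_truncPoly hm (fun k => law m ν p k) (fun k => rfl) N
      fun k hk j hj => tail_le_of_lt_half hm ν hp hi1 hKn hK1 hk hj
  have hprodN := hprod N _ hflow (by
    rintro rfl k hk
    rw [coeff_one_truncPoly _ (by omega)]
    exact hone p hp k)
  set a : ℕ → ℝ := fun k =>
    if k < N then m / s * (truncPoly (law m ν p k) (N - k)).eval s ^ (m - 1) else m with ha
  have hs0 : 0 < s := by linarith
  have ha1 (k : ℕ) : 1 ≤ a k := by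
    simp only [ha]
    split_ifs with h
    · have h1 : 1 ≤ (m : ℝ) / s := by rw [le_div_iff₀ hs0]; linarith
      have h2 := one_le_pow₀ (n := m - 1) (hflow.one_le_eval hs1.le k)
      exact one_le_mul_of_one_le_of_one_le h1 h2
    · linarith
  set L := min K n with hL
  have haL : ∏ k ∈ Finset.range L, a k ≤ C * Real.exp (δ * N) * (m : ℝ) ^ (i + 1) := by
    have h1 : ∏ k ∈ Finset.range L, a k ≤ ∏ k ∈ Finset.range (N + (i + 1)), a k :=
      Finset.prod_le_prod_of_subset_of_one_le (Finset.range_mono (by omega))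
        (fun k _ => by linarith [ha1 k]) fun k _ _ => ha1 k
    refine h1.trans ?_
    rw [Finset.prod_range_add]
    have h2 : ∏ k ∈ Finset.range N, a k =
        ∏ k ∈ Finset.range N, ((m : ℝ) / s *
          (truncPoly (law m ν p k) (N - k)).eval s ^ (m - 1)) :=
      Finset.prod_congr rfl fun k hk => if_pos (Finset.mem_range.1 hk)
    have h3 : ∏ k ∈ Finset.range (i + 1), a (N + k) = (m : ℝ) ^ (i + 1) := by
      rw [Finset.prod_congr rfl fun k _ => if_neg (by omega : ¬ N + k < N)]
      simp
    rw [h2, h3]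
    gcongr
  set x : ℕ → ℝ := fun k => wnorm (n + 1 - k) (N - k) s (perturb m ν p z k) with hx
  have hx0 (k : ℕ) : 0 ≤ x k := wnorm_nonneg hs0.le
  have hsmall : ∀ k ≤ L, x k ≤ ζ := by
    refine le_of_step_le hx0 ha1 (by linarith : 0 ≤ 1 + s) hδ.le hζ2 (fun k hk => ?_) ?_
    · have h1 := wnorm_perturb_succ_le m ν hp z N k (n + 1 - (k + 1)) hs1.le
      rw [show n + 1 - (k + 1) + 1 = n + 1 - k by omega] at h1
      exact h1
    · have h1 : x 0 ≤ ‖z‖ * Cs := wnorm_perturb_zero_le m ν p z hs1 hexp _ _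
      have hLn : (L : ℝ) ≤ n := by exact_mod_cast (min_le_right K n)
      have hNn : (N : ℝ) ≤ n := by exact_mod_cast (by omega : N ≤ n)
      have h2 : Real.exp (δ * L) * ∏ k ∈ Finset.range L, a k ≤ Q * Real.exp (3 * δ * n) := by
        calc Real.exp (δ * L) * ∏ k ∈ Finset.range L, a k
            ≤ Real.exp (δ * n) * (C * Real.exp (δ * n) *
                (m * (m * (16 * (C₂ * Real.exp (δ * n)))))) := by
              refine mul_le_mul (Real.exp_le_exp.2 (by gcongr)) (haL.trans ?_)
                (Finset.prod_nonneg fun k _ => by linarith [ha1 k]) (Real.exp_pos _).le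
              rw [pow_succ']
              gcongr
              exact hi2.trans (by gcongr; exact hsq n)
          _ = Q * Real.exp (3 * δ * n) := by
              rw [show 3 * δ * n = δ * n + δ * n + δ * n by ring, Real.exp_add, Real.exp_add, hQ]
              ring
      have h3 : 0 ≤ Real.exp (δ * L) * ∏ k ∈ Finset.range L, a k :=
        mul_nonneg (Real.exp_pos _).le (Finset.prod_nonneg fun k _ => by linarith [ha1 k])
      calc x 0 * (Real.exp (δ * L) * ∏ k ∈ Finset.range L, a k)
          ≤ (ζ / ((Cs + 1) * Q) * Real.exp (-(3 * δ * n)) * Cs) * (Q * Real.exp (3 * δ * n)) :=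
            mul_le_mul (h1.trans (by gcongr)) h2 h3 (by positivity)
        _ = ζ * (Cs / (Cs + 1)) * (Real.exp (-(3 * δ * n)) * Real.exp (3 * δ * n)) := by
            field_simp
        _ = ζ * (Cs / (Cs + 1)) := by rw [← Real.exp_add]; simp
        _ ≤ ζ * 1 := by
            gcongr
            rw [div_le_one (by linarith)]
            linarith
        _ = ζ := mul_one ζ
  have hdelta (k : ℕ) (hk : k ≤ L) :
      wnorm (n + 1 - k) 0 1 ((PowerSeries.X - 1) * perturb m ν p z k) ≤ 1 / 2 := by
    refine (wnorm_zero_le (b := N - k) hs1.le).trans ((wnorm_mul_le hs1.le).trans ?_)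
    calc _ ≤ (1 + s) * ζ :=
          mul_le_mul (wnorm_X_sub_one_le hs1.le) (hsmall k hk) (hx0 k) (by linarith)
      _ ≤ 1 / 2 := hζ1
  by_cases hKn' : K ≤ n
  · refine (norm_coeff_zero_le_one m (A := fun k => lawSeries m ν ((p : ℂ) + z) k) (fun k => rfl)
      hKn' ?_).trans one_le_two
    rw [lawSeries_add]
    have h1 : wnorm (n + 1 - K) 0 1 (lawSeries m ν (p : ℂ) K) ≤ 1 / 2 := by
      refine (wnorm_mono_left zero_le_one (Nat.sub_le _ _)).trans
        ((wnorm_lawSeries_le_one_sub m ν hp K n).trans ?_)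
      linarith [hK2 hKn']
    linarith [wnorm_add_le (D := n + 1 - K) (b := 0) (f := lawSeries m ν (p : ℂ) K)
      (g := (PowerSeries.X - 1) * perturb m ν p z K) zero_le_one, hdelta K (by omega)]
  · have h1 := hdelta n (by omega)
    rw [Nat.add_sub_cancel_left, ← norm_coeff_zero_le_wnorm] at h1
    rw [lawSeries_add, map_add]
    refine (norm_add_le _ _).trans ?_
    rw [norm_coeff_lawSeries m ν hp]
    linarith [measureReal_le_one (μ := law m ν p n) (s := {0})]

/-! ### Series of polynomials with summable derivatives on a closed interval -/

/-- Term-by-term differentiation on a convex set, at boundary points as well. -/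
lemma hasDerivWithinAt_tsum_of_convex {s : Set ℝ} (hs : Convex ℝ s) {f f' : ℕ → ℝ → ℝ}
    {u : ℕ → ℝ} (hu : Summable u)
    (hf : ∀ n, ∀ y ∈ s, HasDerivWithinAt (f n) (f' n y) s y)
    (hb : ∀ n, ∀ y ∈ s, ‖f' n y‖ ≤ u n) (hsum : ∀ y ∈ s, Summable fun n => f n y)
    {p : ℝ} (hp : p ∈ s) :
    HasDerivWithinAt (fun y => ∑' n, f n y) (∑' n, f' n p) s p := by
  rw [hasDerivWithinAt_iff_tendsto_slope]
  have hlim := tendsto_tsum_of_dominated_convergence (𝓕 := 𝓝[s \ {p}] p)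
    (f := fun y n => slope (f n) p y) (g := fun n => f' n p) hu
    (fun n => hasDerivWithinAt_iff_tendsto_slope.1 (hf n p hp)) (by
      filter_upwards [self_mem_nhdsWithin] with y hy n
      have hyp : 0 < |y - p| := abs_pos.2 (sub_ne_zero.2 hy.2)
      have h := hs.norm_image_sub_le_of_norm_hasDerivWithin_le (hf n) (hb n) hp hy.1
      rw [slope_def_field, norm_div]
      exact (div_le_iff₀ hyp).2 h)
  refine hlim.congr' ?_
  filter_upwards [self_mem_nhdsWithin] with y hy
  simp only [slope_def_field]
  rw [tsum_div_const, (hsum y hy.1).tsum_sub (hsum p hp)]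

lemma iteratedDeriv_aeval {𝕜 : Type*} [NontriviallyNormedField 𝕜] [NormedAlgebra ℝ 𝕜]
    (q : Polynomial ℝ) (k : ℕ) :
    iteratedDeriv k (fun w : 𝕜 => Polynomial.aeval w q) =
      fun w => Polynomial.aeval w (Polynomial.derivative^[k] q) := by
  induction k with
  | zero => rw [iteratedDeriv_zero]; rfl
  | succ k ih =>
    rw [iteratedDeriv_succ, ih, Function.iterate_succ_apply']
    funext w
    exact Polynomial.deriv_aeval _

lemma iteratedDerivWithin_eval (q : Polynomial ℝ) (k : ℕ) {p : ℝ} (hp : p ∈ Icc (0 : ℝ) 1) :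
    iteratedDerivWithin k (fun y => q.eval y) (Icc 0 1) p =
      (Polynomial.derivative^[k] q).eval p := by
  have h := iteratedDerivWithin_eq_iteratedDeriv (n := k) (uniqueDiffOn_Icc zero_lt_one)
    (Polynomial.contDiff_aeval (𝕜 := ℝ) q k).contDiffAt hp
  rw [iteratedDeriv_aeval] at h
  simpa only [Polynomial.coe_aeval_eq_eval] using h

/-- Each series of `k`-th derivatives converges normally on `[0, 1]`. -/
def NormallySummable (q : ℕ → Polynomial ℝ) : Prop :=
  ∀ k : ℕ, ∃ u : ℕ → ℝ, Summable u ∧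
    ∀ n, ∀ p ∈ Icc (0 : ℝ) 1, ‖(Polynomial.derivative^[k] (q n)).eval p‖ ≤ u n

section series

variable {q : ℕ → Polynomial ℝ}

lemma summable_eval_derivative (hq : NormallySummable q) (k : ℕ) {p : ℝ}
    (hp : p ∈ Icc (0 : ℝ) 1) :
    Summable fun n => (Polynomial.derivative^[k] (q n)).eval p := by
  obtain ⟨u, hu, hb⟩ := hq k
  exact Summable.of_norm_bounded hu fun n => hb n p hp

lemma hasDerivWithinAt_tsum_eval (hq : NormallySummable q) (k : ℕ) {p : ℝ}
    (hp : p ∈ Icc (0 : ℝ) 1) :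
    HasDerivWithinAt (fun y => ∑' n, (Polynomial.derivative^[k] (q n)).eval y)
      (∑' n, (Polynomial.derivative^[k + 1] (q n)).eval p) (Icc 0 1) p := by
  obtain ⟨u, hu, hb⟩ := hq (k + 1)
  refine hasDerivWithinAt_tsum_of_convex (convex_Icc 0 1) hu (fun n y _ => ?_) hb
    (fun y hy => summable_eval_derivative hq k hy) hp
  rw [Function.iterate_succ_apply']
  exact (Polynomial.hasDerivAt _ y).hasDerivWithinAt

lemma iteratedDerivWithin_tsum_eval (hq : NormallySummable q) (k : ℕ) {p : ℝ}
    (hp : p ∈ Icc (0 : ℝ) 1) :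
    iteratedDerivWithin k (fun y => ∑' n, (q n).eval y) (Icc 0 1) p =
      ∑' n, (Polynomial.derivative^[k] (q n)).eval p := by
  induction k generalizing p with
  | zero => simp
  | succ k ih =>
    rw [iteratedDerivWithin_succ, derivWithin_congr (fun y hy => ih hy) (ih hp)]
    exact (hasDerivWithinAt_tsum_eval hq k hp).derivWithin (uniqueDiffOn_Icc zero_lt_one p hp)

lemma contDiffOn_tsum_eval (hq : NormallySummable q) :
    ContDiffOn ℝ ∞ (fun y => ∑' n, (q n).eval y) (Icc 0 1) := by
  refine contDiffOn_of_differentiableOn_deriv fun k _ p hp => ?_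
  exact (hasDerivWithinAt_tsum_eval hq k hp).differentiableWithinAt.congr
    (fun y hy => iteratedDerivWithin_tsum_eval hq k hy) (iteratedDerivWithin_tsum_eval hq k hp)

end series

/-! ### Derivatives of the powers of the probabilities -/

/-- The polynomial in `p` that gives `m ^ (-(n + 1)) P(X n = 0) ^ m`. -/
noncomputable def termPoly (m : ℕ) (ν : Measure ℕ) (n : ℕ) : Polynomial ℝ :=
  Polynomial.C (1 / (m : ℝ) ^ (n + 1)) * zeroPoly m ν n ^ m

lemma term_eq_eval (m : ℕ) (ν : Measure ℕ) [IsProbabilityMeasure ν] (k n : ℕ) {p : ℝ}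
    (hp : p ∈ Icc (0 : ℝ) 1) :
    term m ν k n p = (Polynomial.derivative^[k] (termPoly m ν n)).eval p := by
  have h : EqOn (fun y => probZero m ν n y ^ m) (fun y => (zeroPoly m ν n ^ m).eval y)
      (Icc 0 1) := fun y hy => by
    simp only [Polynomial.eval_pow, probZero_eq_eval m ν hy]
  rw [term, iteratedDerivWithin_congr h hp, iteratedDerivWithin_eval _ _ hp, termPoly,
    Polynomial.iterate_derivative_C_mul, Polynomial.eval_mul, Polynomial.eval_C]

/-- Cauchy's estimate on the discs provided by `exists_norm_coeff_zero_le`, with a rate that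
depends on the order of the derivative. -/
lemma normallySummable_termPoly {m : ℕ} (hm : 2 ≤ m) (ν : Measure ℕ)
    [IsProbabilityMeasure ν] (hν_two : 0 < ν {j | 2 ≤ j})
    (hν_exp : ∀ s : ℝ, |s| < m → Integrable (fun j : ℕ => s ^ j) ν) :
    NormallySummable (termPoly m ν) := by
  intro k
  have hm2 : (2 : ℝ) ≤ m := by exact_mod_cast hm
  set κ : ℝ := Real.log (3 / 2) / (k + 1) with hκ
  have hκ0 : 0 < κ := div_pos (Real.log_pos (by norm_num)) (by positivity)
  have hκk : Real.exp (κ * k) ≤ 3 / 2 := by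
    have h1 : κ * k ≤ Real.log (3 / 2) := by
      have h2 : κ * (k + 1) = Real.log (3 / 2) := by
        rw [hκ]; field_simp
      linarith
    calc Real.exp (κ * k) ≤ Real.exp (Real.log (3 / 2)) := Real.exp_le_exp.2 h1
      _ = 3 / 2 := Real.exp_log (by norm_num)
  obtain ⟨c, hc, hbound⟩ := exists_norm_coeff_zero_le hm ν hν_two hν_exp hκ0
  refine ⟨fun n => k.factorial * 2 ^ m / c ^ k * (3 / 4 : ℝ) ^ n,
    (summable_geometric_of_lt_one (by norm_num) (by norm_num)).mul_left _, fun n p hp => ?_⟩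
  set r := c * Real.exp (-(κ * n)) with hr
  have hr0 : 0 < r := by positivity
  have hcauchy := Complex.norm_iteratedDeriv_le_of_forall_mem_sphere_norm_le (c := (p : ℂ))
    (f := fun w : ℂ => Polynomial.aeval w (zeroPoly m ν n ^ m)) (C := 2 ^ m) k hr0
    (Polynomial.differentiable_aeval _).diffContOnCl (fun w hw => by
      have hw' : ‖w - p‖ ≤ r := (mem_sphere_iff_norm.1 hw).le
      have h1 := hbound n p hp (w - p) hw'
      rw [add_sub_cancel] at h1
      rw [map_pow, aeval_zeroPoly, norm_pow]
      exact pow_le_pow_left₀ (norm_nonneg _) h1 m)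
  rw [iteratedDeriv_aeval] at hcauchy
  have hreal (Q : Polynomial ℝ) : ‖Polynomial.aeval (p : ℂ) Q‖ = ‖Q.eval p‖ := by
    rw [show (p : ℂ) = algebraMap ℝ ℂ p from rfl, Polynomial.aeval_algebraMap_apply,
      Polynomial.coe_aeval_eq_eval]
    exact Complex.norm_real _
  rw [hreal] at hcauchy
  rw [termPoly, Polynomial.iterate_derivative_C_mul, Polynomial.eval_mul, Polynomial.eval_C,
    norm_mul, Real.norm_of_nonneg (by positivity)]
  have hexp : (Real.exp (-(κ * n)) ^ k)⁻¹ ≤ (3 / 2 : ℝ) ^ n := by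
    rw [← Real.exp_nat_mul, ← Real.exp_neg]
    calc Real.exp (-(k * -(κ * n))) = Real.exp (κ * k) ^ n := by
          rw [← Real.exp_nat_mul]; congr 1; ring
      _ ≤ _ := by gcongr
  have hmn : 1 / (m : ℝ) ^ (n + 1) ≤ (1 / 2) ^ n := by
    rw [one_div_pow]
    refine one_div_le_one_div_of_le (by positivity) ?_
    calc (2 : ℝ) ^ n ≤ (m : ℝ) ^ n := by gcongr
      _ ≤ (m : ℝ) ^ (n + 1) := pow_le_pow_right₀ (by linarith) (Nat.le_succ n)
  calc _ ≤ (1 / 2 : ℝ) ^ n * (k.factorial * 2 ^ m / c ^ k * (3 / 2 : ℝ) ^ n) := by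
        refine mul_le_mul hmn (hcauchy.trans ?_) (norm_nonneg _) (by positivity)
        rw [hr, mul_pow, ← div_div, div_eq_mul_inv _ (Real.exp (-(κ * n)) ^ k)]
        gcongr
    _ = _ := by
        beta_reduce
        rw [show (3 / 4 : ℝ) = 1 / 2 * (3 / 2) by norm_num, mul_pow]
        ring

/-! ### The free energy -/

lemma integrable_id_law (m : ℕ) (ν : Measure ℕ) [IsProbabilityMeasure ν]
    (hν : Integrable (fun x : ℕ => (x : ℝ)) ν) {p : ℝ} (hp : p ∈ Icc (0 : ℝ) 1) (n : ℕ) :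
    Integrable (fun x : ℕ => (x : ℝ)) (law m ν p n) := by
  induction n with
  | zero =>
    exact ((integrable_dirac (by simp)).smul_measure ENNReal.ofReal_ne_top).add_measure
      (hν.smul_measure ENNReal.ofReal_ne_top)
  | succ n ih =>
    have := isProbabilityMeasure_law m ν hp n
    exact integrable_id_step m _ ih

lemma mean_zero (m : ℕ) (ν : Measure ℕ)
    (hν : Integrable (fun x : ℕ => (x : ℝ)) ν) {p : ℝ} (hp : p ∈ Icc (0 : ℝ) 1) :
    mean m ν 0 p = p * ∫ x, (x : ℝ) ∂ν := by
  rw [mean, law, initLaw, integral_add_measure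
    ((integrable_dirac (by simp)).smul_measure ENNReal.ofReal_ne_top)
    (hν.smul_measure ENNReal.ofReal_ne_top), integral_smul_measure, integral_smul_measure,
    integral_dirac, ENNReal.toReal_ofReal hp.1]
  simp

lemma mean_succ (m : ℕ) (ν : Measure ℕ) [IsProbabilityMeasure ν]
    (hν : Integrable (fun x : ℕ => (x : ℝ)) ν) {p : ℝ} (hp : p ∈ Icc (0 : ℝ) 1) (n : ℕ) :
    mean m ν (n + 1) p = m * mean m ν n p - 1 + probZero m ν n p ^ m := by
  have := isProbabilityMeasure_law m ν hp n
  exact integral_id_step m _ (integrable_id_law m ν hν hp n)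

lemma mean_div_pow {m : ℕ} (hm : 2 ≤ m) (ν : Measure ℕ) [IsProbabilityMeasure ν]
    (hν : Integrable (fun x : ℕ => (x : ℝ)) ν) {p : ℝ} (hp : p ∈ Icc (0 : ℝ) 1) (n : ℕ) :
    mean m ν n p / (m : ℝ) ^ n = mean m ν 0 p - 1 / ((m : ℝ) - 1) +
      (1 / ((m : ℝ) - 1)) * (1 / (m : ℝ)) ^ n +
      ∑ l ∈ Finset.range n, (termPoly m ν l).eval p := by
  have hm2 : (2 : ℝ) ≤ m := by exact_mod_cast hm
  have hm1 : (m : ℝ) - 1 ≠ 0 := by linarith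
  have hm0 : (m : ℝ) ≠ 0 := by linarith
  induction n with
  | zero => simp
  | succ n ih =>
    have h : mean m ν (n + 1) p / (m : ℝ) ^ (n + 1) = mean m ν n p / (m : ℝ) ^ n -
        1 / (m : ℝ) ^ (n + 1) + (termPoly m ν n).eval p := by
      rw [mean_succ m ν hν hp, termPoly, Polynomial.eval_mul, Polynomial.eval_C,
        Polynomial.eval_pow, probZero_eq_eval m ν hp]
      field_simp
      ring
    rw [h, ih, Finset.sum_range_succ, one_div_pow, one_div_pow]
    field_simp
    ring

lemma integrable_id_of_integrable_pow {m : ℕ} (hm : 2 ≤ m) (ν : Measure ℕ)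
    (hν_exp : ∀ s : ℝ, |s| < m → Integrable (fun j : ℕ => s ^ j) ν) :
    Integrable (fun x : ℕ => (x : ℝ)) ν := by
  have hm2 : (2 : ℝ) ≤ m := by exact_mod_cast hm
  have h := (hν_exp (3 / 2) (by rw [abs_of_pos (by norm_num)]; linarith)).const_mul 2
  refine h.mono (Measurable.of_discrete).aestronglyMeasurable (ae_of_all _ fun x => ?_)
  have h1 := one_add_mul_le_pow (show (-2 : ℝ) ≤ 1 / 2 by norm_num) x
  rw [Real.norm_natCast, Real.norm_of_nonneg (by positivity)]
  norm_num at h1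
  linarith

end DerridaRetaux

theorem theorem1 (m : ℕ) (hm : 2 ≤ m) (ν : Measure ℕ) [IsProbabilityMeasure ν]
    (hν_pos : ν {0} = 0) (hν_two : 0 < ν {j | 2 ≤ j})
    (hν_exp : ∀ s : ℝ, |s| < m → Integrable (fun j : ℕ => s ^ j) ν) :
    -- the quantities involved are well defined
    (∀ p ∈ Icc (0 : ℝ) 1,
      (∀ n, Integrable (fun x : ℕ => (x : ℝ)) (DerridaRetaux.law m ν p n)) ∧
      Tendsto (fun n : ℕ => DerridaRetaux.mean m ν n p / (m : ℝ) ^ n) atTop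
        (𝓝 (DerridaRetaux.freeEnergy m ν p))) ∧
    ContDiffOn ℝ ∞ (DerridaRetaux.mean m ν 0) (Icc 0 1) ∧
    (∀ n, ContDiffOn ℝ ∞ (DerridaRetaux.probZero m ν n) (Icc 0 1)) ∧
    -- the free energy is smooth on `[0, 1]`
    ContDiffOn ℝ ∞ (DerridaRetaux.freeEnergy m ν) (Icc 0 1) ∧
    -- its derivatives are given by uniformly convergent series
    ∀ k : ℕ,
      (∀ p ∈ Icc (0 : ℝ) 1,
        Summable (fun n => DerridaRetaux.term m ν k n p) ∧
        iteratedDerivWithin k (DerridaRetaux.freeEnergy m ν) (Icc 0 1) p =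
          iteratedDerivWithin k (fun q => DerridaRetaux.mean m ν 0 q - 1 / ((m : ℝ) - 1))
            (Icc 0 1) p + ∑' n, DerridaRetaux.term m ν k n p) ∧
      TendstoUniformlyOn (fun N p => ∑ n ∈ Finset.range N, DerridaRetaux.term m ν k n p)
        (fun p => ∑' n, DerridaRetaux.term m ν k n p) atTop (Icc 0 1) := by
  have hm2 : (2 : ℝ) ≤ m := by exact_mod_cast hm
  have hν := DerridaRetaux.integrable_id_of_integrable_pow hm ν hν_exp
  have hq := DerridaRetaux.normallySummable_termPoly hm ν hν_two hν_exp
  have hlim (p : ℝ) (hp : p ∈ Icc (0 : ℝ) 1) :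
      Tendsto (fun n : ℕ => DerridaRetaux.mean m ν n p / (m : ℝ) ^ n) atTop
        (𝓝 (DerridaRetaux.mean m ν 0 p - 1 / ((m : ℝ) - 1) +
          ∑' n, (DerridaRetaux.termPoly m ν n).eval p)) := by
    simp_rw [DerridaRetaux.mean_div_pow hm ν hν hp]
    have h1 : Tendsto (fun n : ℕ => (1 / (m : ℝ)) ^ n) atTop (𝓝 0) :=
      tendsto_pow_atTop_nhds_zero_of_lt_one (by positivity)
        (by rw [div_lt_one (by linarith)]; linarith)
    have h2 := (DerridaRetaux.summable_eval_derivative hq 0 hp).hasSum.tendsto_sum_nat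
    have h3 := ((h1.const_mul (1 / ((m : ℝ) - 1))).const_add
      (DerridaRetaux.mean m ν 0 p - 1 / ((m : ℝ) - 1))).add h2
    rw [mul_zero, add_zero] at h3
    exact h3
  have hF : EqOn (DerridaRetaux.freeEnergy m ν)
      ((fun p => DerridaRetaux.mean m ν 0 p - 1 / ((m : ℝ) - 1)) +
        fun p => ∑' n, (DerridaRetaux.termPoly m ν n).eval p) (Icc 0 1) :=
    fun p hp => (hlim p hp).limUnder_eq
  have hmean : ContDiffOn ℝ ∞ (DerridaRetaux.mean m ν 0) (Icc 0 1) :=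
    (contDiff_id.mul contDiff_const).contDiffOn.congr
      fun p hp => DerridaRetaux.mean_zero m ν hν hp
  have hmean' : ContDiffOn ℝ ∞ (fun p => DerridaRetaux.mean m ν 0 p - 1 / ((m : ℝ) - 1))
      (Icc 0 1) := hmean.sub contDiffOn_const
  have hser := DerridaRetaux.contDiffOn_tsum_eval hq
  refine ⟨fun p hp => ⟨DerridaRetaux.integrable_id_law m ν hν hp, ?_⟩, hmean, fun n => ?_,
    (hmean'.add hser).congr hF, fun k => ⟨fun p hp => ⟨?_, ?_⟩, ?_⟩⟩
  · rw [hF hp]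
    exact hlim p hp
  · refine ContDiffOn.congr (f := fun p => (DerridaRetaux.zeroPoly m ν n).eval p) ?_
      fun p hp => DerridaRetaux.probZero_eq_eval m ν hp n
    exact (Polynomial.contDiff_aeval (𝕜 := ℝ) _ _).contDiffOn
  · simp_rw [DerridaRetaux.term_eq_eval m ν k _ hp]
    exact DerridaRetaux.summable_eval_derivative hq k hp
  · simp_rw [DerridaRetaux.term_eq_eval m ν k _ hp]
    have hk : (k : WithTop ℕ∞) ≤ ∞ := by exact_mod_cast le_top
    rw [iteratedDerivWithin_congr hF hp, iteratedDerivWithin_add hp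
      (uniqueDiffOn_Icc zero_lt_one) ((hmean' p hp).of_le hk) ((hser p hp).of_le hk),
      DerridaRetaux.iteratedDerivWithin_tsum_eval hq k hp]
  · obtain ⟨u, hu, hb⟩ := hq k
    exact tendstoUniformlyOn_tsum_nat hu fun n p hp => by
      rw [DerridaRetaux.term_eq_eval m ν k n hp]
      exact hb n p hp
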